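/- Let $\mathcal A$ be an annulus with boundary components $E_1,E_2$ and a finite triangulation $\mathcal T$, and let $c$ be a conductance function (symmetric, positive on edges). For a function $u$ on the vertices of a network write $\Delta u(x)=\sum_{y\sim x}c(x,y)(u(x)-u(y))$; at a boundary vertex this is the normal derivative of $u$ at $x$. Let $k>0$, and let $g$ be the solution of the discrete Dirichlet problem: $g=k$ on the vertices of $E_1$, $g=0$ on the vertices of $E_2$, $\Delta g=0$ at the other vertices. Put $p=\sum_{u\in E_1}\Delta g(u)$ (the period of the conjugate function $g^*$). Let a slit be given, i.e. a path of edges from $E_1$ to $E_2$ along which $g$ is strictly decreasing, and let $\mathcal Q$ be the triangulated quadrilateral obtained by cutting $\mathcal A$ open along the slit. Its sides are the two copies of the slit, called base and top, and the curves $Q(E_1),Q(E_2)$ over $E_1,E_2$; both copies of a slit edge keep its conductance. Let the harmonic conjugate $h$ be the solution of the discrete Dirichlet–Neumann problem on $\mathcal Q$: $h=0$ on the base, $h=p$ on the top, the normal derivative $\Delta h$ vanishes at the vertices of $Q(E_1)$ and $Q(E_2)$ other than the four corners, and $\Delta h=0$ at the interior vertices. Extend $h$ affinely over edges and triangles. Assume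 that adjacent vertices of $\mathcal Q$ have different $h$-values unless they are joined by an edge of the base or of the top. A level curve of a function on $\mathcal Q$ is a non-empty set on which it takes a given value. The conjugate function $h^*$ on $\mathcal Q$ is defined as follows. Let $S\subset[0,p]$ be a finite set that contains the $h$-values of all vertices of $\mathcal Q$ (further elements of $S$ are $h$-values of additional vertices inserted into edges). The nodes are the vertices of $\mathcal Q$ and the points where an edge with different $h$-values at its ends meets a curve $\{h=s\}$, $s\in S$. For a node $v$ let $M(v)$ be the level curve of $h$ through $v$, and let $\pi(v)=M(v)\cap Q(E_1)$. Put $h^*(v)=0$ if $v\in Q(E_1)$; otherwise $h^*(v)$ is the sum, over all nodes $u$ on the arc of $M(v)$ from $\pi(v)$ to $v$ (both ends included), of the normal derivative of $h$ at $u$ with respect to the part $\{h\le h(v)\}$ of $\mathcal Q$; if $v$ lies on the base, the absolute value of the normal derivative with respect to $\mathcal Q$ is used instead. Here, if a node $u$ is interior to an edge $ab$, the part $au$ of this edge has the conductance $c(a,b)\frac{h(a)-h(b)}{h(a)-h(u)}$. The function $h^*$ is then extended affinely over the pieces of the edges between consecutive nodes, and affinely over the triangles and bilinearly over the trapezoids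 into which the curves $\{h=s\}$, $s\in S$, cut the triangles of $\mathcal Q$. Then $h^*$ exists, and: 1. $Q(E_2)$ is a level curve of $h^*$. 2. Each level curve of $h^*$ is a simple arc that has no end point in the interior of $\mathcal Q$ and joins the base to the top, and any two different level curves of $h^*$ are disjoint. 3. Each level curve of $h^*$ meets each level curve of $h$ in exactly one point. -/

import Mathlib

/-!
Triangulated annuli and their slits, the cut-open quadrilateral, discrete boundary value problems
on it, and the conjugate function of the solution of the Dirichlet-Neumann problem.
-/

/-- A pure two-dimensional abstract simplicial complex with vertex set `V`, given by its
triangles. -/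
structure TriComplex (V : Type*) where
  /-- the triangles (two-dimensional simplices) -/
  tri : Set (Finset V)
  card_tri : ∀ T ∈ tri, T.card = 3
  exists_tri : ∀ v, ∃ T ∈ tri, v ∈ T

namespace TriComplex

variable {V : Type*}

/-- The one-skeleton. -/
def graph (K : TriComplex V) : SimpleGraph V where
  Adj u v := u ≠ v ∧ ∃ T ∈ K.tri, u ∈ T ∧ v ∈ T
  symm := ⟨fun _ _ h => ⟨h.1.symm, h.2.imp fun _ hT => ⟨hT.1, hT.2.2, hT.2.1⟩⟩⟩
  loopless := ⟨fun _ h => h.1 rfl⟩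

/-- `u` and `v` are joined by a boundary edge: an edge that lies in exactly one triangle. -/
def BdryAdj (K : TriComplex V) (u v : V) : Prop :=
  u ≠ v ∧ ∃! T, T ∈ K.tri ∧ u ∈ T ∧ v ∈ T

/-- The finite complex `K` triangulates a closed annulus with boundary components `E₁` and `E₂`
(given by their vertices): it is a connected surface with boundary, its Euler characteristic is
zero, and it has exactly two boundary components. By the classification of surfaces, these are
exactly the triangulated annuli. -/
structure IsAnnulus (K : TriComplex V) (E₁ E₂ : Finset V) : Prop where
  /-- an edge lies in at most two triangles -/
  edge_le_two : ∀ u v, u ≠ v → {T | T ∈ K.tri ∧ u ∈ T ∧ v ∈ T}.ncard ≤ 2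
  /-- the link of every vertex is connected (hence a path or a cycle) -/
  link_connected : ∀ v T T', T ∈ K.tri → T' ∈ K.tri → v ∈ T → v ∈ T' →
    Relation.ReflTransGen
      (fun R R' => R' ∈ K.tri ∧ v ∈ R' ∧ ∃ y, y ≠ v ∧ y ∈ R ∧ y ∈ R') T T'
  connected : K.graph.Connected
  euler : (Nat.card V : ℤ) - (K.graph.edgeSet.ncard : ℤ) + (K.tri.ncard : ℤ) = 0
  nonempty₁ : E₁.Nonempty
  nonempty₂ : E₂.Nonempty
  disjoint : Disjoint E₁ E₂
  mem_boundary : ∀ v, (v ∈ E₁ ∨ v ∈ E₂) ↔ ∃ u, K.BdryAdj v u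
  closed₁ : ∀ u v, K.BdryAdj u v → u ∈ E₁ → v ∈ E₁
  closed₂ : ∀ u v, K.BdryAdj u v → u ∈ E₂ → v ∈ E₂
  connected₁ : ∀ u ∈ E₁, ∀ v ∈ E₁, Relation.ReflTransGen K.BdryAdj u v
  connected₂ : ∀ u ∈ E₂, ∀ v ∈ E₂, Relation.ReflTransGen K.BdryAdj u v

/-- A conductance function: symmetric, and positive on edges. -/
def IsConductance (K : TriComplex V) (c : V → V → ℝ) : Prop :=
  (∀ u v, c u v = c v u) ∧ ∀ u v, K.graph.Adj u v → 0 < c u v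

open Classical in
/-- The sum of `c(x,y)(u(x) - u(y))` over all neighbours `y` of `x`. This is the Laplacian at an
interior vertex `x`, and the (outward) normal derivative at a boundary vertex `x`. -/
noncomputable def lap [Fintype V] (K : TriComplex V) (c : V → V → ℝ) (u : V → ℝ) (x : V) : ℝ :=
  ∑ y, if K.graph.Adj x y then c x y * (u x - u y) else 0

/-- The discrete Dirichlet problem on the annulus: `g = k` on `E₁`, `g = 0` on `E₂`, and `g` is
harmonic at the remaining vertices. -/
structure IsDirichletSolution [Fintype V] (K : TriComplex V) (E₁ E₂ : Finset V)
    (c : V → V → ℝ) (k : ℝ) (g : V → ℝ) : Prop where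
  outer : ∀ v ∈ E₁, g v = k
  inner : ∀ v ∈ E₂, g v = 0
  harmonic : ∀ v, v ∉ E₁ → v ∉ E₂ → K.lap c g v = 0

/-- The period of the conjugate function of `g`: the total normal derivative of `g` along `E₁`. -/
noncomputable def period [Fintype V] (K : TriComplex V) (E₁ : Finset V) (c : V → V → ℝ)
    (g : V → ℝ) : ℝ :=
  ∑ u ∈ E₁, K.lap c g u

/-- A slit: a combinatorial path from `E₁` to `E₂` along which `g` decreases (so the path is
simple, and only its end points lie on the boundary when `g` is the Dirichlet solution). -/
structure IsSlit (K : TriComplex V) (E₁ E₂ : Finset V) (g : V → ℝ) {n : ℕ}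
    (γ : Fin (n + 1) → V) : Prop where
  start : γ 0 ∈ E₁
  finish : γ (Fin.last n) ∈ E₂
  adj : ∀ i : Fin n, K.graph.Adj (γ i.castSucc) (γ i.succ)
  anti : StrictAnti fun i => g (γ i)

/-- `u` and `v` are the end points of one of the edges of the path `γ`. -/
def PathEdge {n : ℕ} (γ : Fin (n + 1) → V) (u v : V) : Prop :=
  ∃ i : Fin n, (u = γ i.castSucc ∧ v = γ i.succ) ∨ (v = γ i.castSucc ∧ u = γ i.succ)

/-! ### Cutting open along a slit -/

/-- Pairs consisting of a triangle and one of its vertices. -/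
def Flag (K : TriComplex V) : Type _ := {f : Finset V × V // f.1 ∈ K.tri ∧ f.2 ∈ f.1}

/-- Two triangles at the same vertex `v` which share an edge at `v` that is not an edge of `γ`. -/
def FlagStep (K : TriComplex V) {n : ℕ} (γ : Fin (n + 1) → V) (f f' : K.Flag) : Prop :=
  f.1.2 = f'.1.2 ∧ ∃ y, y ≠ f.1.2 ∧ y ∈ f.1.1 ∧ y ∈ f'.1.1 ∧ ¬ PathEdge γ f.1.2 y

/-- The vertices of the complex cut open along `γ`: the corners of the triangles, two corners
at a vertex being identified when one can go from one to the other around that vertex without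
crossing `γ`. -/
def CutVertex (K : TriComplex V) {n : ℕ} (γ : Fin (n + 1) → V) : Type _ := Quot (K.FlagStep γ)

/-- The corner of the triangle `T` at `v`, as a vertex of the cut complex. -/
def cutMk (K : TriComplex V) {n : ℕ} (γ : Fin (n + 1) → V) (T : Finset V) (hT : T ∈ K.tri)
    (v : V) (hv : v ∈ T) : K.CutVertex γ :=
  Quot.mk _ ⟨(T, v), hT, hv⟩

/-- The vertex of the original complex from which a vertex of the cut complex comes. -/
def cutProj (K : TriComplex V) {n : ℕ} (γ : Fin (n + 1) → V) : K.CutVertex γ → V :=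
  Quot.lift (fun f => f.1.2) fun _ _ h => h.1

instance [Finite V] (K : TriComplex V) : Finite K.Flag :=
  inferInstanceAs (Finite {f : Finset V × V // f.1 ∈ K.tri ∧ f.2 ∈ f.1})

instance [Finite V] (K : TriComplex V) {n : ℕ} (γ : Fin (n + 1) → V) : Finite (K.CutVertex γ) :=
  inferInstanceAs (Finite (Quot (K.FlagStep γ)))

noncomputable instance [Fintype V] (K : TriComplex V) {n : ℕ} (γ : Fin (n + 1) → V) :
    Fintype (K.CutVertex γ) :=
  Fintype.ofFinite _

open Classical in
/-- The complex cut open along `γ`; it has the same triangles, glued along the edges that are not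
edges of `γ`. -/
noncomputable def cut (K : TriComplex V) {n : ℕ} (γ : Fin (n + 1) → V) :
    TriComplex (K.CutVertex γ) where
  tri := {T' | ∃ (T : Finset V) (hT : T ∈ K.tri),
    T' = T.attach.image fun v => K.cutMk γ T hT v.1 v.2}
  card_tri := by
    rintro _ ⟨T, hT, rfl⟩
    rw [Finset.card_image_of_injective, Finset.card_attach, K.card_tri T hT]
    intro v w hvw
    exact Subtype.ext (congrArg (K.cutProj γ) hvw)
  exists_tri := by
    intro w
    induction w using Quot.ind with
    | mk f =>
      exact ⟨_, ⟨f.1.1, f.2.1, rfl⟩,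
        Finset.mem_image.2 ⟨⟨f.1.2, f.2.2⟩, Finset.mem_attach _ _, rfl⟩⟩

/-- The conductances of the cut complex; both copies of a split edge keep its conductance. -/
def cutCond (K : TriComplex V) {n : ℕ} (γ : Fin (n + 1) → V) (c : V → V → ℝ)
    (a b : K.CutVertex γ) : ℝ :=
  c (K.cutProj γ a) (K.cutProj γ b)

/-- `base` and `top` are the two copies of the path `γ` in the complex cut open along `γ`. -/
structure IsBaseTop (K : TriComplex V) {n : ℕ} (γ : Fin (n + 1) → V)
    (base top : Fin (n + 1) → K.CutVertex γ) : Prop where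
  proj_base : ∀ i, K.cutProj γ (base i) = γ i
  proj_top : ∀ i, K.cutProj γ (top i) = γ i
  adj_base : ∀ i : Fin n, (K.cut γ).graph.Adj (base i.castSucc) (base i.succ)
  adj_top : ∀ i : Fin n, (K.cut γ).graph.Adj (top i.castSucc) (top i.succ)
  ne : ∀ i, base i ≠ top i

/-- The discrete Dirichlet-Neumann problem on the cut annulus: `h = 0` on the base, `h = p` on the
top, the normal derivative of `h` vanishes at the vertices over `E₁` and `E₂` other than the four
corners, and `h` is harmonic at the interior vertices. (The sum of all normal derivatives is then
automatically zero.) -/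
structure IsHarmonicConjugate [Fintype V] (K : TriComplex V) (E₁ E₂ : Finset V)
    (c : V → V → ℝ) (p : ℝ) {n : ℕ} (γ : Fin (n + 1) → V)
    (base top : Fin (n + 1) → K.CutVertex γ) (h : K.CutVertex γ → ℝ) : Prop where
  on_top : ∀ i, h (top i) = p
  on_base : ∀ i, h (base i) = 0
  neumann : ∀ w, w ∉ Set.range base → w ∉ Set.range top →
    (K.cutProj γ w ∈ E₁ ∨ K.cutProj γ w ∈ E₂) → (K.cut γ).lap (K.cutCond γ c) h w = 0
  harmonic : ∀ w, w ∉ Set.range base → w ∉ Set.range top →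
    K.cutProj γ w ∉ E₁ → K.cutProj γ w ∉ E₂ → (K.cut γ).lap (K.cutCond γ c) h w = 0

/-! ### Geometric realization and level curves -/

open Classical in
/-- A vertex as a point of the geometric realization (in barycentric coordinates). -/
noncomputable def pt (v : V) : V → ℝ := fun w => if w = v then 1 else 0

/-- The closed edge with end points `a`, `b`. -/
def edgeBody (a b : V) : Set (V → ℝ) := segment ℝ (pt a) (pt b)

/-- The closed triangle (or face) spanned by `T`. -/
def faceBody [Fintype V] (T : Finset V) : Set (V → ℝ) :=
  {x | (∀ v, 0 ≤ x v) ∧ ∑ v, x v = 1 ∧ ∀ v, x v ≠ 0 → v ∈ T}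

/-- The geometric realization. -/
def body [Fintype V] (K : TriComplex V) : Set (V → ℝ) := {x | ∃ T ∈ K.tri, x ∈ faceBody T}

/-- The extension of a function on the vertices that is affine on all edges and triangles. -/
def ext [Fintype V] (f : V → ℝ) (x : V → ℝ) : ℝ := ∑ v, x v * f v

/-- The set of points of the realization where `F` has the value `t`. -/
def levelCurve [Fintype V] (K : TriComplex V) (F : (V → ℝ) → ℝ) (t : ℝ) : Set (V → ℝ) :=
  {x | x ∈ K.body ∧ F x = t}

/-- The polygonal curve through the vertices of a combinatorial path. -/
def pathBody {n : ℕ} (β : Fin (n + 1) → V) : Set (V → ℝ) :=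
  {x | ∃ i : Fin n, x ∈ edgeBody (β i.castSucc) (β i.succ)}

/-- The part of the boundary of the cut annulus that lies over the boundary component with vertex
set `E`. -/
def cutSide (K : TriComplex V) {n : ℕ} (γ : Fin (n + 1) → V) (E : Finset V) :
    Set (K.CutVertex γ → ℝ) :=
  {x | ∃ a b, (K.cut γ).graph.Adj a b ∧ K.BdryAdj (K.cutProj γ a) (K.cutProj γ b) ∧
    K.cutProj γ a ∈ E ∧ K.cutProj γ b ∈ E ∧ x ∈ edgeBody a b}

/-! ### The conjugate function

Below, `K` is a triangulated quadrilateral with conductances `c`, `h` is a function on its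
vertices, `S` is a finite set of values of `h` which contains the values at all vertices, and
`start` and `base` are two sides of the quadrilateral, `base` being the curve `h = 0`. -/

section Conjugate

variable [Fintype V]

/-- The vertices, and the points in which an edge crosses one of the level curves `h = s`,
`s ∈ S`. -/
def IsNode (K : TriComplex V) (h : V → ℝ) (S : Finset ℝ) (x : V → ℝ) : Prop :=
  (∃ v, x = pt v) ∨
    ∃ a b, K.graph.Adj a b ∧ h a < h b ∧ x ∈ edgeBody a b ∧ ext h x ∈ S

/-- The conductance of the part from `a` to `x` of the edge from `a` to `b`, when `x` is inserted
into this edge as a new vertex. -/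
noncomputable def insertedCond (c : V → V → ℝ) (h : V → ℝ) (a b : V) (x : V → ℝ) : ℝ :=
  c a b * (h a - h b) / (h a - ext h x)

open Classical in
/-- The normal derivative of `h` at a node `x` with respect to the part of the quadrilateral that
lies below the level curve of `h` through `x`. (If `x` is the vertex `b`, then
`insertedCond c h a b x` is `c a b`.) -/
noncomputable def normalBelow (K : TriComplex V) (c : V → V → ℝ) (h : V → ℝ) (x : V → ℝ) : ℝ :=
  ∑ a, ∑ b, if K.graph.Adj a b ∧ x ∈ edgeBody a b ∧ h a < ext h x
    then insertedCond c h a b x * (ext h x - h a) else 0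

open Classical in
/-- The absolute value of the normal derivative of `h` at a vertex with respect to the whole
quadrilateral. -/
noncomputable def absNormal (K : TriComplex V) (c : V → V → ℝ) (h : V → ℝ) (x : V → ℝ) : ℝ :=
  ∑ v, if x = pt v then |K.lap c h v| else 0

/-- The arc of the level curve of `h` through `x` that leads from `start` to `x`: the points
of the level curve that belong to each of its connected subsets which contain `x` and meet
`start`. -/
def arcTo (K : TriComplex V) (h : V → ℝ) (start : Set (V → ℝ)) (x : V → ℝ) : Set (V → ℝ) :=
  {u | u ∈ K.levelCurve (ext h) (ext h x) ∧
    ∀ C ⊆ K.levelCurve (ext h) (ext h x), IsConnected C → x ∈ C → (C ∩ start).Nonempty → u ∈ C}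

open Classical in
/-- The value of the conjugate function at a node `x`: zero on `start`; otherwise the sum of the
normal derivatives of `h` over all nodes, both ends included, on the arc from `start` to `x` of the
level curve of `h` through `x`. -/
noncomputable def nodeValue (K : TriComplex V) (c : V → V → ℝ) (h : V → ℝ) (S : Finset ℝ)
    (start base : Set (V → ℝ)) (x : V → ℝ) : ℝ :=
  if x ∈ start then 0
  else if x ∈ base then ∑ᶠ u ∈ {u | K.IsNode h S u ∧ u ∈ K.arcTo h start x}, K.absNormal c h u
  else ∑ᶠ u ∈ {u | K.IsNode h S u ∧ u ∈ K.arcTo h start x}, K.normalBelow c h u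

/-- `F` is the conjugate function of `h`. It has the prescribed values at the nodes. The nodes cut
the edges into intervals, on which `F` is affine. The level curves `h = s`, `s ∈ S`, cut a triangle
into triangles and trapezoids with parallel sides on such level curves. On the horizontal chords
`F` is affine; together with affinity on the edge intervals this is the affine extension to the
small triangles and the bilinear extension to the trapezoids. -/
structure IsConjugate (K : TriComplex V) (c : V → V → ℝ) (h : V → ℝ) (S : Finset ℝ)
    (start base : Set (V → ℝ)) (F : (V → ℝ) → ℝ) : Prop where
  node : ∀ x, K.IsNode h S x → F x = K.nodeValue c h S start base x
  edge : ∀ a b, K.graph.Adj a b → ∀ x ∈ edgeBody a b, ∀ y ∈ edgeBody a b,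
    K.IsNode h S x → K.IsNode h S y → ext h x ≤ ext h y →
    (∀ s ∈ S, ¬ (ext h x < s ∧ s < ext h y)) →
    ∀ t ∈ Set.Icc (0 : ℝ) 1, F (AffineMap.lineMap x y t) = AffineMap.lineMap (F x) (F y) t
  chord : ∀ T ∈ K.tri, ∀ a ∈ T, ∀ a' ∈ T, ∀ b ∈ T, ∀ b' ∈ T,
    ∀ x ∈ edgeBody a a', ∀ y ∈ edgeBody b b', ext h x = ext h y →
    ∀ t ∈ Set.Icc (0 : ℝ) 1, F (AffineMap.lineMap x y t) = AffineMap.lineMap (F x) (F y) t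

end Conjugate

end TriComplex

/-! ### Barycentric coordinates on edges and triangles -/

namespace TriComplex

open AffineMap Set

variable {V : Type*}

set_option linter.unusedSectionVars false

/-! The pair of `h` and its conjugate maps the cut annulus homeomorphically onto a rectangle `[0, p]
× [0, W]`, where `W` is the total flux of `h` out of the base (`IsCoordinate`). The base and the top
go to the sides where `h` is `0` and `p`, the curves over `E₁` and `E₂` to the sides where the
conjugate is `0` and `W`. Level curves become parallel segments of the rectangle, and all assertions
can be read off.

The topological input is that `h` has no saddles, and this comes from a count. By the maximum
principle a vertex off the base and the top has a strictly higher and a strictly lower neighbour, so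
it is the middle vertex, in the order of `h`, of at least one triangle, and by parity of at least
two if it comes from an interior vertex of the annulus off the slit. A triangle has at most one
middle vertex, and none if it has an edge on the base or on the top, which happens for at least `2n`
triangles. Euler characteristic zero bounds the number of triangles by `2|V| - |E₁| - |E₂|`
(`IsAnnulus.card_triangles`). This leaves no slack, so all lower bounds are equalities
(`IsCutAnnulus.card_mid`), and therefore upper and lower links are connected
(`IsCutAnnulus.levelRegular`).

Consequently every level set of `h` is a path. The points where it meets non-horizontal edges have
at most two neighbours each, connectedness propagates from the base to all higher levels
(`LevelRegular.linked_crossSet`), and the ends lie on the two sides. Initial segments of a level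
correspond to initial segments of neighbouring levels, so the orders along the levels are compatible
(`LevelRegular.pos_le_of_gap`).

The conjugate at a node is a partial sum of positive fluxes along its level curve. Hence it is
strictly increasing along the levels in `S`, and by Green's formula the total is the same on all
levels (`IsQuad.sum_nodeFlux`), which makes it constant on the side over `E₂`. Interpolation between
two levels preserves strict monotonicity (`IsQuad.lt_of_pos_lt`). A continuous function that
increases from `0` to `W` along each level curve gives coordinates, and compactness makes the
inverse continuous.

The arcs in the definition of the node values are described by connected sets. To evaluate them, a
function is first built from the combinatorial order alone (`orderValue`). It already gives
coordinates, in which arcs are visible, and the two kinds of node values turn out to agree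
(`IsQuad.nodeValue_eq`). This yields both existence and the properties of every conjugate function.
-/

theorem pt_apply_self (v : V) : pt v v = 1 := by simp [pt]

theorem pt_apply_of_ne {v w : V} (hw : w ≠ v) : pt v w = 0 := by simp [pt, hw]

theorem pt_injective : Function.Injective (pt : V → V → ℝ) := by
  intro v w hvw
  by_contra hne
  have := congrFun hvw v
  rw [pt_apply_self, pt_apply_of_ne hne] at this
  exact one_ne_zero this

theorem lineMap_pi_apply (x y : V → ℝ) (t : ℝ) (v : V) :
    lineMap x y t v = lineMap (x v) (y v) t := by
  simp [lineMap_apply_module]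

theorem mem_edgeBody_iff {a b : V} {x : V → ℝ} :
    x ∈ edgeBody a b ↔ ∃ t ∈ Icc (0 : ℝ) 1, lineMap (pt a) (pt b) t = x := by
  rw [edgeBody, segment_eq_image_lineMap]
  rfl

theorem edgeBody_symm (a b : V) : edgeBody a b = edgeBody b a := segment_symm ℝ _ _

theorem left_mem_edgeBody (a b : V) : pt a ∈ edgeBody a b := left_mem_segment ℝ _ _

theorem right_mem_edgeBody (a b : V) : pt b ∈ edgeBody a b := right_mem_segment ℝ _ _

section

variable [Fintype V]

theorem ext_add (h : V → ℝ) (x y : V → ℝ) : ext h (x + y) = ext h x + ext h y := by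
  simp [ext, add_mul, Finset.sum_add_distrib]

theorem ext_smul (h : V → ℝ) (r : ℝ) (x : V → ℝ) : ext h (r • x) = r * ext h x := by
  simp [ext, Finset.mul_sum, mul_assoc]

theorem ext_lineMap (h : V → ℝ) (x y : V → ℝ) (t : ℝ) :
    ext h (lineMap x y t) = lineMap (ext h x) (ext h y) t := by
  simp [lineMap_apply_module, ext_add, ext_smul]

theorem ext_pt (h : V → ℝ) (v : V) : ext h (pt v) = h v := by
  rw [ext, Finset.sum_eq_single v (fun w _ hw => by rw [pt_apply_of_ne hw, zero_mul])
    (fun hv => absurd (Finset.mem_univ v) hv), pt_apply_self, one_mul]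

theorem ext_neg (h : V → ℝ) (x : V → ℝ) : ext (-h) x = -ext h x := by
  simp [ext]

theorem continuous_ext (h : V → ℝ) : Continuous (ext h) := by
  unfold ext; fun_prop

theorem pt_mem_faceBody {v : V} {T : Finset V} (hv : v ∈ T) : pt v ∈ faceBody T := by
  refine ⟨fun w => ?_, ?_, fun w hw => ?_⟩
  · unfold pt; split_ifs <;> norm_num
  · rw [Finset.sum_eq_single v (fun w _ hw => pt_apply_of_ne hw)
      (fun hv => absurd (Finset.mem_univ v) hv), pt_apply_self]
  · by_contra hwT
    exact hw (pt_apply_of_ne (by rintro rfl; exact hwT hv))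

theorem mem_of_pt_mem_faceBody {v : V} {T : Finset V} (hv : pt v ∈ faceBody T) : v ∈ T :=
  hv.2.2 v (by rw [pt_apply_self]; exact one_ne_zero)

theorem convex_faceBody (T : Finset V) : Convex ℝ (faceBody T) := by
  intro x hx y hy α β hα hβ hαβ
  refine ⟨fun v => ?_, ?_, fun v hv => ?_⟩
  · have := hx.1 v
    have := hy.1 v
    simp only [Pi.add_apply, Pi.smul_apply, smul_eq_mul]
    positivity
  · simp only [Pi.add_apply, Pi.smul_apply, smul_eq_mul, Finset.sum_add_distrib,
      ← Finset.mul_sum, hx.2.1, hy.2.1, mul_one, hαβ]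
  · by_contra hvT
    have h1 : x v = 0 := by by_contra h; exact hvT (hx.2.2 v h)
    have h2 : y v = 0 := by by_contra h; exact hvT (hy.2.2 v h)
    simp [h1, h2] at hv

theorem lineMap_mem_faceBody {T : Finset V} {x y : V → ℝ} (hx : x ∈ faceBody T)
    (hy : y ∈ faceBody T) {t : ℝ} (ht : t ∈ Icc (0 : ℝ) 1) : lineMap x y t ∈ faceBody T :=
  (convex_faceBody T).lineMap_mem hx hy ht

theorem edgeBody_subset_faceBody {T : Finset V} {a b : V} (ha : a ∈ T) (hb : b ∈ T) :
    edgeBody a b ⊆ faceBody T :=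
  (convex_faceBody T).segment_subset (pt_mem_faceBody ha) (pt_mem_faceBody hb)

theorem isClosed_faceBody (T : Finset V) : IsClosed (faceBody T) := by
  have : faceBody T = (⋂ v, {x : V → ℝ | 0 ≤ x v}) ∩ {x | ∑ v, x v = 1} ∩
      ⋂ v, {x | v ∈ T ∨ x v = 0} := by
    ext x
    simp only [faceBody, mem_ofPred_eq, mem_inter_iff, mem_iInter, and_assoc]
    refine and_congr_right fun _ => and_congr_right fun _ => forall_congr' fun v => ?_
    by_cases h : x v = 0 <;> simp [h]
  rw [this]
  refine ((isClosed_iInter fun v => ?_).inter ?_).inter (isClosed_iInter fun v => ?_)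
  · exact isClosed_le continuous_const (continuous_apply v)
  · exact isClosed_eq (by fun_prop) continuous_const
  · by_cases hv : v ∈ T
    · simp [hv]
    · simpa [hv] using isClosed_eq (continuous_apply v) continuous_const

theorem isCompact_faceBody (T : Finset V) : IsCompact (faceBody T) := by
  refine (isCompact_univ_pi fun _ : V => isCompact_Icc (a := (0 : ℝ)) (b := 1)).of_isClosed_subset
    (isClosed_faceBody T) fun x hx v _ => ⟨hx.1 v, ?_⟩
  rw [← hx.2.1]
  exact Finset.single_le_sum (fun w _ => hx.1 w) (Finset.mem_univ v)

theorem isCompact_edgeBody (a b : V) : IsCompact (edgeBody a b) := by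
  rw [edgeBody, segment_eq_image_lineMap]
  exact isCompact_Icc.image (by fun_prop)

theorem isCompact_body (K : TriComplex V) : IsCompact K.body := by
  have : K.body = ⋃ T ∈ K.tri, faceBody T := by
    ext x; simp [body]
  rw [this]
  exact (toFinite K.tri).isCompact_biUnion fun T _ => isCompact_faceBody T

/-- On such an edge `h` is affine and not constant, so it serves as a coordinate there. -/
theorem eq_of_mem_edgeBody {h : V → ℝ} {a b : V} (hab : h a ≠ h b) {x y : V → ℝ}
    (hx : x ∈ edgeBody a b) (hy : y ∈ edgeBody a b) (hxy : ext h x = ext h y) : x = y := by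
  obtain ⟨t, -, rfl⟩ := mem_edgeBody_iff.1 hx
  obtain ⟨t', -, rfl⟩ := mem_edgeBody_iff.1 hy
  rw [ext_lineMap, ext_lineMap, ext_pt, ext_pt, lineMap_apply_ring', lineMap_apply_ring'] at hxy
  have : (t - t') * (h b - h a) = 0 := by linarith
  rcases mul_eq_zero.1 this with h1 | h1
  · rw [sub_eq_zero.1 h1]
  · exact absurd (by linarith) hab

theorem ext_mem_of_mem_edgeBody {h : V → ℝ} {a b : V} (hab : h a ≤ h b) {x : V → ℝ}
    (hx : x ∈ edgeBody a b) : h a ≤ ext h x ∧ ext h x ≤ h b := by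
  obtain ⟨t, ht, rfl⟩ := mem_edgeBody_iff.1 hx
  rw [ext_lineMap, ext_pt, ext_pt, lineMap_apply_ring']
  constructor <;> nlinarith [ht.1, ht.2]

theorem eq_left_of_ext_eq {h : V → ℝ} {a b : V} (hab : h a ≠ h b) {x : V → ℝ}
    (hx : x ∈ edgeBody a b) (hxa : ext h x = h a) : x = pt a :=
  eq_of_mem_edgeBody hab hx (left_mem_edgeBody a b) (by rw [hxa, ext_pt])

theorem eq_right_of_ext_eq {h : V → ℝ} {a b : V} (hab : h a ≠ h b) {x : V → ℝ}
    (hx : x ∈ edgeBody a b) (hxb : ext h x = h b) : x = pt b :=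
  eq_of_mem_edgeBody hab hx (right_mem_edgeBody a b) (by rw [hxb, ext_pt])

/-- The point of the edge from `a` to `b` in which `h` has the value `s`. -/
noncomputable def cross (h : V → ℝ) (a b : V) (s : ℝ) : V → ℝ :=
  lineMap (pt a) (pt b) ((s - h a) / (h b - h a))

theorem ext_cross {h : V → ℝ} {a b : V} (hab : h a ≠ h b) (s : ℝ) :
    ext h (cross h a b s) = s := by
  have : h b - h a ≠ 0 := fun h0 => hab (by linarith)
  simp only [cross, ext_lineMap, ext_pt, lineMap_apply_ring']
  field_simp
  ring

theorem cross_mem {h : V → ℝ} {a b : V} (hab : h a < h b) {s : ℝ} (hs : h a ≤ s) (hs' : s ≤ h b) :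
    cross h a b s ∈ edgeBody a b := by
  refine mem_edgeBody_iff.2 ⟨_, ⟨div_nonneg (by linarith) (by linarith), ?_⟩, rfl⟩
  rw [div_le_one (by linarith)]
  linarith

theorem eq_cross {h : V → ℝ} {a b : V} (hab : h a < h b) {x : V → ℝ} (hx : x ∈ edgeBody a b) :
    x = cross h a b (ext h x) := by
  have := ext_mem_of_mem_edgeBody hab.le hx
  exact eq_of_mem_edgeBody hab.ne hx (cross_mem hab this.1 this.2) (ext_cross hab.ne _).symm

theorem cross_lineMap (h : V → ℝ) (a b : V) (s s' t : ℝ) :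
    cross h a b (lineMap s s' t) = lineMap (cross h a b s) (cross h a b s') t := by
  ext v
  simp only [cross, lineMap_pi_apply, lineMap_apply_ring']
  ring

/-- A point of an edge that lies in a face is a vertex of it, or the edge belongs to the face. -/
theorem mem_face_of_mem_edgeBody {a b : V} {T : Finset V} {x : V → ℝ} (hx : x ∈ edgeBody a b)
    (hxT : x ∈ faceBody T) : (x = pt a ∧ a ∈ T) ∨ (x = pt b ∧ b ∈ T) ∨ (a ∈ T ∧ b ∈ T) := by
  rcases eq_or_ne a b with rfl | hab
  · obtain ⟨t, ht, rfl⟩ := mem_edgeBody_iff.1 hx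
    rw [lineMap_same_apply] at hxT ⊢
    exact Or.inl ⟨rfl, mem_of_pt_mem_faceBody hxT⟩
  obtain ⟨t, ht, rfl⟩ := mem_edgeBody_iff.1 hx
  have ha : lineMap (pt a) (pt b) t a = 1 - t := by
    simp [lineMap_apply_module, pt_apply_self, pt_apply_of_ne hab]
  have hb : lineMap (pt a) (pt b) t b = t := by
    simp [lineMap_apply_module, pt_apply_self, pt_apply_of_ne hab.symm]
  rcases eq_or_ne t 0 with rfl | h0
  · left
    rw [lineMap_apply_zero] at hxT ⊢
    exact ⟨rfl, mem_of_pt_mem_faceBody hxT⟩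
  rcases eq_or_ne t 1 with rfl | h1
  · right; left
    rw [lineMap_apply_one] at hxT ⊢
    exact ⟨rfl, mem_of_pt_mem_faceBody hxT⟩
  · right; right
    exact ⟨hxT.2.2 a (by rw [ha]; intro h; exact h1 (by linarith)),
      hxT.2.2 b (by rw [hb]; exact h0)⟩

theorem pt_mem_edgeBody {a b v : V} (hv : pt v ∈ edgeBody a b) : v = a ∨ v = b := by
  classical
  have := edgeBody_subset_faceBody (T := {a, b}) (by simp) (by simp) hv
  simpa using mem_of_pt_mem_faceBody this

/-- The nonzero barycentric coordinates of a point that is not a vertex determine its edge, and the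
direction in which `h` increases fixes the order of the ends. -/
theorem mem_edgeBody_inter {h : V → ℝ} {a b a' b' : V} (hab : h a < h b) (hab' : h a' < h b')
    {x : V → ℝ} (hx : x ∈ edgeBody a b) (hx' : x ∈ edgeBody a' b') (hv : ∀ v, x ≠ pt v) :
    a = a' ∧ b = b' := by
  classical
  have := edgeBody_subset_faceBody (T := {a', b'}) (by simp) (by simp) hx'
  rcases mem_face_of_mem_edgeBody hx this with h1 | h1 | ⟨h1, h2⟩
  · exact absurd h1.1 (hv _)
  · exact absurd h1.1 (hv _)
  · simp only [Finset.mem_insert, Finset.mem_singleton] at h1 h2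
    rcases h1 with rfl | rfl <;> rcases h2 with rfl | rfl
    · exact absurd hab (lt_irrefl _)
    · exact ⟨rfl, rfl⟩
    · exact absurd hab (not_lt.2 hab'.le)
    · exact absurd hab (lt_irrefl _)

theorem ext_eq_sum_of_mem {T : Finset V} {x : V → ℝ} (hx : x ∈ faceBody T) (h : V → ℝ) :
    ext h x = ∑ v ∈ T, x v * h v := by
  refine (Finset.sum_subset (Finset.subset_univ T) fun v _ hv => ?_).symm
  have : x v = 0 := by by_contra h0; exact hv (hx.2.2 v h0)
  rw [this, zero_mul]

theorem sum_eq_one_of_mem {T : Finset V} {x : V → ℝ} (hx : x ∈ faceBody T) :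
    ∑ v ∈ T, x v = 1 := by
  rw [← hx.2.1]
  refine (Finset.sum_subset (Finset.subset_univ T) fun v _ hv => ?_)
  by_contra h0; exact hv (hx.2.2 v h0)

theorem ext_le_of_mem {T : Finset V} {x : V → ℝ} (hx : x ∈ faceBody T) {h : V → ℝ} {M : ℝ}
    (hM : ∀ v ∈ T, h v ≤ M) : ext h x ≤ M := by
  rw [ext_eq_sum_of_mem hx]
  calc ∑ v ∈ T, x v * h v ≤ ∑ v ∈ T, x v * M :=
        Finset.sum_le_sum fun v hv => mul_le_mul_of_nonneg_left (hM v hv) (hx.1 v)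
    _ = M := by rw [← Finset.sum_mul, sum_eq_one_of_mem hx, one_mul]

theorem le_ext_of_mem {T : Finset V} {x : V → ℝ} (hx : x ∈ faceBody T) {h : V → ℝ} {m : ℝ}
    (hm : ∀ v ∈ T, m ≤ h v) : m ≤ ext h x := by
  have := ext_le_of_mem hx (h := -h) (M := -m) fun v hv => neg_le_neg (hm v hv)
  rw [ext_neg] at this
  linarith

/-- If the maximum of `h` on a face is attained at a point, then it is attained at all vertices
that contribute to this point. -/
theorem eq_of_ext_eq_max {T : Finset V} {x : V → ℝ} (hx : x ∈ faceBody T) {h : V → ℝ} {M : ℝ}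
    (hM : ∀ v ∈ T, h v ≤ M) (hxM : ext h x = M) (v : V) (hv : x v ≠ 0) : h v = M := by
  have h1 : ∑ v ∈ T, x v * (M - h v) = 0 := by
    simp only [mul_sub, Finset.sum_sub_distrib]
    rw [← Finset.sum_mul, sum_eq_one_of_mem hx, ← ext_eq_sum_of_mem hx, hxM]
    ring
  have h2 := (Finset.sum_eq_zero_iff_of_nonneg fun v hv =>
    mul_nonneg (hx.1 v) (sub_nonneg.2 (hM v hv))).1 h1 v (hx.2.2 v hv)
  rcases mul_eq_zero.1 h2 with h3 | h3
  · exact absurd h3 hv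
  · linarith

theorem mem_faceBody_triple [DecidableEq V] {a b c : V} (hab : a ≠ b) (hac : a ≠ c) (hbc : b ≠ c)
    {x : V → ℝ} (hx : x ∈ faceBody {a, b, c}) :
    x a + x b + x c = 1 ∧ x = x a • pt a + x b • pt b + x c • pt c ∧
      ∀ h : V → ℝ, ext h x = x a * h a + x b * h b + x c * h c := by
  refine ⟨?_, ?_, fun h => ?_⟩
  · have := sum_eq_one_of_mem hx
    rw [Finset.sum_insert (by simp [hab, hac]), Finset.sum_insert (by simp [hbc]),
      Finset.sum_singleton] at this
    linarith
  · ext v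
    simp only [Pi.add_apply, Pi.smul_apply, smul_eq_mul]
    by_cases hv : v ∈ ({a, b, c} : Finset V)
    · simp only [Finset.mem_insert, Finset.mem_singleton] at hv
      rcases hv with rfl | rfl | rfl
      · simp [pt_apply_self, pt_apply_of_ne hab, pt_apply_of_ne hac]
      · simp [pt_apply_self, pt_apply_of_ne hab.symm, pt_apply_of_ne hbc]
      · simp [pt_apply_self, pt_apply_of_ne hac.symm, pt_apply_of_ne hbc.symm]
    · have : x v = 0 := by by_contra h0; exact hv (hx.2.2 v h0)
      simp only [Finset.mem_insert, Finset.mem_singleton, not_or] at hv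
      rw [this, pt_apply_of_ne hv.1, pt_apply_of_ne hv.2.1, pt_apply_of_ne hv.2.2]
      ring
  · rw [ext_eq_sum_of_mem hx, Finset.sum_insert (by simp [hab, hac]),
      Finset.sum_insert (by simp [hbc]), Finset.sum_singleton]
    ring

/-- The part of a level line in a triangle on which `h` is not extreme at `b` and `c` only: it
joins the two edges at `a`. -/
theorem exists_lineMap_cross [DecidableEq V] {h : V → ℝ} {a b c : V} (hab : a ≠ b) (hac : a ≠ c)
    (hbc : b ≠ c) (hb : h a ≠ h b) (hc : h a ≠ h c) {x : V → ℝ} (hx : x ∈ faceBody {a, b, c})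
    (hpos : 0 < (h b - h a) * (h c - h a)) :
    ∃ t ∈ Icc (0 : ℝ) 1, x = lineMap (cross h a b (ext h x)) (cross h a c (ext h x)) t := by
  obtain ⟨h1, h2, h3⟩ := mem_faceBody_triple hab hac hbc hx
  have h4 := h3 h
  set s := ext h x
  have h5 : s - h a = x b * (h b - h a) + x c * (h c - h a) := by
    rw [h4]; linear_combination h a * h1
  have hb' : h b - h a ≠ 0 := fun h0 => hb (by linarith)
  have hc' : h c - h a ≠ 0 := fun h0 => hc (by linarith)
  have xb := hx.1 b
  have xc := hx.1 c
  rcases eq_or_ne s (h a) with hs | hs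
  -- After multiplication by `h b - h a` both coefficients are positive, whatever the common sign of
  -- the two differences. So both coordinates vanish and `x` is the apex.
  · have h6 : x b * (h b - h a) ^ 2 + x c * ((h b - h a) * (h c - h a)) = 0 := by
      have : x b * (h b - h a) + x c * (h c - h a) = 0 := by rw [← h5, hs, sub_self]
      linear_combination (h b - h a) * this
    have h7 : 0 < (h b - h a) ^ 2 := by positivity
    have hxb : x b = 0 := by nlinarith [mul_nonneg xb h7.le, mul_nonneg xc hpos.le]
    have hxc : x c = 0 := by nlinarith [mul_nonneg xb h7.le, mul_nonneg xc hpos.le]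
    refine ⟨0, ⟨le_rfl, zero_le_one⟩, ?_⟩
    rw [lineMap_apply_zero, cross, hs, sub_self, zero_div, lineMap_apply_zero, h2, hxb, hxc]
    have : x a = 1 := by linarith
    simp [this]
  · have hs' : s - h a ≠ 0 := sub_ne_zero.2 hs
    -- The parameter is the share of `s - h a` that is contributed by the coordinate at `c`.
    refine ⟨x c * (h c - h a) / (s - h a), ?_, ?_⟩
    · rcases lt_or_gt_of_ne hb' with hb0 | hb0
      · have hc0 : h c - h a < 0 := by
          by_contra hcon; push Not at hcon; nlinarith
        have hs0 : s - h a < 0 := by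
          refine lt_of_le_of_ne ?_ hs'
          rw [h5]; nlinarith
        constructor
        · exact div_nonneg_of_nonpos (by nlinarith) hs0.le
        · rw [div_le_one_of_neg hs0]; nlinarith
      · have hc0 : 0 < h c - h a := by
          by_contra hcon; push Not at hcon; nlinarith
        have hs0 : 0 < s - h a := by
          refine lt_of_le_of_ne ?_ hs'.symm
          rw [h5]; nlinarith
        constructor
        · exact div_nonneg (by nlinarith) hs0.le
        · rw [div_le_one hs0]; nlinarith
    · have hxb : x b = (1 - x c * (h c - h a) / (s - h a)) * ((s - h a) / (h b - h a)) := by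
        field_simp
        linarith
      have hxc : x c = (x c * (h c - h a) / (s - h a)) * ((s - h a) / (h c - h a)) := by
        field_simp
      have hxa : x a = 1 - x b - x c := by linarith
      generalize hr : x c * (h c - h a) / (s - h a) = r at *
      simp only [cross]
      generalize hμ : (s - h a) / (h c - h a) = μ at *
      generalize hν : (s - h a) / (h b - h a) = ν at *
      conv_lhs => rw [h2]
      ext v
      simp only [lineMap_apply_module, Pi.add_apply, Pi.smul_apply, smul_eq_mul]
      rw [hxa, hxb, hxc]
      ring

end

end TriComplex

/-! ### Paths as connected graphs with degrees at most two -/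

namespace TriComplex

open Relation

/-- Any two points of `C` are joined by an `R`-chain inside `C`. -/
def Linked {α : Type*} (R : α → α → Prop) (C : Set α) : Prop :=
  ∀ x ∈ C, ∀ y ∈ C, ReflTransGen (fun u v => u ∈ C ∧ v ∈ C ∧ R u v) x y

/-- `pos` numbers the points of `N` along a path of `R` that starts at `x₀`. -/
structure PathOrder {α : Type*} (R : α → α → Prop) (N : Set α) (x₀ : α) (pos : α → ℕ) : Prop where
  mem : x₀ ∈ N
  zero : pos x₀ = 0
  inj : Set.InjOn pos N
  step : ∀ x ∈ N, ∀ y ∈ N, R x y → pos y ≤ pos x + 1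
  pred : ∀ x ∈ N, pos x ≠ 0 → ∃ y ∈ N, R y x ∧ pos y + 1 = pos x

/-- A connected graph with degrees at most two is a path, if it has an end point. -/
theorem dist_injective {β : Type*} {G : SimpleGraph β} (hG : G.Connected) {x₀ : β}
    (h₀ : ∀ y y', G.Adj x₀ y → G.Adj x₀ y' → y = y')
    (h₂ : ∀ x y₁ y₂ y₃, G.Adj x y₁ → G.Adj x y₂ → G.Adj x y₃ → y₁ = y₂ ∨ y₁ = y₃ ∨ y₂ = y₃) :
    (∀ x, G.dist x₀ x ≠ 0 → ∃ y, G.Adj y x ∧ G.dist x₀ y + 1 = G.dist x₀ x) ∧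
      Function.Injective (G.dist x₀) := by
  have pred : ∀ x, G.dist x₀ x ≠ 0 → ∃ y, G.Adj y x ∧ G.dist x₀ y + 1 = G.dist x₀ x := by
    intro x hx
    obtain ⟨p, hp⟩ := (hG.preconnected x x₀).exists_walk_length_eq_dist
    cases p with
    | nil => simp at hx
    | @cons _ y _ hxy q =>
      refine ⟨y, hxy.symm, ?_⟩
      have h1 : G.dist y x₀ ≤ q.length := SimpleGraph.dist_le q
      have h2 : G.dist x x₀ ≤ G.dist y x₀ + 1 := by
        obtain ⟨q', hq'⟩ := (hG.preconnected y x₀).exists_walk_length_eq_dist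
        rw [← hq']
        exact SimpleGraph.dist_le (SimpleGraph.Walk.cons hxy q')
      rw [SimpleGraph.Walk.length_cons] at hp
      rw [SimpleGraph.dist_comm (u := x₀), SimpleGraph.dist_comm (u := x₀)]
      omega
  refine ⟨pred, ?_⟩
  -- Induction on the distance: two vertices at distance `d + 1` have the same predecessor. If this
  -- is `x₀`, it has only one neighbour; otherwise its own predecessor is a third neighbour,
  -- excluded by its distance.
  have key : ∀ d x y, G.dist x₀ x = d → G.dist x₀ y = d → x = y := by
    intro d
    induction d with
    | zero =>
      intro x y hx hy
      rw [← hG.dist_eq_zero_iff.1 hx, ← hG.dist_eq_zero_iff.1 hy]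
    | succ d ih =>
      intro x y hx hy
      obtain ⟨x', hx', hx''⟩ := pred x (by omega)
      obtain ⟨y', hy', hy''⟩ := pred y (by omega)
      obtain rfl := ih x' y' (by omega) (by omega)
      by_cases hd : d = 0
      · obtain rfl := hG.dist_eq_zero_iff.1 (show G.dist x₀ x' = 0 by omega)
        exact h₀ x y hx' hy'
      · obtain ⟨r, hr, hr'⟩ := pred x' (by omega)
        rcases h₂ x' r x y hr.symm hx' hy' with rfl | rfl | h
        · omega
        · omega
        · exact h
  intro x y hxy
  exact key _ x y rfl hxy.symm

/-- The graph distance from `x₀` inside `N` is the numbering. -/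
theorem exists_pathOrder {α : Type*} {R : α → α → Prop} (symm : ∀ x y, R x y → R y x)
    (irrefl : ∀ x, ¬ R x x) {N : Set α} {x₀ : α} (hx₀ : x₀ ∈ N) (hN : Linked R N)
    (h₀ : ∀ y ∈ N, ∀ y' ∈ N, R x₀ y → R x₀ y' → y = y')
    (h₂ : ∀ x ∈ N, ∀ y₁ ∈ N, ∀ y₂ ∈ N, ∀ y₃ ∈ N, R x y₁ → R x y₂ → R x y₃ →
      y₁ = y₂ ∨ y₁ = y₃ ∨ y₂ = y₃) :
    ∃ pos, PathOrder R N x₀ pos := by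
  classical
  let G : SimpleGraph N :=
    { Adj := fun x y => R x y
      symm := ⟨fun _ _ h => symm _ _ h⟩
      loopless := ⟨fun _ h => irrefl _ h⟩ }
  have hreach : ∀ x y : α, ReflTransGen (fun u v => u ∈ N ∧ v ∈ N ∧ R u v) x y →
      ∀ hx : x ∈ N, ∀ hy : y ∈ N, G.Reachable ⟨x, hx⟩ ⟨y, hy⟩ := by
    intro x y hxy
    induction hxy with
    | refl => intro _ _; rfl
    | tail _ h ih =>
      intro hx hy
      exact (ih hx h.1).trans (SimpleGraph.Adj.reachable (show R _ _ from h.2.2))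
  have hG : G.Connected :=
    { preconnected := fun x y => hreach x y (hN x x.2 y y.2) x.2 y.2
      nonempty := ⟨⟨x₀, hx₀⟩⟩ }
  obtain ⟨pred, inj⟩ := dist_injective (x₀ := ⟨x₀, hx₀⟩) hG
    (fun y y' h h' => Subtype.ext (h₀ y y.2 y' y'.2 h h'))
    (fun x y₁ y₂ y₃ k₁ k₂ k₃ => by
      simpa only [Subtype.ext_iff] using
        h₂ x x.2 y₁ y₁.2 y₂ y₂.2 y₃ y₃.2 k₁ k₂ k₃)
  refine ⟨fun x => if hx : x ∈ N then G.dist ⟨x₀, hx₀⟩ ⟨x, hx⟩ else 0, hx₀, by simp [hx₀], ?_, ?_, ?_⟩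
  · intro x hx y hy hxy
    simp only [hx, hy, dif_pos] at hxy
    exact congrArg Subtype.val (inj hxy)
  · intro x hx y hy hxy
    simp only [hx, hy, dif_pos]
    obtain ⟨q, hq⟩ := (hG.preconnected ⟨x₀, hx₀⟩ ⟨x, hx⟩).exists_walk_length_eq_dist
    rw [← hq]
    have hadj : G.Adj ⟨x, hx⟩ ⟨y, hy⟩ := hxy
    simpa using SimpleGraph.dist_le (q.concat hadj)
  · intro x hx hx0
    simp only [hx, dif_pos] at hx0 ⊢
    obtain ⟨y, hy, hy'⟩ := pred _ hx0
    exact ⟨y, y.2, hy, by simpa using hy'⟩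

namespace PathOrder

variable {α : Type*} {R : α → α → Prop} {N : Set α} {x₀ : α} {pos : α → ℕ}

/-- A connected set that contains the start is an initial segment. -/
theorem mem_of_le (hp : PathOrder R N x₀ pos) {C : Set α} (hCN : C ⊆ N) (h0 : x₀ ∈ C)
    (hC : Linked R C) {x : α} (hx : x ∈ C) {y : α} (hy : y ∈ N) (hyx : pos y ≤ pos x) : y ∈ C := by
  have := hC x₀ h0 x hx
  clear hx
  induction this generalizing y with
  | refl =>
    rw [hp.zero] at hyx
    rw [hp.inj hy hp.mem (by rw [hp.zero]; omega)]
    exact h0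
  | @tail u v _ huv ih =>
    -- One step raises the position by at most one, so the only position that can be new is that of
    -- `v` itself.
    have h1 := hp.step u (hCN huv.1) v (hCN huv.2.1) huv.2.2
    by_cases h2 : pos y ≤ pos u
    · exact ih hy h2
    · rw [hp.inj hy (hCN huv.2.1) (by omega)]
      exact huv.2.1

/-- Passing to predecessors leads from any point to the start without raising the position. This is
the converse of `mem_of_le`: initial segments are connected. -/
theorem linked_le (hp : PathOrder R N x₀ pos) (symm : ∀ x y, R x y → R y x) (k : ℕ) :
    Linked R {x | x ∈ N ∧ pos x ≤ k} := by
  set C := {x | x ∈ N ∧ pos x ≤ k} with hC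
  have h1 : ∀ n, ∀ x ∈ C, pos x = n →
      ReflTransGen (fun u v => u ∈ C ∧ v ∈ C ∧ R u v) x₀ x := by
    intro n
    induction n with
    | zero =>
      intro x hx hx0
      rw [hp.inj hx.1 hp.mem (by rw [hp.zero, hx0])]
    | succ n ih =>
      intro x hx hxn
      obtain ⟨y, hy, hyx, hyp⟩ := hp.pred x hx.1 (by omega)
      have hyC : y ∈ C := ⟨hy, by have := hx.2; omega⟩
      exact (ih y hyC (by omega)).tail ⟨hyC, hx, hyx⟩
  have hs : Std.Symm fun u v => u ∈ C ∧ v ∈ C ∧ R u v :=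
    ⟨fun u v h => ⟨h.2.1, h.1, symm _ _ h.2.2⟩⟩
  intro x hx y hy
  exact (ReflTransGen.stdSymm.symm _ _ (h1 _ x hx rfl)).trans (h1 _ y hy rfl)

theorem exists_pos_eq (hp : PathOrder R N x₀ pos) {x : α} (hx : x ∈ N) {k : ℕ} (hk : k ≤ pos x) :
    ∃ y ∈ N, pos y = k := by
  obtain ⟨d, hd⟩ := Nat.exists_eq_add_of_le hk
  induction d generalizing x with
  | zero => exact ⟨x, hx, by omega⟩
  | succ d ih =>
    obtain ⟨y, hy, -, hyp⟩ := hp.pred x hx (by omega)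
    exact ih hy (by omega) (by omega)

/-- A further point with only one neighbour is the last one. -/
theorem le_of_end (hp : PathOrder R N x₀ pos) (symm : ∀ x y, R x y → R y x) {y : α} (hy : y ∈ N)
    (hy0 : y ≠ x₀) (hend : ∀ z ∈ N, ∀ z' ∈ N, R y z → R y z' → z = z') {x : α} (hx : x ∈ N) :
    pos x ≤ pos y := by
  by_contra hlt
  push Not at hlt
  -- If some point came after `y`, then `y` would have a neighbour before it and another one after
  -- it.
  obtain ⟨r, hr, hry, hrp⟩ := hp.pred y hy fun h0 => hy0 (hp.inj hy hp.mem (by rw [h0, hp.zero]))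
  obtain ⟨y', hy', hyp'⟩ := hp.exists_pos_eq hx (k := pos y + 1) hlt
  obtain ⟨q, hq, hqy, hqp⟩ := hp.pred y' hy' (by omega)
  obtain rfl := hp.inj hq hy (by omega)
  have := hend r hr y' hy' (symm _ _ hry) hqy
  subst this
  omega

end PathOrder

end TriComplex

/-! ### Level lines of a function without saddles -/

namespace TriComplex

open AffineMap Set Relation

variable {V : Type*} [Fintype V]

set_option linter.unusedSectionVars false

theorem faceBody_pair_subset [DecidableEq V] (a b : V) : faceBody {a, b} ⊆ edgeBody a b := by
  intro x hx
  refine mem_edgeBody_iff.2 ⟨x b, ⟨hx.1 b, ?_⟩, ?_⟩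
  · rw [← hx.2.1]
    exact Finset.single_le_sum (fun w _ => hx.1 w) (Finset.mem_univ b)
  · ext v
    have h1 : x v ≠ 0 → v = a ∨ v = b := fun h => by simpa using hx.2.2 v h
    have h2 := sum_eq_one_of_mem hx
    rcases eq_or_ne a b with rfl | hab
    · simp only [Finset.pair_eq_singleton, Finset.sum_singleton] at h2
      rw [lineMap_same_apply]
      by_cases hv : v = a
      · rw [hv, pt_apply_self, h2]
      · rw [pt_apply_of_ne hv]
        by_contra h0
        exact hv (by simpa using h1 (Ne.symm h0))
    · rw [Finset.sum_pair hab] at h2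
      rw [lineMap_pi_apply, lineMap_apply_ring']
      by_cases hva : v = a
      · rw [hva, pt_apply_self, pt_apply_of_ne hab]
        linarith
      · by_cases hvb : v = b
        · rw [hvb, pt_apply_self, pt_apply_of_ne hab.symm]
          linarith
        · rw [pt_apply_of_ne hva, pt_apply_of_ne hvb]
          by_contra h0
          rcases h1 (fun h => h0 (by rw [h]; ring)) with h | h
          exacts [hva h, hvb h]

/-- The end points of a segment lie in every face that contains an inner point of the segment. -/
theorem mem_faceBody_of_lineMap_mem {T₁ T : Finset V} {p q : V → ℝ} (hp : p ∈ faceBody T₁)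
    (hq : q ∈ faceBody T₁) {t : ℝ} (h0 : 0 < t) (h1 : t < 1) (hx : lineMap p q t ∈ faceBody T) :
    p ∈ faceBody T ∧ q ∈ faceBody T := by
  have key : ∀ v, lineMap p q t v = (1 - t) * p v + t * q v := by
    intro v; rw [lineMap_pi_apply, lineMap_apply_ring]
  refine ⟨⟨hp.1, hp.2.1, fun v hv => hx.2.2 v ?_⟩, ⟨hq.1, hq.2.1, fun v hv => hx.2.2 v ?_⟩⟩
  · have := (hp.1 v).lt_of_ne' hv
    have := hq.1 v
    rw [key]
    have : 0 < 1 - t := by linarith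
    positivity
  · have := (hq.1 v).lt_of_ne' hv
    have := hp.1 v
    rw [key]
    have : 0 < 1 - t := by linarith
    positivity

/-- The points of the edges on which `h` is not constant. -/
def IsCross (K : TriComplex V) (h : V → ℝ) (x : V → ℝ) : Prop :=
  ∃ a b, K.graph.Adj a b ∧ h a < h b ∧ x ∈ edgeBody a b

/-- The points in which the level curve `h = s` meets the edges on which `h` is not constant. -/
def crossSet (K : TriComplex V) (h : V → ℝ) (s : ℝ) : Set (V → ℝ) :=
  {x | K.IsCross h x ∧ ext h x = s}

/-- `x` and `y` are different points of a common triangle. -/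
def ChordRel (K : TriComplex V) (x y : V → ℝ) : Prop :=
  x ≠ y ∧ ∃ T ∈ K.tri, x ∈ faceBody T ∧ y ∈ faceBody T

/-- Two points of an edge on which `h` is not constant. -/
def Over (K : TriComplex V) (h : V → ℝ) (z x : V → ℝ) : Prop :=
  ∃ a b, K.graph.Adj a b ∧ h a < h b ∧ z ∈ edgeBody a b ∧ x ∈ edgeBody a b

/-- The triangle `T` at `v` contains neighbours of `v` on both sides of the level curve of `v`. -/
def Through (K : TriComplex V) (h : V → ℝ) (v : V) (T : Finset V) : Prop :=
  T ∈ K.tri ∧ v ∈ T ∧ (∃ a ∈ T, a ≠ v ∧ h a ≤ h v) ∧ ∃ b ∈ T, b ≠ v ∧ h v ≤ h b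

/-- The function `h` has no saddles and no extrema except for plateaus at its extreme values. -/
structure LevelRegular (K : TriComplex V) (h : V → ℝ) : Prop where
  exists_lt : ∀ T ∈ K.tri, ∃ a ∈ T, ∃ b ∈ T, h a < h b
  horiz : ∀ a b, K.graph.Adj a b → h a = h b → (∀ u, h u ≤ h a) ∨ ∀ u, h a ≤ h u
  edge_le : ∀ a b, a ≠ b → ∀ T₁ ∈ K.tri, ∀ T₂ ∈ K.tri, ∀ T₃ ∈ K.tri, a ∈ T₁ → b ∈ T₁ → a ∈ T₂ →
    b ∈ T₂ → a ∈ T₃ → b ∈ T₃ → T₁ = T₂ ∨ T₁ = T₃ ∨ T₂ = T₃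
  through_le : ∀ v T₁ T₂ T₃, K.Through h v T₁ → K.Through h v T₂ → K.Through h v T₃ →
    T₁ = T₂ ∨ T₁ = T₃ ∨ T₂ = T₃
  up_ne : ∀ v, (∃ u, h v < h u) → ∃ u, K.graph.Adj v u ∧ h v < h u
  up_conn : ∀ v u u', K.graph.Adj v u → h v < h u → K.graph.Adj v u' → h v < h u' →
    ReflTransGen (fun y z => h v < h y ∧ h v < h z ∧ ∃ T ∈ K.tri, v ∈ T ∧ y ∈ T ∧ z ∈ T) u u'
  down_ne : ∀ v, (∃ u, h u < h v) → ∃ u, K.graph.Adj v u ∧ h u < h v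
  down_conn : ∀ v u u', K.graph.Adj v u → h u < h v → K.graph.Adj v u' → h u' < h v →
    ReflTransGen (fun y z => h y < h v ∧ h z < h v ∧ ∃ T ∈ K.tri, v ∈ T ∧ y ∈ T ∧ z ∈ T) u u'

variable {K : TriComplex V} {h : V → ℝ}

theorem Through.neg {v : V} {T : Finset V} (hT : K.Through (-h) v T) : K.Through h v T := by
  obtain ⟨h1, h2, ⟨a, ha, hav, hah⟩, b, hb, hbv, hbh⟩ := hT
  exact ⟨h1, h2, ⟨b, hb, hbv, neg_le_neg_iff.1 hbh⟩, a, ha, hav, neg_le_neg_iff.1 hah⟩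

/-- The conditions come in pairs that are exchanged by a change of sign. Every result on the passage
from a level upwards can thus be used downwards. -/
theorem LevelRegular.neg (hL : K.LevelRegular h) : K.LevelRegular (-h) where
  exists_lt T hT := by
    obtain ⟨a, ha, b, hb, hab⟩ := hL.exists_lt T hT
    exact ⟨b, hb, a, ha, neg_lt_neg hab⟩
  horiz a b hab h' := by
    rcases hL.horiz a b hab (neg_injective h') with h1 | h1
    · exact Or.inr fun u => neg_le_neg (h1 u)
    · exact Or.inl fun u => neg_le_neg (h1 u)
  edge_le := hL.edge_le
  through_le v T₁ T₂ T₃ h₁ h₂ h₃ := hL.through_le v T₁ T₂ T₃ h₁.neg h₂.neg h₃.neg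
  up_ne v hv := by
    simp only [Pi.neg_apply, neg_lt_neg_iff] at hv ⊢
    exact hL.down_ne v hv
  up_conn v u u' := by
    simp only [Pi.neg_apply, neg_lt_neg_iff]
    exact hL.down_conn v u u'
  down_ne v hv := by
    simp only [Pi.neg_apply, neg_lt_neg_iff] at hv ⊢
    exact hL.up_ne v hv
  down_conn v u u' := by
    simp only [Pi.neg_apply, neg_lt_neg_iff]
    exact hL.up_conn v u u'

theorem isCross_neg (x : V → ℝ) : K.IsCross (-h) x ↔ K.IsCross h x := by
  constructor
  · rintro ⟨a, b, hab, h1, hx⟩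
    exact ⟨b, a, hab.symm, neg_lt_neg_iff.1 h1, edgeBody_symm a b ▸ hx⟩
  · rintro ⟨a, b, hab, h1, hx⟩
    exact ⟨b, a, hab.symm, neg_lt_neg h1, edgeBody_symm a b ▸ hx⟩

theorem crossSet_neg (s : ℝ) : K.crossSet (-h) (-s) = K.crossSet h s := by
  ext x
  simp only [crossSet, mem_ofPred_eq, isCross_neg, ext_neg, neg_inj]

theorem Over.neg {z x : V → ℝ} (hz : K.Over h z x) : K.Over (-h) z x := by
  obtain ⟨a, b, hab, h1, h2, h3⟩ := hz
  exact ⟨b, a, hab.symm, neg_lt_neg h1, edgeBody_symm a b ▸ h2, edgeBody_symm a b ▸ h3⟩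

theorem ChordRel.symm {x y : V → ℝ} (hxy : K.ChordRel x y) : K.ChordRel y x := by
  obtain ⟨h1, T, hT, h2, h3⟩ := hxy
  exact ⟨h1.symm, T, hT, h3, h2⟩

theorem ChordRel.irrefl (x : V → ℝ) : ¬ K.ChordRel x x := fun hx => hx.1 rfl

theorem adj_of_mem {T : Finset V} (hT : T ∈ K.tri) {a b : V} (ha : a ∈ T) (hb : b ∈ T)
    (hab : a ≠ b) : K.graph.Adj a b := ⟨hab, T, hT, ha, hb⟩

theorem adj_of_mem_lt {T : Finset V} (hT : T ∈ K.tri) {a b : V} (ha : a ∈ T) (hb : b ∈ T)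
    (hab : h a < h b) : K.graph.Adj a b :=
  adj_of_mem hT ha hb (by rintro rfl; exact lt_irrefl _ hab)

theorem exists_sorted [DecidableEq V] {T : Finset V} (hT : T.card = 3) (h : V → ℝ) :
    ∃ a b c, a ≠ b ∧ a ≠ c ∧ b ≠ c ∧ T = {a, b, c} ∧ h a ≤ h b ∧ h b ≤ h c := by
  obtain ⟨a, b, c, hab, hac, hbc, rfl⟩ := Finset.card_eq_three.1 hT
  rcases le_total (h a) (h b) with h1 | h1 <;> rcases le_total (h b) (h c) with h2 | h2 <;>
    rcases le_total (h a) (h c) with h3 | h3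
  · exact ⟨a, b, c, hab, hac, hbc, rfl, h1, h2⟩
  · exact ⟨a, b, c, hab, hac, hbc, rfl, h1, h2⟩
  · exact ⟨a, c, b, hac, hab, hbc.symm, by grind, h3, h2⟩
  · exact ⟨c, a, b, hac.symm, hbc.symm, hab, by grind, h3, h1⟩
  · exact ⟨b, a, c, hab.symm, hbc, hac, by grind, h1, h3⟩
  · exact ⟨b, c, a, hbc, hab.symm, hac.symm, by grind, h2, h3⟩
  · exact ⟨c, b, a, hbc.symm, hac.symm, hab.symm, by grind, h2, h1⟩
  · exact ⟨c, b, a, hbc.symm, hac.symm, hab.symm, by grind, h2, h1⟩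

/-- The edge that carries `x` need not belong to `T` when `x` is a vertex. But `T` is not flat, so
each of its vertices is an end of a non-horizontal edge of `T`. -/
theorem LevelRegular.exists_edge (hL : K.LevelRegular h) {T : Finset V} (hT : T ∈ K.tri)
    {x : V → ℝ} (hx : K.IsCross h x) (hxT : x ∈ faceBody T) :
    ∃ a ∈ T, ∃ b ∈ T, h a < h b ∧ x ∈ edgeBody a b := by
  have key : ∀ v ∈ T, ∃ a ∈ T, ∃ b ∈ T, h a < h b ∧ pt v ∈ edgeBody a b := by
    intro v hv
    obtain ⟨a, ha, b, hb, hab⟩ := hL.exists_lt T hT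
    rcases lt_or_ge (h a) (h v) with h1 | h1
    · exact ⟨a, ha, v, hv, h1, right_mem_edgeBody _ _⟩
    · exact ⟨v, hv, b, hb, h1.trans_lt hab, left_mem_edgeBody _ _⟩
  obtain ⟨a, b, -, h1, hxe⟩ := hx
  rcases mem_face_of_mem_edgeBody hxe hxT with ⟨rfl, h2⟩ | ⟨rfl, h2⟩ | ⟨h2, h3⟩
  · exact key _ h2
  · exact key _ h2
  · exact ⟨a, h2, b, h3, h1, hxe⟩

theorem LevelRegular.pt_cross (hL : K.LevelRegular h) (v : V) : K.IsCross h (pt v) := by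
  obtain ⟨T, hT, hv⟩ := K.exists_tri v
  obtain ⟨a, ha, b, hb, hab⟩ := hL.exists_lt T hT
  rcases lt_or_ge (h a) (h v) with h1 | h1
  · exact ⟨a, v, adj_of_mem_lt hT ha hv h1, h1, right_mem_edgeBody _ _⟩
  · exact ⟨v, b, adj_of_mem_lt hT hv hb (h1.trans_lt hab), h1.trans_lt hab,
      left_mem_edgeBody _ _⟩

theorem cross_mem_crossSet {a b : V} (hadj : K.graph.Adj a b) (hab : h a < h b) {s : ℝ}
    (hs : h a ≤ s) (hs' : s ≤ h b) : cross h a b s ∈ K.crossSet h s :=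
  ⟨⟨a, b, hadj, hab, cross_mem hab hs hs'⟩, ext_cross hab.ne s⟩

/-- A level line meets a triangle in a segment between two points of edges on which `h` is not
constant. -/
theorem LevelRegular.exists_chord (hL : K.LevelRegular h) {T : Finset V} (hT : T ∈ K.tri) {s : ℝ}
    (hs : ∃ u ∈ faceBody T, ext h u = s) :
    ∃ p ∈ K.crossSet h s, ∃ q ∈ K.crossSet h s, p ∈ faceBody T ∧ q ∈ faceBody T ∧
      ∀ u ∈ faceBody T, ext h u = s → ∃ t ∈ Icc (0 : ℝ) 1, u = lineMap p q t := by
  classical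
  obtain ⟨a, b, c, hab, hac, hbc, rfl, h1, h2⟩ := exists_sorted (K.card_tri T hT) h
  have h3 : h a < h c := by
    obtain ⟨x, hx, y, hy, hxy⟩ := hL.exists_lt _ hT
    simp only [Finset.mem_insert, Finset.mem_singleton] at hx hy
    rcases hx with rfl | rfl | rfl <;> rcases hy with rfl | rfl | rfl <;> linarith
  have ha : a ∈ ({a, b, c} : Finset V) := by simp
  have hb : b ∈ ({a, b, c} : Finset V) := by simp
  have hc : c ∈ ({a, b, c} : Finset V) := by simp
  have adj {x y : V} (hx : x ∈ ({a, b, c} : Finset V)) (hy : y ∈ ({a, b, c} : Finset V))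
    (hxy : x ≠ y) := adj_of_mem hT hx hy hxy
  obtain ⟨u₀, hu₀, hu₀s⟩ := hs
  have hsa : h a ≤ s := by
    rw [← hu₀s]
    refine le_ext_of_mem hu₀ fun v hv => ?_
    simp only [Finset.mem_insert, Finset.mem_singleton] at hv
    rcases hv with rfl | rfl | rfl <;> linarith
  have hsc : s ≤ h c := by
    rw [← hu₀s]
    refine ext_le_of_mem hu₀ fun v hv => ?_
    simp only [Finset.mem_insert, Finset.mem_singleton] at hv
    rcases hv with rfl | rfl | rfl <;> linarith
  -- The level of a horizontal edge `x y` is extreme in the triangle. Hence `z` does not contribute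
  -- to points at this level, and the level line is the edge.
  have horiz : ∀ x y z : V, ({x, y, z} : Finset V) = {a, b, c} → x ≠ y → x ≠ z → y ≠ z →
      h x = h y → s = h x → ((∀ v ∈ ({a, b, c} : Finset V), h v ≤ s) ∨
        ∀ v ∈ ({a, b, c} : Finset V), s ≤ h v) → h z ≠ s →
      ∃ p ∈ K.crossSet h s, ∃ q ∈ K.crossSet h s, p ∈ faceBody {a, b, c} ∧ q ∈ faceBody {a, b, c} ∧
      ∀ u ∈ faceBody {a, b, c}, ext h u = s → ∃ t ∈ Icc (0 : ℝ) 1, u = lineMap p q t := by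
    intro x y z hxyz hxy hxz hyz hh hsx hext hzs
    have hx : x ∈ ({a, b, c} : Finset V) := hxyz ▸ by simp
    have hy : y ∈ ({a, b, c} : Finset V) := hxyz ▸ by simp
    refine ⟨pt x, ⟨hL.pt_cross x, by rw [ext_pt, hsx]⟩, pt y, ⟨hL.pt_cross y, by
      rw [ext_pt, hsx, hh]⟩, pt_mem_faceBody hx, pt_mem_faceBody hy, fun u hu hus => ?_⟩
    have hz0 : u z = 0 := by
      by_contra h0
      rcases hext with hext | hext
      · exact hzs (eq_of_ext_eq_max hu hext hus z h0)
      · refine hzs (neg_injective (eq_of_ext_eq_max (h := -h) (M := -s) hu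
          (fun v hv => neg_le_neg (hext v hv)) (by rw [ext_neg, hus]) z h0))
    have : u ∈ faceBody {x, y} := by
      refine ⟨hu.1, hu.2.1, fun v hv => ?_⟩
      have h4 := hu.2.2 v hv
      rw [← hxyz] at h4
      simp only [Finset.mem_insert, Finset.mem_singleton] at h4 ⊢
      rcases h4 with h4 | h4 | rfl
      · exact Or.inl h4
      · exact Or.inr h4
      · exact absurd hz0 hv
    obtain ⟨t, ht, hut⟩ := mem_edgeBody_iff.1 (faceBody_pair_subset x y this)
    exact ⟨t, ht, hut.symm⟩
  -- Below the middle value the level line cuts off the lowest vertex, above it the highest one; a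
  -- tie at the cut-off end is the case `horiz`.
  rcases le_total s (h b) with hsb | hsb
  · rcases h1.lt_or_eq with h4 | h4
    · refine ⟨cross h a b s, cross_mem_crossSet (adj ha hb hab) h4 hsa hsb, cross h a c s,
        cross_mem_crossSet (adj ha hc hac) h3 hsa hsc,
        edgeBody_subset_faceBody ha hb (cross_mem h4 hsa hsb),
        edgeBody_subset_faceBody ha hc (cross_mem h3 hsa hsc), fun u hu hus => ?_⟩
      subst hus
      exact exists_lineMap_cross hab hac hbc h4.ne h3.ne hu
        (mul_pos (by linarith) (by linarith))
    · exact horiz a b c rfl hab hac hbc h4 (by linarith) (Or.inr fun v hv => by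
        simp only [Finset.mem_insert, Finset.mem_singleton] at hv
        rcases hv with rfl | rfl | rfl <;> linarith) (by intro h5; linarith)
  · rcases h2.lt_or_eq with h4 | h4
    -- The apex is now the upper end of both edges, so the crossing points appear with the edges
    -- reversed.
    · have e1 : cross h c a s = cross h a c s := by
        refine eq_of_mem_edgeBody h3.ne (edgeBody_symm c a ▸ ?_) (cross_mem h3 hsa hsc) ?_
        · refine mem_edgeBody_iff.2 ⟨_, ⟨div_nonneg_of_nonpos (by linarith) (by linarith), ?_⟩, rfl⟩
          rw [div_le_one_of_neg (by linarith)]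
          linarith
        · rw [ext_cross h3.ne, ext_cross h3.ne']
      have e2 : cross h c b s = cross h b c s := by
        refine eq_of_mem_edgeBody h4.ne (edgeBody_symm c b ▸ ?_) (cross_mem h4 hsb hsc) ?_
        · refine mem_edgeBody_iff.2 ⟨_, ⟨div_nonneg_of_nonpos (by linarith) (by linarith), ?_⟩, rfl⟩
          rw [div_le_one_of_neg (by linarith)]
          linarith
        · rw [ext_cross h4.ne, ext_cross h4.ne']
      refine ⟨cross h a c s, cross_mem_crossSet (adj ha hc hac) h3 hsa hsc, cross h b c s,
        cross_mem_crossSet (adj hb hc hbc) h4 hsb hsc,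
        edgeBody_subset_faceBody ha hc (cross_mem h3 hsa hsc),
        edgeBody_subset_faceBody hb hc (cross_mem h4 hsb hsc), fun u hu hus => ?_⟩
      subst hus
      have hu' : u ∈ faceBody {c, a, b} := by
        convert hu using 2
        grind
      rw [← e1, ← e2]
      exact exists_lineMap_cross hac.symm hbc.symm hab h3.ne' h4.ne' hu'
        (mul_pos_of_neg_of_neg (by linarith) (by linarith))
    · exact horiz b c a (by grind) hbc hab.symm hac.symm h4 (by linarith) (Or.inl fun v hv => by
        simp only [Finset.mem_insert, Finset.mem_singleton] at hv
        rcases hv with rfl | rfl | rfl <;> linarith) (by intro h5; linarith)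

/-- A point of an edge on which `h` is not constant is extreme on its level line. -/
theorem IsCross.eq_or_eq {z : V → ℝ} (hz : K.IsCross h z) {T : Finset V} {p q : V → ℝ}
    (hp : p ∈ faceBody T) (hq : q ∈ faceBody T) (hpq : ext h p = ext h q) {t : ℝ}
    (ht : t ∈ Icc (0 : ℝ) 1) (hzt : z = lineMap p q t) : z = p ∨ z = q := by
  classical
  rcases ht.1.eq_or_lt with rfl | h0
  · left; rw [hzt, lineMap_apply_zero]
  rcases ht.2.eq_or_lt with rfl | h1
  · right; rw [hzt, lineMap_apply_one]
  obtain ⟨a, b, -, hab, hze⟩ := hz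
  have hzf := edgeBody_subset_faceBody (T := {a, b}) (by simp) (by simp) hze
  rw [hzt] at hzf
  left
  refine eq_of_mem_edgeBody hab.ne hze
    (faceBody_pair_subset a b (mem_faceBody_of_lineMap_mem hp hq h0 h1 hzf).1) ?_
  rw [hzt, ext_lineMap, ← hpq, lineMap_same_apply]

/-- Crossing points can only be the two ends of the single chord of this level in `T`. -/
theorem LevelRegular.eq_of_mem_face (hL : K.LevelRegular h) {T : Finset V} (hT : T ∈ K.tri) {s : ℝ}
    {x y z : V → ℝ} (hx : x ∈ K.crossSet h s) (hy : y ∈ K.crossSet h s) (hz : z ∈ K.crossSet h s)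
    (hxT : x ∈ faceBody T) (hyT : y ∈ faceBody T) (hzT : z ∈ faceBody T) :
    x = y ∨ x = z ∨ y = z := by
  obtain ⟨p, hp, q, hq, hpT, hqT, hpq⟩ := hL.exists_chord hT ⟨x, hxT, hx.2⟩
  have key : ∀ w ∈ K.crossSet h s, w ∈ faceBody T → w = p ∨ w = q := by
    intro w hw hwT
    obtain ⟨t, ht, hwt⟩ := hpq w hwT hw.2
    exact hw.1.eq_or_eq hpT hqT (hp.2.trans hq.2.symm) ht hwt
  rcases key x hx hxT with rfl | rfl <;> rcases key y hy hyT with rfl | rfl <;>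
    rcases key z hz hzT with rfl | rfl <;> simp

/-- If all other vertices of `T` were strictly above `v`, or all strictly below, then `v` would be
the only point of `T` at its level. -/
theorem through_of_mem {T : Finset V} (hT : T ∈ K.tri) {v : V} (hv : v ∈ T) {y : V → ℝ}
    (hy : y ∈ faceBody T) (hyv : y ≠ pt v) (hyh : ext h y = h v) : K.Through h v T := by
  classical
  have key : ∀ f : V → ℝ, ext f y = f v → ∃ a ∈ T, a ≠ v ∧ f a ≤ f v := by
    intro f hf
    by_contra hcon
    push Not at hcon
    have hsup : y ∈ faceBody {v, v} := by
      refine ⟨hy.1, hy.2.1, fun w hw => ?_⟩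
      by_contra hwv
      have hwv' : w ≠ v := by simpa using hwv
      have := eq_of_ext_eq_max (h := -f) (M := -f v) hy (fun u hu => ?_) (by rw [ext_neg, hf]) w hw
      · exact (hcon w (hy.2.2 w hw) hwv').ne' (neg_injective this)
      · rcases eq_or_ne u v with rfl | huv
        · exact le_rfl
        · exact neg_le_neg (hcon u hu huv).le
    obtain ⟨t, -, ht⟩ := mem_edgeBody_iff.1 (faceBody_pair_subset v v hsup)
    rw [lineMap_same_apply] at ht
    exact hyv ht.symm
  refine ⟨hT, hv, key h hyh, ?_⟩
  obtain ⟨b, hb, hbv, hbh⟩ := key (-h) (by rw [ext_neg, hyh, Pi.neg_apply])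
  exact ⟨b, hb, hbv, neg_le_neg_iff.1 hbh⟩

/-- Each triangle at `x` contributes at most one neighbour. At most two triangles contain an inner
point of an edge (`edge_le`), and at most two triangles at a vertex are crossed by its level line
(`through_le`). -/
theorem LevelRegular.chordRel_le_two (hL : K.LevelRegular h) {s : ℝ} {x y₁ y₂ y₃ : V → ℝ}
    (hx : x ∈ K.crossSet h s) (h₁ : y₁ ∈ K.crossSet h s) (h₂ : y₂ ∈ K.crossSet h s)
    (h₃ : y₃ ∈ K.crossSet h s) (k₁ : K.ChordRel x y₁) (k₂ : K.ChordRel x y₂)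
    (k₃ : K.ChordRel x y₃) : y₁ = y₂ ∨ y₁ = y₃ ∨ y₂ = y₃ := by
  obtain ⟨n₁, T₁, hT₁, hx₁, hy₁⟩ := k₁
  obtain ⟨n₂, T₂, hT₂, hx₂, hy₂⟩ := k₂
  obtain ⟨n₃, T₃, hT₃, hx₃, hy₃⟩ := k₃
  have hTT : T₁ = T₂ ∨ T₁ = T₃ ∨ T₂ = T₃ := by
    have key : ∀ v, x = pt v → T₁ = T₂ ∨ T₁ = T₃ ∨ T₂ = T₃ := by
      rintro v rfl
      have hs : s = h v := by rw [← hx.2, ext_pt]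
      exact hL.through_le v T₁ T₂ T₃
        (through_of_mem hT₁ (mem_of_pt_mem_faceBody hx₁) hy₁ n₁.symm (h₁.2.trans hs))
        (through_of_mem hT₂ (mem_of_pt_mem_faceBody hx₂) hy₂ n₂.symm (h₂.2.trans hs))
        (through_of_mem hT₃ (mem_of_pt_mem_faceBody hx₃) hy₃ n₃.symm (h₃.2.trans hs))
    obtain ⟨a, b, hab, -, hxe⟩ := hx.1
    rcases mem_face_of_mem_edgeBody hxe hx₁ with h | h | m₁
    · exact key a h.1
    · exact key b h.1
    rcases mem_face_of_mem_edgeBody hxe hx₂ with h | h | m₂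
    · exact key a h.1
    · exact key b h.1
    rcases mem_face_of_mem_edgeBody hxe hx₃ with h | h | m₃
    · exact key a h.1
    · exact key b h.1
    exact hL.edge_le a b hab.1 T₁ hT₁ T₂ hT₂ T₃ hT₃ m₁.1 m₁.2 m₂.1 m₂.2 m₃.1 m₃.2
  rcases hTT with rfl | rfl | rfl
  · rcases hL.eq_of_mem_face hT₁ hx h₁ h₂ hx₁ hy₁ hy₂ with h | h | h
    exacts [absurd h n₁, absurd h n₂, Or.inl h]
  · rcases hL.eq_of_mem_face hT₁ hx h₁ h₃ hx₁ hy₁ hy₃ with h | h | h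
    exacts [absurd h n₁, absurd h n₃, Or.inr (Or.inl h)]
  · rcases hL.eq_of_mem_face hT₂ hx h₂ h₃ hx₂ hy₂ hy₃ with h | h | h
    exacts [absurd h n₂, absurd h n₃, Or.inr (Or.inr h)]

/-! ### Passing from a level to a neighbouring one -/

/-- No vertex has its value in `(s', s]`, so the edge through `z` reaches down to the level `s'`. -/
theorem exists_under {s s' : ℝ} (hgap : ∀ v, h v ≤ s' ∨ s < h v) (hss : s' < s) {z : V → ℝ}
    (hz : z ∈ K.crossSet h s) : ∃ x ∈ K.crossSet h s', K.Over h z x := by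
  obtain ⟨⟨a, b, hadj, hab, hze⟩, hzs⟩ := hz
  have h1 := ext_mem_of_mem_edgeBody hab.le hze
  rw [hzs] at h1
  have ha : h a ≤ s' := by rcases hgap a with h | h <;> linarith
  have hb : s' ≤ h b := by linarith
  exact ⟨_, cross_mem_crossSet hadj hab ha hb, a, b, hadj, hab, hze, cross_mem hab ha hb⟩

theorem not_vertex {s s' : ℝ} (hgap : ∀ v, h v ≤ s' ∨ s < h v) (hss : s' < s) {z : V → ℝ}
    (hz : z ∈ K.crossSet h s) (v : V) : z ≠ pt v := by
  rintro rfl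
  have := hz.2
  rw [ext_pt] at this
  rcases hgap v with h | h <;> linarith

/-- A point that is not a vertex lies on one edge only. So `Over` is a map from a level without
vertices to a level at the ends of its edges. -/
theorem Over.eq {z x x' : V → ℝ} (hz : ∀ v, z ≠ pt v) (hx : K.Over h z x) (hx' : K.Over h z x')
    (hxx : ext h x = ext h x') : x = x' := by
  obtain ⟨a, b, -, hab, hza, hxa⟩ := hx
  obtain ⟨a', b', -, hab', hza', hxa'⟩ := hx'
  obtain ⟨rfl, rfl⟩ := mem_edgeBody_inter hab hab' hza hza' hz
  exact eq_of_mem_edgeBody hab.ne hxa hxa' hxx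

theorem Over.mem_face {z x : V → ℝ} (hz : ∀ v, z ≠ pt v) (hx : K.Over h z x) {T : Finset V}
    (hzT : z ∈ faceBody T) : x ∈ faceBody T := by
  obtain ⟨a, b, -, -, hza, hxa⟩ := hx
  rcases mem_face_of_mem_edgeBody hza hzT with h | h | h
  · exact absurd h.1 (hz _)
  · exact absurd h.1 (hz _)
  · exact edgeBody_subset_faceBody h.1 h.2 hxa

/-- The edge of `x` continues upwards unless `x` is its upper end; then `up_ne` supplies another
edge. Thus the map given by `Over` is surjective. -/
theorem LevelRegular.exists_over (hL : K.LevelRegular h) {s s' : ℝ}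
    (hgap : ∀ v, h v ≤ s' ∨ s < h v) (hss : s' < s) (htop : ∃ v, s < h v) {x : V → ℝ}
    (hx : x ∈ K.crossSet h s') : ∃ z ∈ K.crossSet h s, K.Over h z x := by
  obtain ⟨⟨a, b, hadj, hab, hxe⟩, hxs⟩ := hx
  have h1 := ext_mem_of_mem_edgeBody hab.le hxe
  rw [hxs] at h1
  rcases hgap b with hb | hb
  · have hb' : h b = s' := le_antisymm hb h1.2
    obtain rfl := eq_right_of_ext_eq hab.ne hxe (hxs.trans hb'.symm)
    obtain ⟨v, hv⟩ := htop
    obtain ⟨u, hadj', hu⟩ := hL.up_ne b ⟨v, by linarith⟩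
    have hu' : s < h u := by rcases hgap u with h | h <;> linarith
    exact ⟨_, cross_mem_crossSet hadj' hu (by linarith) hu'.le, b, u, hadj', hu,
      cross_mem hu (by linarith) hu'.le, left_mem_edgeBody _ _⟩
  · exact ⟨_, cross_mem_crossSet hadj hab (by linarith) hb.le, a, b, hadj, hab,
      cross_mem hab (by linarith) hb.le, hxe⟩

/-- Within `T` the continuation upwards could fail only if `T` had a horizontal top edge from `x` to
`x'`. By `horiz` such an edge is at an extreme value of `h`, but here there are both lower and
higher vertices. -/
theorem LevelRegular.exists_over_mem (hL : K.LevelRegular h) {s s' : ℝ}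
    (hgap : ∀ v, h v ≤ s' ∨ s < h v) (hss : s' < s) (htop : ∃ v, s < h v) {T : Finset V}
    (hT : T ∈ K.tri) {x x' : V → ℝ} (hx : x ∈ K.crossSet h s') (hx' : x' ∈ K.crossSet h s')
    (hne : x ≠ x') (hxT : x ∈ faceBody T) (hxT' : x' ∈ faceBody T) :
    ∃ z ∈ K.crossSet h s, z ∈ faceBody T ∧ K.Over h z x := by
  obtain ⟨a, ha, b, hb, hab, hxe⟩ := hL.exists_edge hT hx.1 hxT
  have hxs := hx.2
  have h1 := ext_mem_of_mem_edgeBody hab.le hxe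
  rw [hxs] at h1
  rcases hgap b with hb' | hb'
  · have hb'' : h b = s' := le_antisymm hb' h1.2
    obtain rfl := eq_right_of_ext_eq hab.ne hxe (hxs.trans hb''.symm)
    have hu : ∃ u ∈ T, s' < h u := by
      by_contra hcon
      push Not at hcon
      obtain ⟨a₁, ha₁, b₁, hb₁, hab₁, hxe₁⟩ := hL.exists_edge hT hx'.1 hxT'
      have h2 := ext_mem_of_mem_edgeBody hab₁.le hxe₁
      rw [hx'.2] at h2
      have h3 : h b₁ = s' := le_antisymm (hcon b₁ hb₁) h2.2
      obtain rfl := eq_right_of_ext_eq hab₁.ne hxe₁ (hx'.2.trans h3.symm)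
      have h4 : b ≠ b₁ := fun h => hne (by rw [h])
      obtain ⟨v, hv⟩ := htop
      rcases hL.horiz b b₁ (adj_of_mem hT hb hb₁ h4) (hb''.trans h3.symm) with h5 | h5
      · have := h5 v; linarith
      · have := h5 a; linarith
    obtain ⟨u, hu, hus⟩ := hu
    have hbu : h b < h u := by linarith
    have hu' : s < h u := by rcases hgap u with h | h <;> linarith
    have hadj := adj_of_mem_lt hT hb hu hbu
    exact ⟨_, cross_mem_crossSet hadj hbu (by linarith) hu'.le,
      edgeBody_subset_faceBody hb hu (cross_mem hbu (by linarith) hu'.le), b, u, hadj, hbu,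
      cross_mem hbu (by linarith) hu'.le, left_mem_edgeBody _ _⟩
  · have hadj := adj_of_mem_lt hT ha hb hab
    exact ⟨_, cross_mem_crossSet hadj hab (by linarith) hb'.le,
      edgeBody_subset_faceBody ha hb (cross_mem hab (by linarith) hb'.le), a, b, hadj, hab,
      cross_mem hab (by linarith) hb'.le, hxe⟩

/-- Over a point inside an edge there is a single point. Over a vertex the fibre consists of
crossings of its ascending edges, and connectedness of the upper link joins these through triangles
at the vertex. -/
theorem LevelRegular.linked_fiber (hL : K.LevelRegular h) {s s' : ℝ}
    (hgap : ∀ v, h v ≤ s' ∨ s < h v) (hss : s' < s) {C : Set (V → ℝ)} {x z z' : V → ℝ}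
    (hx : x ∈ K.crossSet h s') (hC : ∀ w ∈ K.crossSet h s, K.Over h w x → w ∈ C)
    (hz : z ∈ K.crossSet h s) (hz' : z' ∈ K.crossSet h s) (hzx : K.Over h z x)
    (hzx' : K.Over h z' x) :
    ReflTransGen (fun u v => u ∈ C ∧ v ∈ C ∧ K.ChordRel u v) z z' := by
  obtain ⟨a, b, hadj, hab, hze, hxe⟩ := hzx
  obtain ⟨a', b', hadj', hab', hze', hxe'⟩ := hzx'
  by_cases hv : ∀ v, x ≠ pt v
  · obtain ⟨rfl, rfl⟩ := mem_edgeBody_inter hab hab' hxe hxe' hv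
    rw [eq_of_mem_edgeBody hab.ne hze hze' (hz.2.trans hz'.2.symm)]
  push Not at hv
  obtain ⟨v, rfl⟩ := hv
  have hvs : h v = s' := by rw [← hx.2, ext_pt]
  have h1 := ext_mem_of_mem_edgeBody hab.le hze
  have h1' := ext_mem_of_mem_edgeBody hab'.le hze'
  rw [hz.2] at h1
  rw [hz'.2] at h1'
  have e1 : v = a := by
    rcases pt_mem_edgeBody hxe with h | h
    · exact h
    · subst h; linarith
  have e2 : v = a' := by
    rcases pt_mem_edgeBody hxe' with h | h
    · exact h
    · subst h; linarith
  subst e1 e2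
  have key := hL.up_conn v b b' hadj hab hadj' hab'
  have hlift : ∀ {u}, h v < h u → h v ≤ s ∧ s ≤ h u := fun {u} hu =>
    ⟨by linarith, by rcases hgap u with h | h <;> linarith⟩
  have e3 : z = cross h v b s := hz.2 ▸ eq_cross hab hze
  have e4 : z' = cross h v b' s := hz'.2 ▸ eq_cross hab' hze'
  rw [e3, e4]
  clear e3 e4 hze hze' hxe hxe' hz hz' hadj' hab' h1 h1'
  induction key with
  | refl => rfl
  | @tail y y' _ hyy' ih =>
    obtain ⟨hy, hy', T, hT, hvT, hyT, hyT'⟩ := hyy'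
    refine ih.trans ?_
    rcases eq_or_ne (cross h v y s) (cross h v y' s) with h1 | h1
    · rw [h1]
    have hin : ∀ {u}, u ∈ T → h v < h u → cross h v u s ∈ C ∧ cross h v u s ∈ faceBody T := by
      intro u huT hu
      have hadj := adj_of_mem_lt hT hvT huT hu
      have h2 := cross_mem hu (hlift hu).1 (hlift hu).2
      exact ⟨hC _ (cross_mem_crossSet hadj hu (hlift hu).1 (hlift hu).2)
        ⟨v, u, hadj, hu, h2, left_mem_edgeBody _ _⟩, edgeBody_subset_faceBody hvT huT h2⟩
    exact ReflTransGen.single ⟨(hin hyT hy).1, (hin hyT' hy').1, h1, T, hT, (hin hyT hy).2,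
      (hin hyT' hy').2⟩

/-- Connected sets have connected preimages at a neighbouring level. -/
theorem LevelRegular.linked_preimage (hL : K.LevelRegular h) {s s' : ℝ}
    (hgap : ∀ v, h v ≤ s' ∨ s < h v) (hss : s' < s) (htop : ∃ v, s < h v) {C : Set (V → ℝ)}
    (hCs : C ⊆ K.crossSet h s') (hC : Linked K.ChordRel C) :
    Linked K.ChordRel {z | z ∈ K.crossSet h s ∧ ∃ x ∈ C, K.Over h z x} := by
  rintro z ⟨hz, x, hx, hzx⟩ z' ⟨hz', x', hx', hzx'⟩
  set D := {z | z ∈ K.crossSet h s ∧ ∃ x ∈ C, K.Over h z x}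
  have key := hC x hx x' hx'
  clear hx'
  have hD : ∀ x ∈ C, ∀ w ∈ K.crossSet h s, K.Over h w x → w ∈ D :=
    fun x hx w hw hwx => ⟨hw, x, hx, hwx⟩
  induction key generalizing z' with
  | refl => exact hL.linked_fiber hgap hss (hCs hx) (hD x hx) hz hz' hzx hzx'
  | @tail y y' _ hyy' ih =>
    obtain ⟨hy, hy', hne, T, hT, hyT, hyT'⟩ := hyy'
    -- A chord lifts to a chord or a point in the same triangle; the fibres over its two ends are
    -- connected.
    obtain ⟨w, hw, hwT, hwy⟩ :=
      hL.exists_over_mem hgap hss htop hT (hCs hy) (hCs hy') hne hyT hyT'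
    obtain ⟨w', hw', hwT', hwy'⟩ :=
      hL.exists_over_mem hgap hss htop hT (hCs hy') (hCs hy) hne.symm hyT' hyT
    have h1 := ih w hw hwy
    have h2 := hL.linked_fiber hgap hss (hCs hy') (hD y' hy') hw' hz' hwy' hzx'
    refine h1.trans (ReflTransGen.trans ?_ h2)
    rcases eq_or_ne w w' with rfl | h3
    · rfl
    · exact ReflTransGen.single ⟨hD y hy w hw hwy, hD y' hy' w' hw' hwy', h3, T, hT, hwT, hwT'⟩

/-- The map given by `Over` is surjective and sends chords to chords or points, since both ends stay
in the same triangle. -/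
theorem LevelRegular.linked_image (hL : K.LevelRegular h) {s s' : ℝ}
    (hgap : ∀ v, h v ≤ s' ∨ s < h v) (hss : s' < s) (htop : ∃ v, s < h v)
    (hC : Linked K.ChordRel (K.crossSet h s)) : Linked K.ChordRel (K.crossSet h s') := by
  intro x hx x' hx'
  obtain ⟨z, hz, hzx⟩ := hL.exists_over hgap hss htop hx
  obtain ⟨z', hz', hzx'⟩ := hL.exists_over hgap hss htop hx'
  have key := hC z hz z' hz'
  induction key generalizing x' with
  | refl => rw [hzx.eq (not_vertex hgap hss hz) hzx' (hx.2.trans hx'.2.symm)]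
  | @tail w w' _ hww' ih =>
    obtain ⟨hw, hw', hne, T, hT, hwT, hwT'⟩ := hww'
    obtain ⟨y, hy, hwy⟩ := exists_under hgap hss hw
    refine (ih y hy hw hwy).trans ?_
    rcases eq_or_ne y x' with rfl | h1
    · rfl
    · exact ReflTransGen.single ⟨hy, hx', h1, T, hT, hwy.mem_face (not_vertex hgap hss hw) hwT,
        hzx'.mem_face (not_vertex hgap hss hw') hwT'⟩

/-- Induction on the number of vertices below the level. From the highest vertex value below `s` one
ascends to a level without vertices by taking preimages, and from there to `s`, which may again
contain vertices, by taking an image. -/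
theorem LevelRegular.linked_crossSet (hL : K.LevelRegular h) {m : ℝ} (hm : ∀ v, m ≤ h v)
    (hm' : ∃ v, h v = m) (hlink : Linked K.ChordRel (K.crossSet h m)) (s : ℝ) (hms : m ≤ s)
    (hs : ∃ v, s ≤ h v) : Linked K.ChordRel (K.crossSet h s) := by
  classical
  obtain ⟨v₀, hv₀⟩ := hm'
  generalize hn : (Finset.univ.filter fun v => h v < s).card = n
  induction n using Nat.strong_induction_on generalizing s with
  | _ n ih =>
    rcases hms.eq_or_lt with rfl | hms
    · exact hlink
    have hne : (Finset.univ.filter fun v => h v < s).Nonempty := ⟨v₀, by simp [hv₀, hms]⟩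
    obtain ⟨v₁, hv₁, hmax⟩ := Finset.exists_max_image _ h hne
    simp only [Finset.mem_filter, Finset.mem_univ, true_and] at hv₁ hmax
    have h1 : Linked K.ChordRel (K.crossSet h (h v₁)) := by
      refine ih _ ?_ (h v₁) (hm v₁) ⟨v₁, le_rfl⟩ rfl
      rw [← hn]
      refine Finset.card_lt_card ⟨fun v hv => ?_, fun hcon => ?_⟩
      · simp only [Finset.mem_filter, Finset.mem_univ, true_and] at hv ⊢
        linarith
      · have := hcon (x := v₁) (by simpa using hv₁)
        simp at this
    -- An intermediate level without vertices.
    obtain ⟨r, hr1, hr2⟩ := exists_between hv₁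
    obtain ⟨v₂, hv₂⟩ := hs
    have hgap : ∀ v, h v ≤ h v₁ ∨ r < h v := by
      intro v
      rcases lt_or_ge (h v) s with h | h
      · exact Or.inl (hmax v h)
      · exact Or.inr (by linarith)
    have h2 : Linked K.ChordRel (K.crossSet h r) := by
      have := hL.linked_preimage hgap hr1 ⟨v₂, by linarith⟩ subset_rfl h1
      convert this using 1
      ext z
      exact ⟨fun hz => ⟨hz, exists_under hgap hr1 hz⟩, fun hz => hz.1⟩
    -- For `-h` the level `s` lies below `r`, so the passage from `r` to `s` is an image.
    rw [← crossSet_neg] at h2 ⊢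
    refine hL.neg.linked_image (s := -r) (fun v => ?_) (neg_lt_neg hr2)
      ⟨v₁, neg_lt_neg hr1⟩ h2
    simp only [Pi.neg_apply, neg_le_neg_iff, neg_lt_neg_iff]
    rcases lt_or_ge (h v) s with h | h
    · exact Or.inr (by linarith [hmax v h])
    · exact Or.inl h

/-- The orders along neighbouring level curves agree. -/
theorem LevelRegular.pos_le_of_gap (hL : K.LevelRegular h) {s s' : ℝ}
    (hgap : ∀ v, h v ≤ s' ∨ s < h v) (hss : s' < s) (htop : ∃ v, s < h v) {z₀ x₀ : V → ℝ}
    {pos pos' : (V → ℝ) → ℕ} (hp : PathOrder K.ChordRel (K.crossSet h s) z₀ pos)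
    (hp' : PathOrder K.ChordRel (K.crossSet h s') x₀ pos') (h₀ : K.Over h z₀ x₀)
    {z₁ z₂ x₁ x₂ : V → ℝ} (hz₁ : z₁ ∈ K.crossSet h s) (hz₂ : z₂ ∈ K.crossSet h s)
    (hx₁ : x₁ ∈ K.crossSet h s') (hx₂ : x₂ ∈ K.crossSet h s') (h₁ : K.Over h z₁ x₁)
    (h₂ : K.Over h z₂ x₂) (hle : pos z₁ ≤ pos z₂) : pos' x₁ ≤ pos' x₂ := by
  -- The points over the initial segment that ends at `x₂` form a connected set containing the
  -- start. So they are an initial segment of the level `s`, and it contains `z₁` along with `z₂`.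
  have h3 := hL.linked_preimage hgap hss htop (C := {x | x ∈ K.crossSet h s' ∧ pos' x ≤ pos' x₂})
    (fun x hx => hx.1) (hp'.linked_le (fun _ _ => ChordRel.symm) _)
  obtain ⟨-, x, hx, hzx⟩ := hp.mem_of_le (C := {z | z ∈ K.crossSet h s ∧
    ∃ x ∈ {x | x ∈ K.crossSet h s' ∧ pos' x ≤ pos' x₂}, K.Over h z x}) (fun z hz => hz.1)
    ⟨hp.mem, x₀, ⟨hp'.mem, by rw [hp'.zero]; omega⟩, h₀⟩ h3 ⟨hz₂, x₂, ⟨hx₂, le_rfl⟩, h₂⟩ hz₁ hle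
  rw [h₁.eq (not_vertex hgap hss hz₁) hzx (hx₁.2.trans hx.1.2.symm)]
  exact hx.2

end TriComplex

/-! ### Extensions of node values: monotonicity and continuity -/

namespace TriComplex

open AffineMap Set Relation

/-- A function on the image of a compact set is continuous if its pullback is. -/
theorem continuousOn_image_of_isCompact {X Y Z : Type*} [TopologicalSpace X] [TopologicalSpace Y]
    [T2Space Y] [TopologicalSpace Z] {A : Set X} (hA : IsCompact A) {q : X → Y}
    (hq : ContinuousOn q A) {F : Y → Z} (hF : ContinuousOn (fun x => F (q x)) A) :
    ContinuousOn F (q '' A) := by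
  rw [continuousOn_iff_isClosed]
  intro t ht
  -- A closed set upstairs is compact, hence so is its image, which is therefore closed.
  obtain ⟨u, hu, hut⟩ := continuousOn_iff_isClosed.1 hF t ht
  refine ⟨q '' (A ∩ u), ((hA.inter_right hu).image_of_continuousOn
    (hq.mono inter_subset_left)).isClosed, ?_⟩
  ext y
  constructor
  · rintro ⟨hy, x, hx, rfl⟩
    have : x ∈ u ∩ A := hut ▸ ⟨hy, hx⟩
    exact ⟨⟨x, ⟨hx, this.1⟩, rfl⟩, x, hx, rfl⟩
  · rintro ⟨⟨x, hx, rfl⟩, hy⟩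
    have : x ∈ (fun x => F (q x)) ⁻¹' t ∩ A := hut ▸ ⟨hx.2, hx.1⟩
    exact ⟨this.1, hy⟩

theorem exists_bracket (S : Finset ℝ) {a b s : ℝ} (ha : a ∈ S) (hb : b ∈ S) (has : a ≤ s)
    (hsb : s ≤ b) : ∃ s₁ ∈ S, ∃ s₂ ∈ S, a ≤ s₁ ∧ s₁ ≤ s ∧ s ≤ s₂ ∧ s₂ ≤ b ∧
      (∀ r ∈ S, ¬ (s₁ < r ∧ r < s₂)) ∧ (s ∈ S → s₁ = s ∧ s₂ = s) := by
  classical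
  obtain ⟨s₁, h1, h1'⟩ := Finset.exists_max_image (S.filter (· ≤ s)) (fun r => r) ⟨a, by simp [ha, has]⟩
  obtain ⟨s₂, h2, h2'⟩ := Finset.exists_min_image (S.filter (s ≤ ·)) (fun r => r) ⟨b, by simp [hb, hsb]⟩
  simp only [Finset.mem_filter] at h1 h1' h2 h2'
  refine ⟨s₁, h1.1, s₂, h2.1, h1' a ⟨ha, has⟩, h1.2, h2.2, h2' b ⟨hb, hsb⟩, fun r hr hrs => ?_,
    fun hs => ⟨le_antisymm h1.2 (h1' s ⟨hs, le_rfl⟩), le_antisymm (h2' s ⟨hs, le_rfl⟩) h2.2⟩⟩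
  rcases le_total r s with h | h
  · exact absurd (h1' r ⟨hr, h⟩) (not_le.2 hrs.1)
  · exact absurd (h2' r ⟨hr, h⟩) (not_le.2 hrs.2)

variable {V : Type*} [Fintype V]

set_option linter.unusedSectionVars false

/-- `E` is a union of edges that contains one end point of every level curve between `0` and
`p`. -/
structure IsSide (K : TriComplex V) (h : V → ℝ) (p : ℝ) (E : Set (V → ℝ)) : Prop where
  edge : ∀ x ∈ E, ∃ a b, K.graph.Adj a b ∧ h a < h b ∧ x ∈ edgeBody a b ∧ edgeBody a b ⊆ E
  isEnd : ∀ x ∈ E, ∀ y ∈ K.crossSet h (ext h x), ∀ y' ∈ K.crossSet h (ext h x),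
    K.ChordRel x y → K.ChordRel x y' → y = y'
  exists_mem : ∀ s, 0 ≤ s → s ≤ p → ∃ x ∈ E, ext h x = s

/-- A quadrilateral with bottom `h = 0` and top `h = p`, each level curve of `h` leading from the
side `start` to the side `fin`. -/
structure IsQuad (K : TriComplex V) (h : V → ℝ) (p : ℝ) (start fin : Set (V → ℝ)) : Prop where
  reg : K.LevelRegular h
  pos : 0 < p
  nonneg : ∀ v, 0 ≤ h v
  le : ∀ v, h v ≤ p
  exists_zero : ∃ v, h v = 0
  exists_top : ∃ v, h v = p
  linked : Linked K.ChordRel (K.crossSet h 0)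
  start_side : K.IsSide h p start
  fin_side : K.IsSide h p fin
  disjoint : Disjoint start fin

/-- `pos s` numbers the points of `crossSet h s` along the level curve `h = s`, beginning with the
point `x₀ s` of `start`. -/
def IsLevelOrder (K : TriComplex V) (h : V → ℝ) (p : ℝ) (start : Set (V → ℝ)) (x₀ : ℝ → V → ℝ)
    (pos : ℝ → (V → ℝ) → ℕ) : Prop :=
  ∀ s, 0 ≤ s → s ≤ p → x₀ s ∈ start ∧ PathOrder K.ChordRel (K.crossSet h s) (x₀ s) (pos s)

variable {K : TriComplex V} {h : V → ℝ} {p : ℝ} {start fin : Set (V → ℝ)}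
  {x₀ : ℝ → V → ℝ} {pos : ℝ → (V → ℝ) → ℕ}

theorem IsSide.mem_crossSet {E : Set (V → ℝ)} (hE : K.IsSide h p E) {x : V → ℝ} (hx : x ∈ E) :
    x ∈ K.crossSet h (ext h x) := by
  obtain ⟨a, b, h1, h2, h3, -⟩ := hE.edge x hx
  exact ⟨⟨a, b, h1, h2, h3⟩, rfl⟩

theorem IsCross.mem_body {x : V → ℝ} (hx : K.IsCross h x) : x ∈ K.body := by
  obtain ⟨a, b, hab, -, hx⟩ := hx
  obtain ⟨-, T, hT, ha, hb⟩ := hab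
  exact ⟨T, hT, edgeBody_subset_faceBody ha hb hx⟩

namespace IsQuad

variable (hQ : K.IsQuad h p start fin)

include hQ

theorem ext_mem {x : V → ℝ} (hx : x ∈ K.body) : 0 ≤ ext h x ∧ ext h x ≤ p := by
  obtain ⟨T, hT, hx⟩ := hx
  exact ⟨le_ext_of_mem hx fun v _ => hQ.nonneg v, ext_le_of_mem hx fun v _ => hQ.le v⟩

/-- A level is connected, its points have at most two neighbours, and its point on `start` has at
most one. Outside `[0, p]` the chosen values are arbitrary. -/
theorem exists_levelOrder : ∃ x₀ pos, K.IsLevelOrder h p start x₀ pos := by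
  have key : ∀ s, ∃ x₀ pos, 0 ≤ s → s ≤ p →
      x₀ ∈ start ∧ PathOrder K.ChordRel (K.crossSet h s) x₀ pos := by
    intro s
    by_cases hs : 0 ≤ s ∧ s ≤ p
    · obtain ⟨x₀, hx₀, rfl⟩ := hQ.start_side.exists_mem s hs.1 hs.2
      obtain ⟨v, hv⟩ := hQ.exists_top
      obtain ⟨pos, hpos⟩ := exists_pathOrder (R := K.ChordRel) (fun _ _ => ChordRel.symm)
        ChordRel.irrefl (hQ.start_side.mem_crossSet hx₀)
        (hQ.reg.linked_crossSet hQ.nonneg hQ.exists_zero hQ.linked (ext h x₀) hs.1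
          ⟨v, by rw [hv]; exact hs.2⟩)
        (hQ.start_side.isEnd x₀ hx₀)
        (fun x hx y₁ h₁ y₂ h₂ y₃ h₃ => hQ.reg.chordRel_le_two hx h₁ h₂ h₃)
      exact ⟨x₀, pos, fun _ _ => ⟨hx₀, hpos⟩⟩
    · exact ⟨0, fun _ => 0, fun h1 h2 => absurd ⟨h1, h2⟩ hs⟩
  choose x₀ pos h1 using key
  exact ⟨x₀, pos, h1⟩

variable (ho : K.IsLevelOrder h p start x₀ pos)

include ho

/-- A point of `fin` is an end of its level and is not the start. -/
theorem pos_le_fin {x y : V → ℝ} (hx : x ∈ fin) (hy : y ∈ K.crossSet h (ext h x)) :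
    pos (ext h x) y ≤ pos (ext h x) x := by
  have hxc := hQ.fin_side.mem_crossSet hx
  have hs := hQ.ext_mem hxc.1.mem_body
  refine (ho _ hs.1 hs.2).2.le_of_end (fun _ _ => ChordRel.symm) hxc ?_ (hQ.fin_side.isEnd x hx) hy
  intro heq
  exact hQ.disjoint.le_bot ⟨by rw [heq]; exact (ho _ hs.1 hs.2).1, hx⟩

/-- A second point of `start` would be an end different from the first one, hence the last point of
the level. But the last point lies on `fin`. -/
theorem eq_start {x : V → ℝ} (hx : x ∈ start) : x = x₀ (ext h x) := by
  by_contra hne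
  have hxc := hQ.start_side.mem_crossSet hx
  have hs := hQ.ext_mem hxc.1.mem_body
  have hp := (ho _ hs.1 hs.2).2
  obtain ⟨y, hy, hyx⟩ := hQ.fin_side.exists_mem _ hs.1 hs.2
  have hyc := hyx ▸ hQ.fin_side.mem_crossSet hy
  have h1 := hp.le_of_end (fun _ _ => ChordRel.symm) hxc hne (hQ.start_side.isEnd x hx) hyc
  have h2 := hQ.pos_le_fin ho hy (hyx ▸ hxc)
  rw [hyx] at h2
  have := hp.inj hxc hyc (le_antisymm h2 h1)
  exact hQ.disjoint.le_bot ⟨this ▸ hx, hy⟩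

/-- The starting points of neighbouring levels correspond to each other, as
`LevelRegular.pos_le_of_gap` requires. -/
theorem over_start {s s' : ℝ} {a b : V}
    (hab : h a < h b) (hadj : K.graph.Adj a b) (hs₀ : x₀ s ∈ edgeBody a b)
    (hE : edgeBody a b ⊆ start) (h1 : h a ≤ s') (h2 : s' ≤ h b) : K.Over h (x₀ s) (x₀ s') := by
  have h3 := cross_mem hab h1 h2
  have h4 := hQ.eq_start ho (hE h3)
  rw [ext_cross hab.ne] at h4
  exact ⟨a, b, hadj, hab, hs₀, h4 ▸ h3⟩

end IsQuad

/-- `F` extends the values `nv` at the nodes as the conjugate function does. -/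
structure IsExtension (K : TriComplex V) (h : V → ℝ) (S : Finset ℝ) (nv F : (V → ℝ) → ℝ) :
    Prop where
  node : ∀ x, K.IsNode h S x → F x = nv x
  edge : ∀ a b, K.graph.Adj a b → ∀ x ∈ edgeBody a b, ∀ y ∈ edgeBody a b,
    K.IsNode h S x → K.IsNode h S y → ext h x ≤ ext h y →
    (∀ s ∈ S, ¬ (ext h x < s ∧ s < ext h y)) →
    ∀ t ∈ Set.Icc (0 : ℝ) 1, F (AffineMap.lineMap x y t) = AffineMap.lineMap (F x) (F y) t
  chord : ∀ T ∈ K.tri, ∀ a ∈ T, ∀ a' ∈ T, ∀ b ∈ T, ∀ b' ∈ T,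
    ∀ x ∈ edgeBody a a', ∀ y ∈ edgeBody b b', ext h x = ext h y →
    ∀ t ∈ Set.Icc (0 : ℝ) 1, F (AffineMap.lineMap x y t) = AffineMap.lineMap (F x) (F y) t

/-- The values `nv` increase along the level curves from `0` on `start` to `W` on `fin`. -/
structure IsMonotoneValue (K : TriComplex V) (h : V → ℝ) (S : Finset ℝ) (start fin : Set (V → ℝ))
    (pos : ℝ → (V → ℝ) → ℕ) (W : ℝ) (nv : (V → ℝ) → ℝ) : Prop where
  lt : ∀ s ∈ S, ∀ x ∈ K.crossSet h s, ∀ y ∈ K.crossSet h s, pos s x < pos s y → nv x < nv y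
  start : ∀ x ∈ start, ext h x ∈ S → nv x = 0
  fin : ∀ x ∈ fin, ext h x ∈ S → nv x = W

variable {S : Finset ℝ} {W : ℝ} {nv F : (V → ℝ) → ℝ}

theorem isNode_of_mem_crossSet {s : ℝ} (hs : s ∈ S) {x : V → ℝ} (hx : x ∈ K.crossSet h s) :
    K.IsNode h S x := by
  obtain ⟨⟨a, b, hadj, hab, hxe⟩, rfl⟩ := hx
  exact Or.inr ⟨a, b, hadj, hab, hxe, hs⟩

theorem IsNode.mem_crossSet (hL : K.LevelRegular h) (hS : ∀ v, h v ∈ S) {x : V → ℝ}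
    (hx : K.IsNode h S x) : ext h x ∈ S ∧ x ∈ K.crossSet h (ext h x) := by
  rcases hx with ⟨v, rfl⟩ | ⟨a, b, hadj, hab, hxe, hxS⟩
  · exact ⟨by rw [ext_pt]; exact hS v, hL.pt_cross v, rfl⟩
  · exact ⟨hxS, ⟨a, b, hadj, hab, hxe⟩, rfl⟩

theorem cross_eq_lineMap {a b : V} {s s₁ s₂ : ℝ} (h12 : s₁ < s₂) {z x y : V → ℝ}
    (hz : z = cross h a b s) (hx : x = cross h a b s₁) (hy : y = cross h a b s₂) :
    z = lineMap x y ((s - s₁) / (s₂ - s₁)) := by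
  rw [hz, hx, hy, ← cross_lineMap]
  congr 1
  rw [lineMap_apply_ring']
  have : s₂ - s₁ ≠ 0 := by linarith
  field_simp
  ring

theorem ratio_mem {s s₁ s₂ : ℝ} (h1 : s₁ ≤ s) (h2 : s ≤ s₂) :
    (s - s₁) / (s₂ - s₁) ∈ Icc (0 : ℝ) 1 := by
  constructor
  · exact div_nonneg (by linarith) (by linarith)
  · exact div_le_one_of_le₀ (by linarith) (by linarith)

/-- On an edge, an extension is affine between consecutive nodes. -/
theorem IsExtension.apply_cross (hF : K.IsExtension h S nv F) {a b : V} (hadj : K.graph.Adj a b)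
    (hab : h a < h b) {s s₁ s₂ : ℝ} (hs₁ : s₁ ∈ S) (hs₂ : s₂ ∈ S) (h12 : s₁ < s₂) (ha : h a ≤ s₁)
    (hb : s₂ ≤ h b) (h1 : s₁ ≤ s) (h2 : s ≤ s₂) (hgap : ∀ r ∈ S, ¬ (s₁ < r ∧ r < s₂)) :
    F (cross h a b s) =
      lineMap (F (cross h a b s₁)) (F (cross h a b s₂)) ((s - s₁) / (s₂ - s₁)) := by
  rw [cross_eq_lineMap h12 rfl rfl rfl]
  have hx := cross_mem_crossSet hadj hab ha (h12.le.trans hb)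
  have hy := cross_mem_crossSet hadj hab (ha.trans h12.le) hb
  refine hF.edge a b hadj _ (cross_mem hab ha (h12.le.trans hb)) _
    (cross_mem hab (ha.trans h12.le) hb) (isNode_of_mem_crossSet hs₁ hx)
    (isNode_of_mem_crossSet hs₂ hy) ?_ ?_ _ (ratio_mem h1 h2)
  · rw [hx.2, hy.2]; exact h12.le
  · rw [hx.2, hy.2]; exact hgap

theorem cross_of_mem_crossSet {s : ℝ} {z : V → ℝ} {a b : V} (hz : z ∈ K.crossSet h s)
    (hab : h a < h b) (hze : z ∈ edgeBody a b) :
    z = cross h a b s ∧ h a ≤ s ∧ s ≤ h b := by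
  have h1 := ext_mem_of_mem_edgeBody hab.le hze
  have h2 := eq_cross hab hze
  rw [hz.2] at h1 h2
  exact ⟨h2, h1⟩

/-- An extension increases strictly along every level curve. -/
theorem IsQuad.lt_of_pos_lt (hQ : K.IsQuad h p start fin) (ho : K.IsLevelOrder h p start x₀ pos)
    (hS : ∀ v, h v ∈ S) (hS' : ∀ s ∈ S, 0 ≤ s ∧ s ≤ p)
    (hnv : K.IsMonotoneValue h S start fin pos W nv) (hF : K.IsExtension h S nv F) {s : ℝ}
    (hs : 0 ≤ s) (hsp : s ≤ p) {z₁ z₂ : V → ℝ} (hz₁ : z₁ ∈ K.crossSet h s)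
    (hz₂ : z₂ ∈ K.crossSet h s) (hlt : pos s z₁ < pos s z₂) : F z₁ < F z₂ := by
  by_cases hsS : s ∈ S
  · rw [hF.node _ (isNode_of_mem_crossSet hsS hz₁), hF.node _ (isNode_of_mem_crossSet hsS hz₂)]
    exact hnv.lt s hsS _ hz₁ _ hz₂ hlt
  obtain ⟨v₀, hv₀⟩ := hQ.exists_zero
  obtain ⟨v₁, hv₁⟩ := hQ.exists_top
  obtain ⟨s₁, hs₁, s₂, hs₂, -, h1, h2, -, hgap, -⟩ :=
    exists_bracket S (hv₀ ▸ hS v₀) (hv₁ ▸ hS v₁) hs hsp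
  -- Since `s` is not in `S`, it lies strictly between consecutive elements of `S`. No vertex is in
  -- this gap, so the edges through `z₁` and `z₂` reach from the level `s₁` to the level `s₂`.
  replace h1 : s₁ < s := lt_of_le_of_ne h1 fun h => hsS (h ▸ hs₁)
  replace h2 : s < s₂ := lt_of_le_of_ne h2 fun h => hsS (h ▸ hs₂)
  have hgap1 : ∀ v, h v ≤ s₁ ∨ s < h v := fun v => by
    by_contra hcon
    push Not at hcon
    exact hgap _ (hS v) ⟨hcon.1, hcon.2.trans_lt h2⟩
  have hgap2 : ∀ v, (-h) v ≤ -s₂ ∨ -s < (-h) v := fun v => by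
    by_contra hcon
    simp only [Pi.neg_apply] at hcon
    push Not at hcon
    exact hgap _ (hS v) ⟨by linarith, by linarith⟩
  have hbd : ∀ v, h v ≤ s → h v ≤ s₁ := fun v hv => (hgap1 v).resolve_right (not_lt.2 hv)
  have hbd' : ∀ v, s ≤ h v → s₂ ≤ h v := fun v hv => by
    by_contra hcon
    push Not at hcon
    exact hgap _ (hS v) ⟨h1.trans_le hv, hcon⟩
  obtain ⟨hst, hp⟩ := ho s hs hsp
  obtain ⟨hst1, hp1⟩ := ho s₁ (hS' s₁ hs₁).1 (hS' s₁ hs₁).2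
  obtain ⟨hst2, hp2⟩ := ho s₂ (hS' s₂ hs₂).1 (hS' s₂ hs₂).2
  obtain ⟨a, b, hadj, hab, hse, hsE⟩ := hQ.start_side.edge _ hst
  obtain ⟨-, ha, hb⟩ := cross_of_mem_crossSet hp.mem hab hse
  have hov1 := hQ.over_start ho (s' := s₁) hab hadj hse hsE (hbd a ha) (h1.le.trans hb)
  have hov2 := hQ.over_start ho (s' := s₂) hab hadj hse hsE (ha.trans h2.le) (hbd' b hb)
  obtain ⟨a₁, b₁, hadj₁, hab₁, hze₁⟩ := hz₁.1
  obtain ⟨a₂, b₂, hadj₂, hab₂, hze₂⟩ := hz₂.1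
  obtain ⟨e₁, ha₁, hb₁⟩ := cross_of_mem_crossSet hz₁ hab₁ hze₁
  obtain ⟨e₂, ha₂, hb₂⟩ := cross_of_mem_crossSet hz₂ hab₂ hze₂
  have hx₁ := cross_mem_crossSet hadj₁ hab₁ (hbd _ ha₁) (h1.le.trans hb₁)
  have hx₂ := cross_mem_crossSet hadj₂ hab₂ (hbd _ ha₂) (h1.le.trans hb₂)
  have hy₁ := cross_mem_crossSet hadj₁ hab₁ (ha₁.trans h2.le) (hbd' _ hb₁)
  have hy₂ := cross_mem_crossSet hadj₂ hab₂ (ha₂.trans h2.le) (hbd' _ hb₂)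
  have hle1 := hQ.reg.pos_le_of_gap hgap1 h1 ⟨v₁, by linarith [(hS' s₂ hs₂).2]⟩ hp hp1 hov1 hz₁ hz₂
    hx₁ hx₂ ⟨a₁, b₁, hadj₁, hab₁, hze₁, cross_mem hab₁ (hbd _ ha₁) (h1.le.trans hb₁)⟩
    ⟨a₂, b₂, hadj₂, hab₂, hze₂, cross_mem hab₂ (hbd _ ha₂) (h1.le.trans hb₂)⟩ hlt.le
  -- The upper level is the lower one for `-h`.
  have hle2 : pos s₂ (cross h a₁ b₁ s₂) ≤ pos s₂ (cross h a₂ b₂ s₂) := by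
    refine hQ.reg.neg.pos_le_of_gap (s := -s) (s' := -s₂) (z₀ := x₀ s) (x₀ := x₀ s₂) (pos := pos s)
      hgap2 (neg_lt_neg h2)
      ⟨v₀, by rw [Pi.neg_apply]; linarith [(hS' s₁ hs₁).1]⟩ (by rwa [crossSet_neg])
      (by rwa [crossSet_neg]) hov2.neg (by rwa [crossSet_neg]) (by rwa [crossSet_neg])
      (by rwa [crossSet_neg]) (by rwa [crossSet_neg])
      (Over.neg ⟨a₁, b₁, hadj₁, hab₁, hze₁, cross_mem hab₁ (ha₁.trans h2.le) (hbd' _ hb₁)⟩)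
      (Over.neg ⟨a₂, b₂, hadj₂, hab₂, hze₂, cross_mem hab₂ (ha₂.trans h2.le) (hbd' _ hb₂)⟩) hlt.le
  have hval : ∀ s' ∈ S, ∀ x ∈ K.crossSet h s', ∀ y ∈ K.crossSet h s', pos s' x ≤ pos s' y →
      F x ≤ F y ∧ (F x = F y → x = y) := by
    intro s' hs' x hx y hy hxy
    rw [hF.node _ (isNode_of_mem_crossSet hs' hx), hF.node _ (isNode_of_mem_crossSet hs' hy)]
    rcases hxy.lt_or_eq with h | h
    · have := hnv.lt s' hs' x hx y hy h
      exact ⟨this.le, fun h' => absurd h' this.ne⟩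
    · rw [(ho s' (hS' s' hs').1 (hS' s' hs').2).2.inj hx hy h]
      exact ⟨le_rfl, fun _ => rfl⟩
  obtain ⟨m1, m1'⟩ := hval s₁ hs₁ _ hx₁ _ hx₂ hle1
  obtain ⟨m2, m2'⟩ := hval s₂ hs₂ _ hy₁ _ hy₂ hle2
  have h12 := h1.trans h2
  have f₁ := hF.apply_cross hadj₁ hab₁ hs₁ hs₂ h12 (hbd _ ha₁) (hbd' _ hb₁) h1.le h2.le hgap
  have f₂ := hF.apply_cross hadj₂ hab₂ hs₁ hs₂ h12 (hbd _ ha₂) (hbd' _ hb₂) h1.le h2.le hgap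
  rw [← e₁] at f₁
  rw [← e₂] at f₂
  have hr1 : 0 < (s - s₁) / (s₂ - s₁) := div_pos (by linarith) (by linarith)
  have hr2 : (s - s₁) / (s₂ - s₁) < 1 := by rw [div_lt_one (by linarith)]; linarith
  rw [f₁, f₂, lineMap_apply_ring, lineMap_apply_ring]
  rcases m1.lt_or_eq with m1 | m1
  · nlinarith
  rcases m2.lt_or_eq with m2 | m2
  · nlinarith
  -- Equal values on both levels mean equal points there; then `z₁` and `z₂` divide the same segment
  -- in the same ratio.
  exfalso
  have g₁ := cross_eq_lineMap h12 e₁ rfl rfl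
  have g₂ := cross_eq_lineMap h12 e₂ rfl rfl
  rw [m1' m1, m2' m2, ← g₂] at g₁
  exact hlt.ne (by rw [g₁])

/-- A side contains whole edges, and `F` interpolates between nodes at which its value is `W`. -/
theorem IsExtension.eq_on_side (hS : ∀ v, h v ∈ S)
    (hF : K.IsExtension h S nv F) {E : Set (V → ℝ)} (hE : K.IsSide h p E) {W : ℝ}
    (hW : ∀ x ∈ E, ext h x ∈ S → nv x = W) {x : V → ℝ} (hx : x ∈ E) : F x = W := by
  obtain ⟨a, b, hadj, hab, hxe, hsub⟩ := hE.edge x hx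
  obtain ⟨e, ha, hb⟩ := cross_of_mem_crossSet (hE.mem_crossSet hx) hab hxe
  obtain ⟨s₁, hs₁, s₂, hs₂, ha', h1, h2, hb', hgap, hin⟩ := exists_bracket S (hS a) (hS b) ha hb
  have hval : ∀ s' ∈ S, h a ≤ s' → s' ≤ h b → F (cross h a b s') = W := by
    intro s' hs' h1 h2
    rw [hF.node _ (isNode_of_mem_crossSet hs' (cross_mem_crossSet hadj hab h1 h2))]
    exact hW _ (hsub (cross_mem hab h1 h2)) (by rw [ext_cross hab.ne]; exact hs')
  rcases (h1.trans h2).lt_or_eq with h12 | h12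
  · rw [e, hF.apply_cross hadj hab hs₁ hs₂ h12 ha' hb' h1 h2 hgap, hval s₁ hs₁ ha' (h12.le.trans hb'),
      hval s₂ hs₂ (ha'.trans h12.le) hb', lineMap_same_apply]
  · have : ext h x = s₁ := le_antisymm (h12 ▸ h2) h1
    rw [e, this]
    exact hval s₁ hs₁ ha' (h12.le.trans hb')

/-! ### Continuity -/

/-- With `h` as the parameter, `F` is piecewise affine on the edge, with breaks only at elements of
the finite set `S`. -/
theorem IsExtension.continuousOn_edge (hS : ∀ v, h v ∈ S)
    (hF : K.IsExtension h S nv F) {a b : V} (hadj : K.graph.Adj a b) (hab : h a < h b) :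
    ContinuousOn F (edgeBody a b) := by
  -- Equal entries are allowed, because `exists_bracket` returns such a pair when `s` belongs to
  -- `S`.
  let Q : Type := {q : ℝ × ℝ // q ∈ S ×ˢ S ∧ h a ≤ q.1 ∧ q.1 ≤ q.2 ∧ q.2 ≤ h b ∧
    ∀ r ∈ S, ¬ (q.1 < r ∧ r < q.2)}
  have : Finite Q := Finite.of_injective (β := {q : ℝ × ℝ // q ∈ S ×ˢ S})
    (fun q => ⟨q.1, q.2.1⟩) fun q q' hqq => Subtype.ext (by simpa using hqq)
  have h1 : ContinuousOn (fun s => F (cross h a b s))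
      (⋃ q : Q, Icc q.1.1 q.1.2) := by
    refine (locallyFinite_of_finite _).continuousOn_iUnion (fun q => isClosed_Icc) fun q => ?_
    obtain ⟨⟨s₁, s₂⟩, hq, ha, h12, hb, hgap⟩ := q
    rw [Finset.mem_product] at hq
    simp only at hq ha h12 hb hgap ⊢
    rcases h12.lt_or_eq with h12 | rfl
    · refine ContinuousOn.congr (f := fun s => lineMap (F (cross h a b s₁))
        (F (cross h a b s₂)) ((s - s₁) / (s₂ - s₁))) ?_ fun s hs =>
          hF.apply_cross hadj hab hq.1 hq.2 h12 ha hb hs.1 hs.2 hgap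
      fun_prop
    · rw [Icc_self]
      exact continuousOn_singleton _ _
  have h2 : Icc (h a) (h b) ⊆ ⋃ q : Q, Icc q.1.1 q.1.2 := by
    intro s hs
    obtain ⟨s₁, hs₁, s₂, hs₂, ha', h1, h2, hb', hgap, -⟩ := exists_bracket S (hS a) (hS b) hs.1 hs.2
    exact mem_iUnion.2 ⟨⟨(s₁, s₂), Finset.mem_product.2 ⟨hs₁, hs₂⟩, ha', h1.trans h2, hb', hgap⟩,
      h1, h2⟩
  refine ((h1.mono h2).comp (continuous_ext h).continuousOn
    fun x hx => ext_mem_of_mem_edgeBody hab.le hx).congr fun x hx => ?_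
  exact congrArg F (eq_cross hab hx)

/-- Every point of a triangle lies on a horizontal chord. -/
theorem LevelRegular.exists_lineMap (hL : K.LevelRegular h) {T : Finset V} (hT : T ∈ K.tri)
    {u : V → ℝ} (hu : u ∈ faceBody T) :
    ∃ q₁ ∈ K.crossSet h (ext h u), ∃ q₂ ∈ K.crossSet h (ext h u), q₁ ∈ faceBody T ∧
      q₂ ∈ faceBody T ∧ ∃ t ∈ Icc (0 : ℝ) 1, u = lineMap q₁ q₂ t := by
  obtain ⟨q₁, h1, q₂, h2, h3, h4, h5⟩ := hL.exists_chord hT ⟨u, hu, rfl⟩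
  exact ⟨q₁, h1, q₂, h2, h3, h4, h5 u hu rfl⟩

theorem IsExtension.apply_lineMap (hL : K.LevelRegular h) (hF : K.IsExtension h S nv F) {T : Finset V}
    (hT : T ∈ K.tri) {x y : V → ℝ} (hx : K.IsCross h x) (hy : K.IsCross h y)
    (hxT : x ∈ faceBody T) (hyT : y ∈ faceBody T) (hxy : ext h x = ext h y) {t : ℝ}
    (ht : t ∈ Icc (0 : ℝ) 1) : F (lineMap x y t) = lineMap (F x) (F y) t := by
  obtain ⟨a, ha, a', ha', -, hxe⟩ := hL.exists_edge hT hx hxT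
  obtain ⟨b, hb, b', hb', -, hye⟩ := hL.exists_edge hT hy hyT
  exact hF.chord T hT a ha a' ha' b hb b' hb' x hxe y hye hxy t ht

/-- A triangle is the image of the compact set of triples of two crossing points at a common level
and a ratio. There `F` pulls back to an expression in its values on edges, which is continuous. -/
theorem IsExtension.continuousOn (hL : K.LevelRegular h) (hS : ∀ v, h v ∈ S)
    (hF : K.IsExtension h S nv F) : ContinuousOn F K.body := by
  have hcross : {x | K.IsCross h x} =
      ⋃ e : {e : V × V // K.graph.Adj e.1 e.2 ∧ h e.1 < h e.2}, edgeBody e.1.1 e.1.2 := by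
    ext x
    simp only [IsCross, mem_ofPred_eq, mem_iUnion, Subtype.exists, Prod.exists, exists_prop,
      and_assoc]
  have hcompact : IsCompact {x | K.IsCross h x} := by
    rw [hcross]
    exact isCompact_iUnion fun e => isCompact_edgeBody _ _
  have hcont : ContinuousOn F {x | K.IsCross h x} := by
    rw [hcross]
    exact (locallyFinite_of_finite _).continuousOn_iUnion
      (fun e => (isCompact_edgeBody _ _).isClosed)
      fun e => IsExtension.continuousOn_edge hS hF e.2.1 e.2.2
  have hface : ∀ T ∈ K.tri, ContinuousOn F (faceBody T) := by
    intro T hT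
    let A : Set ((V → ℝ) × (V → ℝ) × ℝ) :=
      ({x | K.IsCross h x} ∩ faceBody T) ×ˢ ({x | K.IsCross h x} ∩ faceBody T) ×ˢ Icc (0 : ℝ) 1 ∩
        {q | ext h q.1 = ext h q.2.1}
    have hA : IsCompact A := by
      refine IsCompact.inter_right ?_ (isClosed_eq ((continuous_ext h).comp continuous_fst)
        ((continuous_ext h).comp (continuous_fst.comp continuous_snd)))
      exact (hcompact.inter_right (isClosed_faceBody T)).prod
        ((hcompact.inter_right (isClosed_faceBody T)).prod isCompact_Icc)
    have h1 : ContinuousOn (fun q : (V → ℝ) × (V → ℝ) × ℝ => F (AffineMap.lineMap q.1 q.2.1 q.2.2))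
        A := by
      refine ContinuousOn.congr (f := fun q => AffineMap.lineMap (F q.1) (F q.2.1) q.2.2) ?_ ?_
      · have e1 : ContinuousOn (fun q : (V → ℝ) × (V → ℝ) × ℝ => F q.1) A :=
          hcont.comp continuous_fst.continuousOn fun q hq => hq.1.1.1
        have e2 : ContinuousOn (fun q : (V → ℝ) × (V → ℝ) × ℝ => F q.2.1) A :=
          hcont.comp (continuous_fst.comp continuous_snd).continuousOn fun q hq => hq.1.2.1.1
        simp only [lineMap_apply_ring']
        exact ((continuous_snd.comp continuous_snd).continuousOn.mul (e2.sub e1)).add e1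
      · rintro q ⟨⟨hq1, hq2, hq3⟩, hq4⟩
        exact hF.apply_lineMap hL hT hq1.1 hq2.1 hq1.2 hq2.2 hq4 hq3
    refine (continuousOn_image_of_isCompact hA ?_ h1).mono ?_
    · simp only [lineMap_apply_module]
      fun_prop
    · intro u hu
      obtain ⟨q₁, h1, q₂, h2, h3, h4, t, ht, hut⟩ := hL.exists_lineMap hT hu
      exact ⟨(q₁, q₂, t), ⟨⟨⟨h1.1, h3⟩, ⟨h2.1, h4⟩, ht⟩, h1.2.trans h2.2.symm⟩, hut.symm⟩
  have : K.body = ⋃ T : K.tri, faceBody T.1 := by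
    ext x
    simp [body]
  rw [this]
  exact (locallyFinite_of_finite _).continuousOn_iUnion (fun T => isClosed_faceBody _)
    fun T => hface T T.2

end TriComplex

/-! ### Coordinates onto a rectangle -/

namespace TriComplex

open AffineMap Set Relation

variable {V : Type*} [Fintype V]

set_option linter.unusedSectionVars false

/-- `(h, F)` are coordinates that identify the complex with the rectangle `[0, p] × [0, W]`, the
side `start` with `F = 0` and the side `fin` with `F = W`. -/
structure IsCoordinate (K : TriComplex V) (h : V → ℝ) (p : ℝ) (start fin : Set (V → ℝ)) (W : ℝ)
    (F : (V → ℝ) → ℝ) : Prop where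
  mem : ∀ u ∈ K.body, (0 ≤ ext h u ∧ ext h u ≤ p) ∧ 0 ≤ F u ∧ F u ≤ W
  inj : ∀ u ∈ K.body, ∀ v ∈ K.body, ext h u = ext h v → F u = F v → u = v
  cont : ContinuousOn F K.body
  exists_mem : ∀ s, 0 ≤ s → s ≤ p → ∀ t, 0 ≤ t → t ≤ W → ∃ u ∈ K.body, ext h u = s ∧ F u = t
  start_iff : ∀ u ∈ K.body, u ∈ start ↔ F u = 0
  fin_iff : ∀ u ∈ K.body, u ∈ fin ↔ F u = W

variable {K : TriComplex V} {h : V → ℝ} {p : ℝ} {start fin : Set (V → ℝ)}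
  {x₀ : ℝ → V → ℝ} {pos : ℝ → (V → ℝ) → ℕ} {S : Finset ℝ} {W : ℝ} {nv F : (V → ℝ) → ℝ}

/-- Along a level curve `F` increases strictly from `0` to `W` at the crossing points and is affine
between consecutive ones. So it maps the curve bijectively onto `[0, W]`. -/
theorem IsQuad.isCoordinate_of_lt (hQ : K.IsQuad h p start fin)
    (ho : K.IsLevelOrder h p start x₀ pos)
    (hlt : ∀ s, 0 ≤ s → s ≤ p → ∀ x ∈ K.crossSet h s, ∀ y ∈ K.crossSet h s, pos s x < pos s y →
      F x < F y)
    (hstart : ∀ x ∈ start, F x = 0) (hfin : ∀ x ∈ fin, F x = W)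
    (haff : ∀ T ∈ K.tri, ∀ x y, K.IsCross h x → K.IsCross h y → x ∈ faceBody T → y ∈ faceBody T →
      ext h x = ext h y → ∀ t ∈ Icc (0 : ℝ) 1, F (lineMap x y t) = lineMap (F x) (F y) t)
    (hcont : ContinuousOn F K.body) : K.IsCoordinate h p start fin W F := by
  have hle : ∀ s, 0 ≤ s → s ≤ p → ∀ x ∈ K.crossSet h s, ∀ y ∈ K.crossSet h s,
      pos s x ≤ pos s y → F x ≤ F y := by
    intro s hs hsp x hx y hy hxy
    rcases hxy.lt_or_eq with h1 | h1
    · exact (hlt s hs hsp x hx y hy h1).le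
    · rw [(ho s hs hsp).2.inj hx hy h1]
  have hinj : ∀ s, 0 ≤ s → s ≤ p → ∀ x ∈ K.crossSet h s, ∀ y ∈ K.crossSet h s,
      F x = F y → x = y := by
    intro s hs hsp x hx y hy hxy
    rcases lt_trichotomy (pos s x) (pos s y) with h1 | h1 | h1
    · exact absurd hxy (hlt s hs hsp x hx y hy h1).ne
    · exact (ho s hs hsp).2.inj hx hy h1
    · exact absurd hxy (hlt s hs hsp y hy x hx h1).ne'
  -- Each point lies on a chord whose ends have equal or consecutive positions, in this order.
  have hrep : ∀ u ∈ K.body, ∃ q₁ ∈ K.crossSet h (ext h u), ∃ q₂ ∈ K.crossSet h (ext h u),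
      pos (ext h u) q₁ ≤ pos (ext h u) q₂ ∧ pos (ext h u) q₂ ≤ pos (ext h u) q₁ + 1 ∧
      ∃ t ∈ Icc (0 : ℝ) 1, u = lineMap q₁ q₂ t ∧ F u = lineMap (F q₁) (F q₂) t := by
    intro u hu
    have hs := hQ.ext_mem hu
    obtain ⟨-, hp⟩ := ho _ hs.1 hs.2
    obtain ⟨T, hT, huT⟩ := hu
    obtain ⟨q₁, h1, q₂, h2, h3, h4, t, ht, hut⟩ := hQ.reg.exists_lineMap hT huT
    have hval := haff T hT q₁ q₂ h1.1 h2.1 h3 h4 (h1.2.trans h2.2.symm) t ht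
    rw [← hut] at hval
    have hstep : ∀ x ∈ K.crossSet h (ext h u), ∀ y ∈ K.crossSet h (ext h u), x ∈ faceBody T →
        y ∈ faceBody T → pos (ext h u) y ≤ pos (ext h u) x + 1 := by
      intro x hx y hy hxT hyT
      rcases eq_or_ne x y with rfl | hxy
      · omega
      · exact hp.step x hx y hy ⟨hxy, T, hT, hxT, hyT⟩
    rcases le_total (pos (ext h u) q₁) (pos (ext h u) q₂) with h5 | h5
    · exact ⟨q₁, h1, q₂, h2, h5, hstep _ h1 _ h2 h3 h4, t, ht, hut, hval⟩
    · refine ⟨q₂, h2, q₁, h1, h5, hstep _ h2 _ h1 h4 h3, 1 - t, ⟨by linarith [ht.2],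
        by linarith [ht.1]⟩, ?_, ?_⟩
      · rw [lineMap_apply_one_sub, ← hut]
      · rw [lineMap_apply_one_sub, ← hval]
  have hbetween : ∀ x y : ℝ, x ≤ y → ∀ t ∈ Icc (0 : ℝ) 1, x ≤ lineMap x y t ∧ lineMap x y t ≤ y := by
    intro x y hxy t ht
    rw [lineMap_apply_ring']
    constructor <;> nlinarith [ht.1, ht.2]
  have hmem : ∀ u ∈ K.body, 0 ≤ F u ∧ F u ≤ W := by
    intro u hu
    obtain ⟨q₁, h1, q₂, h2, h3, -, t, ht, -, hF⟩ := hrep u hu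
    have hs := hQ.ext_mem hu
    obtain ⟨hst, hp⟩ := ho _ hs.1 hs.2
    have h5 := hbetween _ _ (hle _ hs.1 hs.2 _ h1 _ h2 h3) t ht
    rw [← hF] at h5
    constructor
    · refine le_trans ?_ h5.1
      rw [← hstart _ hst]
      exact hle _ hs.1 hs.2 _ hp.mem _ h1 (by rw [hp.zero]; omega)
    · refine h5.2.trans ?_
      obtain ⟨y, hy, hyu⟩ := hQ.fin_side.exists_mem _ hs.1 hs.2
      rw [← hfin y hy]
      refine hle _ hs.1 hs.2 _ h2 _ (hyu ▸ hQ.fin_side.mem_crossSet hy) ?_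
      have := hQ.pos_le_fin ho hy (y := q₂) (hyu ▸ h2)
      rwa [hyu] at this
  have hIs : ∀ u ∈ K.body, ∀ v ∈ K.body, ext h u = ext h v → F u = F v → u = v := by
    have aux : ∀ {q₁ q₂ u : V → ℝ} {t : ℝ}, u = lineMap q₁ q₂ t → F u = lineMap (F q₁) (F q₂) t →
        (F q₁ = F q₂ → q₁ = q₂) → (F u = F q₁ → u = q₁) ∧ (F u = F q₂ → u = q₂) := by
      intro q₁ q₂ u t hu hF hq
      rw [lineMap_apply_ring'] at hF
      by_cases hqq : F q₁ = F q₂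
      · obtain rfl := hq hqq
        rw [lineMap_same_apply] at hu
        exact ⟨fun _ => hu, fun _ => hu⟩
      · have hne : F q₂ - F q₁ ≠ 0 := fun h0 => hqq (by linarith)
        constructor
        · intro h1
          have : t * (F q₂ - F q₁) = 0 := by linarith
          rw [hu, (mul_eq_zero.1 this).resolve_right hne, lineMap_apply_zero]
        · intro h1
          have : (t - 1) * (F q₂ - F q₁) = 0 := by linarith
          have : t = 1 := by linarith [(mul_eq_zero.1 this).resolve_right hne]
          rw [hu, this, lineMap_apply_one]
    -- Suppose that the chord of `u` does not begin after that of `v`. If it ends before the other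
    -- one begins, equal values force both points to the adjacent ends. Otherwise the chords begin
    -- at the same point, and they coincide unless the second is degenerate.
    have key : ∀ u ∈ K.body, ∀ v ∈ K.body, ext h u = ext h v → F u = F v →
        ∀ q₁ ∈ K.crossSet h (ext h u), ∀ q₂ ∈ K.crossSet h (ext h u),
        ∀ r₁ ∈ K.crossSet h (ext h u), ∀ r₂ ∈ K.crossSet h (ext h u),
        pos (ext h u) q₁ ≤ pos (ext h u) q₂ → pos (ext h u) q₂ ≤ pos (ext h u) q₁ + 1 →
        pos (ext h u) r₁ ≤ pos (ext h u) r₂ → pos (ext h u) r₂ ≤ pos (ext h u) r₁ + 1 →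
        ∀ t ∈ Icc (0 : ℝ) 1, ∀ t' ∈ Icc (0 : ℝ) 1, u = lineMap q₁ q₂ t → v = lineMap r₁ r₂ t' →
        F u = lineMap (F q₁) (F q₂) t → F v = lineMap (F r₁) (F r₂) t' →
        pos (ext h u) q₁ ≤ pos (ext h u) r₁ → u = v := by
      intro u hu v hv huv hFuv q₁ hq₁ q₂ hq₂ r₁ hr₁ r₂ hr₂ hq hq' hr hr' t ht t' ht' eu ev fu fv hqr
      have hs := hQ.ext_mem hu
      have hinj' := hinj _ hs.1 hs.2
      have hle' := hle _ hs.1 hs.2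
      have au := aux eu fu (hinj' _ hq₁ _ hq₂)
      have av := aux ev fv (hinj' _ hr₁ _ hr₂)
      have bu := hbetween _ _ (hle' _ hq₁ _ hq₂ hq) t ht
      have bv := hbetween _ _ (hle' _ hr₁ _ hr₂ hr) t' ht'
      rw [← fu] at bu
      rw [← fv] at bv
      have hposinj := (ho _ hs.1 hs.2).2.inj
      rcases le_or_gt (pos (ext h u) q₂) (pos (ext h u) r₁) with h1 | h1
      · have h2 := hle' _ hq₂ _ hr₁ h1
        rw [au.2 (by linarith), av.1 (by linarith)]
        exact hinj' _ hq₂ _ hr₁ (by linarith)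
      · obtain rfl := hposinj hq₁ hr₁ (by omega)
        rcases hr.eq_or_lt with h2 | h2
        · obtain rfl := hposinj hr₁ hr₂ h2
          have h3 : v = q₁ := by rw [ev, lineMap_same_apply]
          rw [h3]
          exact au.1 (by rw [hFuv, h3])
        · obtain rfl := hposinj hq₂ hr₂ (by omega)
          have h3 := hlt _ hs.1 hs.2 _ hq₁ _ hq₂ h1
          rw [fu, fv, lineMap_apply_ring', lineMap_apply_ring'] at hFuv
          have : (t - t') * (F q₂ - F q₁) = 0 := by linarith
          rcases mul_eq_zero.1 this with h4 | h4
          · rw [eu, ev, sub_eq_zero.1 h4]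
          · linarith
    intro u hu v hv huv hFuv
    obtain ⟨q₁, hq₁, q₂, hq₂, hq, hq', t, ht, eu, fu⟩ := hrep u hu
    obtain ⟨r₁, hr₁, r₂, hr₂, hr, hr', t', ht', ev, fv⟩ := hrep v hv
    rw [← huv] at hr₁ hr₂ hr hr'
    rcases le_total (pos (ext h u) q₁) (pos (ext h u) r₁) with h1 | h1
    · exact key u hu v hv huv hFuv q₁ hq₁ q₂ hq₂ r₁ hr₁ r₂ hr₂ hq hq' hr hr' t ht t' ht' eu ev fu
        fv h1
    · rw [huv] at hq₁ hq₂ hr₁ hr₂ hq hq' hr hr' h1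
      exact (key v hv u hu huv.symm hFuv.symm r₁ hr₁ r₂ hr₂ q₁ hq₁ q₂ hq₂ hr hr' hq hq' t' ht' t ht
        ev eu fv fu h1).symm
  have hbody : ∀ {E}, K.IsSide h p E → ∀ x ∈ E, x ∈ K.body :=
    fun hE x hx => (hE.mem_crossSet hx).1.mem_body
  refine ⟨fun u hu => ⟨hQ.ext_mem hu, hmem u hu⟩, hIs, hcont, ?_, fun u hu => ⟨hstart u, fun h0 => ?_⟩,
    fun u hu => ⟨hfin u, fun h0 => ?_⟩⟩
  · intro s hs hsp t ht htW
    obtain ⟨hst, hp⟩ := ho s hs hsp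
    obtain ⟨z, hz, hzs⟩ := hQ.fin_side.exists_mem s hs hsp
    -- The first crossing point at which `F` is at least `t`; the value `t` is taken there or on the
    -- chord that leads to it.
    have hne : ∃ n, ∃ y ∈ K.crossSet h s, t ≤ F y ∧ pos s y = n :=
      ⟨_, z, hzs ▸ hQ.fin_side.mem_crossSet hz, by rw [hfin z hz]; exact htW, rfl⟩
    classical
    obtain ⟨y, hy, hty, hyn⟩ := Nat.find_spec hne
    have hmin := fun m => Nat.find_min hne (m := m)
    rw [← hyn] at hmin
    by_cases h0 : pos s y = 0
    · have : y = x₀ s := hp.inj hy hp.mem (by rw [h0, hp.zero])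
      have h1 := hstart _ hst
      refine ⟨y, hy.1.mem_body, hy.2, ?_⟩
      rw [this] at hty ⊢
      linarith
    · obtain ⟨x, hx, ⟨-, T, hT, hxT, hyT⟩, hxy⟩ := hp.pred y hy h0
      have hFx : F x < t := by
        by_contra hcon
        exact hmin (pos s x) (by omega) ⟨x, hx, not_lt.1 hcon, rfl⟩
      have hr : (t - F x) / (F y - F x) ∈ Icc (0 : ℝ) 1 := ratio_mem hFx.le hty
      refine ⟨lineMap x y ((t - F x) / (F y - F x)), ⟨T, hT, lineMap_mem_faceBody hxT hyT hr⟩, ?_, ?_⟩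
      · rw [ext_lineMap, hx.2, hy.2, lineMap_same_apply]
      · rw [haff T hT x y hx.1 hy.1 hxT hyT (hx.2.trans hy.2.symm) _ hr, lineMap_apply_ring']
        have : F y - F x ≠ 0 := by linarith
        field_simp
        ring
  · have hs := hQ.ext_mem hu
    obtain ⟨hst, hp⟩ := ho _ hs.1 hs.2
    rw [hIs u hu _ hp.mem.1.mem_body hp.mem.2.symm (by rw [h0, hstart _ hst])]
    exact hst
  · have hs := hQ.ext_mem hu
    obtain ⟨z, hz, hzs⟩ := hQ.fin_side.exists_mem _ hs.1 hs.2
    rw [hIs u hu z (hbody hQ.fin_side z hz) hzs.symm (by rw [h0, hfin z hz])]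
    exact hz

theorem IsQuad.isCoordinate (hQ : K.IsQuad h p start fin) (ho : K.IsLevelOrder h p start x₀ pos)
    (hS : ∀ v, h v ∈ S) (hS' : ∀ s ∈ S, 0 ≤ s ∧ s ≤ p)
    (hnv : K.IsMonotoneValue h S start fin pos W nv) (hF : K.IsExtension h S nv F) :
    K.IsCoordinate h p start fin W F :=
  hQ.isCoordinate_of_lt ho
    (fun _ hs hsp _ hx _ hy => hQ.lt_of_pos_lt ho hS hS' hnv hF hs hsp hx hy)
    (fun _ hx => hF.eq_on_side hS hQ.start_side hnv.start hx)
    (fun _ hx => hF.eq_on_side hS hQ.fin_side hnv.fin hx)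
    (fun _ hT _ _ hx hy hxT hyT hxy _ ht => hF.apply_lineMap hQ.reg hT hx hy hxT hyT hxy ht)
    (hF.continuousOn hQ.reg hS)

namespace IsCoordinate

variable (hC : K.IsCoordinate h p start fin W F)

include hC

/-- A continuous bijection from a compact space onto a Hausdorff space has a continuous inverse. -/
theorem exists_inverse : ∃ Φ : ℝ × ℝ → V → ℝ, ContinuousOn Φ (Icc 0 p ×ˢ Icc 0 W) ∧
    ∀ s ∈ Icc 0 p, ∀ t ∈ Icc 0 W, Φ (s, t) ∈ K.body ∧ ext h (Φ (s, t)) = s ∧ F (Φ (s, t)) = t := by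
  classical
  have key : ∀ q : ℝ × ℝ, ∃ u, q ∈ Icc 0 p ×ˢ Icc 0 W → u ∈ K.body ∧ ext h u = q.1 ∧ F u = q.2 := by
    intro q
    by_cases hq : q ∈ Icc 0 p ×ˢ Icc 0 W
    · obtain ⟨u, hu⟩ := hC.exists_mem q.1 hq.1.1 hq.1.2 q.2 hq.2.1 hq.2.2
      exact ⟨u, fun _ => hu⟩
    · exact ⟨0, fun h => absurd h hq⟩
  choose Φ hΦ using key
  refine ⟨Φ, ?_, fun s hs t ht => hΦ (s, t) ⟨hs, ht⟩⟩
  refine (continuousOn_image_of_isCompact (isCompact_body K) (q := fun u => (ext h u, F u))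
    ((continuous_ext h).continuousOn.prodMk hC.cont) (F := Φ)
    (continuousOn_id.congr fun u hu => ?_)).mono ?_
  · have hm := hC.mem u hu
    obtain ⟨h1, h2, h3⟩ := hΦ (ext h u, F u) ⟨hm.1, hm.2⟩
    exact hC.inj _ h1 u hu h2 h3
  · intro q hq
    obtain ⟨h1, h2, h3⟩ := hΦ q hq
    exact ⟨Φ q, h1, Prod.ext h2 h3⟩

/-- The points with smaller or equal `F` form the image of a segment under the inverse coordinates,
so they are one of the connected sets in the definition of the arc. Any other such set has an
interval containing `0` and `F x` as its image under `F`, hence contains them all. -/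
theorem arcTo_eq {x : V → ℝ} (hx : x ∈ K.body) :
    K.arcTo h start x = {u | u ∈ K.levelCurve (ext h) (ext h x) ∧ F u ≤ F x} := by
  have hm := hC.mem x hx
  ext u
  constructor
  · rintro ⟨hu, harc⟩
    refine ⟨hu, ?_⟩
    obtain ⟨Φ, hΦ, hΦ'⟩ := hC.exists_inverse
    have h0 : Icc 0 (F x) ⊆ Icc 0 W := Icc_subset_Icc_right hm.2.2
    have hsub : (fun t => Φ (ext h x, t)) '' Icc 0 (F x) ⊆ K.levelCurve (ext h) (ext h x) := by
      rintro _ ⟨t, ht, rfl⟩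
      obtain ⟨h1, h2, -⟩ := hΦ' _ hm.1 t (h0 ht)
      exact ⟨h1, h2⟩
    have hconn : IsConnected ((fun t => Φ (ext h x, t)) '' Icc 0 (F x)) := by
      refine (isConnected_Icc hm.2.1).image _ (hΦ.comp (by fun_prop) fun t ht => ?_)
      exact ⟨hm.1, h0 ht⟩
    have hxC : x ∈ (fun t => Φ (ext h x, t)) '' Icc 0 (F x) := by
      obtain ⟨h1, h2, h3⟩ := hΦ' _ hm.1 _ hm.2
      exact ⟨F x, ⟨hm.2.1, le_rfl⟩, hC.inj _ h1 x hx h2 h3⟩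
    have hst : ((fun t => Φ (ext h x, t)) '' Icc 0 (F x) ∩ start).Nonempty := by
      obtain ⟨h1, -, h3⟩ := hΦ' _ hm.1 0 ⟨le_rfl, hm.2.1.trans hm.2.2⟩
      exact ⟨_, ⟨0, ⟨le_rfl, hm.2.1⟩, rfl⟩, (hC.start_iff _ h1).2 h3⟩
    obtain ⟨t, ht, rfl⟩ := harc _ hsub hconn hxC hst
    rw [(hΦ' _ hm.1 t (h0 ht)).2.2]
    exact ht.2
  · rintro ⟨hu, hle⟩
    refine ⟨hu, fun C hCsub hconn hxC ⟨y, hyC, hy⟩ => ?_⟩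
    have hsub : C ⊆ K.body := fun z hz => (hCsub hz).1
    have h1 : OrdConnected (F '' C) :=
      (hconn.isPreconnected.image F (hC.cont.mono hsub)).ordConnected
    have hFy := (hC.start_iff y (hsub hyC)).1 hy
    obtain ⟨z, hz, hzu⟩ := h1.out ⟨y, hyC, rfl⟩ ⟨x, hxC, rfl⟩
      (show F u ∈ Icc (F y) (F x) from ⟨by rw [hFy]; exact (hC.mem u hu.1).2.1, hle⟩)
    rwa [← hC.inj z (hsub hz) u hu.1 ((hCsub hz).2.trans hu.2.symm) hzu]

end IsCoordinate

end TriComplex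

/-! ### Existence of the extension -/

namespace TriComplex

open AffineMap Set Relation

variable {V : Type*} [Fintype V]

set_option linter.unusedSectionVars false

variable {K : TriComplex V} {h : V → ℝ} {S : Finset ℝ}

/-- The values at the nodes extend affinely to the edges on which `h` is not constant. -/
theorem exists_edge_extension (hS : ∀ v, h v ∈ S) (nv : (V → ℝ) → ℝ) :
    ∃ f : (V → ℝ) → ℝ, (∀ x, ext h x ∈ S → f x = nv x) ∧
      ∀ a b, h a < h b → ∀ s₁ ∈ S, ∀ s₂ ∈ S, h a ≤ s₁ → s₂ ≤ h b →
        (∀ r ∈ S, ¬ (s₁ < r ∧ r < s₂)) → ∀ s, s₁ < s → s < s₂ →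
        f (cross h a b s) =
          lineMap (nv (cross h a b s₁)) (nv (cross h a b s₂)) ((s - s₁) / (s₂ - s₁)) := by
  have key : ∀ x, ∃ v : ℝ, (ext h x ∈ S → v = nv x) ∧
      ∀ a b, h a < h b → x ∈ edgeBody a b → ∀ s₁ ∈ S, ∀ s₂ ∈ S,
        (∀ r ∈ S, ¬ (s₁ < r ∧ r < s₂)) → s₁ < ext h x → ext h x < s₂ →
        v = lineMap (nv (cross h a b s₁)) (nv (cross h a b s₂)) ((ext h x - s₁) / (s₂ - s₁)) := by
    intro x
    by_cases hx : ext h x ∈ S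
    · exact ⟨nv x, fun _ => rfl, fun a b _ _ s₁ _ s₂ _ hgap h1 h2 => absurd ⟨h1, h2⟩ (hgap _ hx)⟩
    by_cases hex : ∃ a b, h a < h b ∧ x ∈ edgeBody a b ∧ ∃ s₁ ∈ S, ∃ s₂ ∈ S,
        (∀ r ∈ S, ¬ (s₁ < r ∧ r < s₂)) ∧ s₁ < ext h x ∧ ext h x < s₂
    · obtain ⟨a, b, hab, hxe, s₁, hs₁, s₂, hs₂, hgap, h1, h2⟩ := hex
      refine ⟨lineMap (nv (cross h a b s₁)) (nv (cross h a b s₂)) ((ext h x - s₁) / (s₂ - s₁)),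
        fun h => absurd h hx, fun a' b' hab' hxe' s₁' hs₁' s₂' hs₂' hgap' h1' h2' => ?_⟩
      -- The level of `x` is not in `S`, so `x` is not a vertex and determines its edge; the two
      -- consecutive elements of `S` around its level are determined as well.
      · obtain ⟨rfl, rfl⟩ := mem_edgeBody_inter hab hab' hxe hxe' (by
          rintro v rfl
          exact hx (by rw [ext_pt]; exact hS v))
        have e1 : s₁ = s₁' := by
          rcases lt_trichotomy s₁ s₁' with h | h | h
          · exact absurd ⟨h, h1'.trans h2⟩ (hgap _ hs₁')
          · exact h
          · exact absurd ⟨h, h1.trans h2'⟩ (hgap' _ hs₁)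
        have e2 : s₂ = s₂' := by
          rcases lt_trichotomy s₂ s₂' with h | h | h
          · exact absurd ⟨h1'.trans h2, h⟩ (hgap' _ hs₂)
          · exact h
          · exact absurd ⟨h1.trans h2', h⟩ (hgap _ hs₂')
        rw [e1, e2]
    · exact ⟨0, fun h => absurd h hx, fun a b hab hxe s₁ hs₁ s₂ hs₂ hgap h1 h2 =>
        absurd ⟨a, b, hab, hxe, s₁, hs₁, s₂, hs₂, hgap, h1, h2⟩ hex⟩
  choose f hf using key
  refine ⟨f, fun x => (hf x).1, fun a b hab s₁ hs₁ s₂ hs₂ ha hb hgap s h1 h2 => ?_⟩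
  have := (hf (cross h a b s)).2 a b hab (cross_mem hab (ha.trans h1.le) (h2.le.trans hb)) s₁ hs₁
    s₂ hs₂ hgap
  rw [ext_cross hab.ne] at this
  exact this h1 h2

/-- A function on the edges on which `h` is not constant extends affinely to the horizontal
chords. -/
theorem LevelRegular.exists_chord_extension (hL : K.LevelRegular h) (f : (V → ℝ) → ℝ) :
    ∃ F : (V → ℝ) → ℝ, (∀ x, K.IsCross h x → F x = f x) ∧
      ∀ T ∈ K.tri, ∀ x ∈ faceBody T, ∀ y ∈ faceBody T, ext h x = ext h y →
        ∀ t ∈ Icc (0 : ℝ) 1, F (lineMap x y t) = lineMap (F x) (F y) t := by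
  classical
  let R : (V → ℝ) → ℝ → Prop := fun u v => ∃ T ∈ K.tri, ∃ x y, K.IsCross h x ∧ K.IsCross h y ∧
    x ∈ faceBody T ∧ y ∈ faceBody T ∧ ext h x = ext h y ∧ ∃ t ∈ Icc (0 : ℝ) 1,
      u = lineMap x y t ∧ v = lineMap (f x) (f y) t
  have hcross : ∀ u v, K.IsCross h u → R u v → v = f u := by
    rintro u v hu ⟨T, hT, x, y, hx, hy, hxT, hyT, hxy, t, ht, rfl, rfl⟩
    by_cases hne : x = y
    · subst hne
      rw [lineMap_same_apply, lineMap_same_apply]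
    rcases hu.eq_or_eq hxT hyT hxy ht rfl with h1 | h1
    · have : t = 0 := lineMap_injective ℝ hne (by rw [h1, lineMap_apply_zero])
      simp [this]
    · have : t = 1 := lineMap_injective ℝ hne (by rw [h1, lineMap_apply_one])
      simp [this]
  -- If a triangle contains an inner point of a chord, it contains both ends. It has at most two
  -- crossing points at that level, so two chords through the point have the same ends, possibly in
  -- reverse order.
  have huniq : ∀ u v v', R u v → R u v' → v = v' := by
    intro u v v' huv huv'
    by_cases hu : K.IsCross h u
    · rw [hcross u v hu huv, hcross u v' hu huv']
    obtain ⟨T, hT, x, y, hx, hy, hxT, hyT, hxy, t, ht, hut, rfl⟩ := huv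
    obtain ⟨T', hT', x', y', hx', hy', hxT', hyT', hxy', t', ht', hut', rfl⟩ := huv'
    have key : ∀ (x y : V → ℝ) (t : ℝ), K.IsCross h x → K.IsCross h y → t ∈ Icc (0 : ℝ) 1 →
        u = lineMap x y t → 0 < t ∧ t < 1 ∧ x ≠ y := by
      rintro x y t hx hy ht hut
      refine ⟨ht.1.lt_of_ne ?_, ht.2.lt_of_ne ?_, ?_⟩
      · rintro rfl; exact hu (by rw [hut, lineMap_apply_zero]; exact hx)
      · rintro rfl; exact hu (by rw [hut, lineMap_apply_one]; exact hy)
      · rintro rfl; exact hu (by rw [hut, lineMap_same_apply]; exact hx)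
    obtain ⟨h0, h1, hne⟩ := key x y t hx hy ht hut
    obtain ⟨h0', h1', hne'⟩ := key x' y' t' hx' hy' ht' hut'
    have huT' : u ∈ faceBody T' := hut' ▸ lineMap_mem_faceBody hxT' hyT' ht'
    obtain ⟨k1, k2⟩ := mem_faceBody_of_lineMap_mem hxT hyT h0 h1 (hut ▸ huT')
    have e1 : ext h u = ext h x := by rw [hut, ext_lineMap, ← hxy, lineMap_same_apply]
    have e2 : ext h u = ext h x' := by rw [hut', ext_lineMap, ← hxy', lineMap_same_apply]
    have c1 : x ∈ K.crossSet h (ext h u) := ⟨hx, e1.symm⟩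
    have c2 : y ∈ K.crossSet h (ext h u) := ⟨hy, by rw [e1, hxy]⟩
    have c3 : x' ∈ K.crossSet h (ext h u) := ⟨hx', e2.symm⟩
    have c4 : y' ∈ K.crossSet h (ext h u) := ⟨hy', by rw [e2, hxy']⟩
    have d1 := (hL.eq_of_mem_face hT' c1 c2 c3 k1 k2 hxT').resolve_left hne
    have d2 := (hL.eq_of_mem_face hT' c1 c2 c4 k1 k2 hyT').resolve_left hne
    rcases d1 with rfl | rfl <;> rcases d2 with rfl | rfl
    · exact absurd rfl hne'
    · rw [lineMap_injective ℝ hne (hut.symm.trans hut')]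
    · rw [← lineMap_apply_one_sub] at hut'
      rw [lineMap_injective ℝ hne (hut.symm.trans hut'), lineMap_apply_one_sub]
    · exact absurd rfl hne'
  let F : (V → ℝ) → ℝ := fun u => if hu : ∃ v, R u v then hu.choose else 0
  have hF : ∀ u v, R u v → F u = v := by
    intro u v huv
    have hu : ∃ v, R u v := ⟨v, huv⟩
    simp only [F, dif_pos hu]
    exact huniq _ _ _ hu.choose_spec huv
  refine ⟨F, fun x hx => ?_, fun T hT x hx y hy hxy t ht => ?_⟩
  · obtain ⟨T, hT, hxT⟩ := hx.mem_body
    exact hF _ _ ⟨T, hT, x, x, hx, hx, hxT, hxT, rfl, 0, ⟨le_rfl, zero_le_one⟩, by simp, by simp⟩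
  -- Affinity on the full chord of this level in the triangle implies affinity on every part of it.
  · obtain ⟨p, hp, q, hq, hpT, hqT, hpq⟩ := hL.exists_chord hT ⟨x, hx, rfl⟩
    have key : ∀ t ∈ Icc (0 : ℝ) 1, F (lineMap p q t) = lineMap (f p) (f q) t := fun t ht =>
      hF _ _ ⟨T, hT, p, q, hp.1, hq.1, hpT, hqT, hp.2.trans hq.2.symm, t, ht, rfl, rfl⟩
    obtain ⟨t₁, ht₁, e₁⟩ := hpq x hx rfl
    obtain ⟨t₂, ht₂, e₂⟩ := hpq y hy hxy.symm
    rw [e₁, e₂, ← apply_lineMap, key _ ht₁, key _ ht₂, ← apply_lineMap]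
    exact key _ ((convex_Icc 0 1).lineMap_mem ht₁ ht₂ ht)

/-- Interpolation along the non-horizontal edges is followed by interpolation along the chords. The
two are compatible because points of such edges are never inner points of chords. -/
theorem LevelRegular.exists_isExtension (hL : K.LevelRegular h) (hS : ∀ v, h v ∈ S)
    (nv : (V → ℝ) → ℝ) : ∃ F, K.IsExtension h S nv F := by
  obtain ⟨f, hf, hf'⟩ := exists_edge_extension hS nv
  obtain ⟨F, hF, hF'⟩ := hL.exists_chord_extension f
  have hnode : ∀ x, K.IsNode h S x → F x = nv x := by
    intro x hx
    obtain ⟨h1, h2⟩ := hx.mem_crossSet hL hS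
    rw [hF x h2.1, hf x h1]
  refine ⟨F, hnode, ?_, fun T hT a ha a' ha' b hb b' hb' x hx y hy hxy t ht => hF' T hT x
    (edgeBody_subset_faceBody ha ha' hx) y (edgeBody_subset_faceBody hb hb' hy) hxy t ht⟩
  have key : ∀ a b, K.graph.Adj a b → h a < h b → ∀ x ∈ edgeBody a b, ∀ y ∈ edgeBody a b,
      K.IsNode h S x → K.IsNode h S y → ext h x ≤ ext h y →
      (∀ s ∈ S, ¬ (ext h x < s ∧ s < ext h y)) →
      ∀ t ∈ Set.Icc (0 : ℝ) 1, F (lineMap x y t) = lineMap (F x) (F y) t := by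
    intro a b hadj hab x hx y hy hxn hyn hxy hgap t ht
    rcases hxy.lt_or_eq with hlt | heq
    · obtain ⟨hxS, hxc⟩ := hxn.mem_crossSet hL hS
      obtain ⟨hyS, hyc⟩ := hyn.mem_crossSet hL hS
      rcases ht.1.eq_or_lt with rfl | h0
      · simp
      rcases ht.2.eq_or_lt with rfl | h1
      · simp
      obtain ⟨ex, hax, hxb⟩ := cross_of_mem_crossSet hxc hab hx
      obtain ⟨ey, hay, hyb⟩ := cross_of_mem_crossSet hyc hab hy
      have ez : lineMap x y t = cross h a b (lineMap (ext h x) (ext h y) t) := by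
        rw [cross_lineMap, ← ex, ← ey]
      have hs1 : ext h x < lineMap (ext h x) (ext h y) t := by
        rw [lineMap_apply_ring']; nlinarith
      have hs2 : lineMap (ext h x) (ext h y) t < ext h y := by
        rw [lineMap_apply_ring']; nlinarith
      rw [hnode x hxn, hnode y hyn, ez, hF _ (cross_mem_crossSet hadj hab (hax.trans hs1.le)
        (hs2.le.trans hyb)).1, hf' a b hab _ hxS _ hyS hax hyb hgap _ hs1 hs2, ← ex, ← ey]
      congr 1
      rw [lineMap_apply_ring']
      have : ext h y - ext h x ≠ 0 := by linarith
      field_simp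
      ring
    · rw [eq_of_mem_edgeBody hab.ne hx hy heq, lineMap_same_apply, lineMap_same_apply]
  intro a b hadj x hx y hy hxn hyn hxy hgap t ht
  rcases lt_trichotomy (h a) (h b) with hab | hab | hab
  · exact key a b hadj hab x hx y hy hxn hyn hxy hgap t ht
  -- A horizontal edge is itself a chord.
  · obtain ⟨-, T, hT, ha, hb⟩ := hadj
    have hconst : ∀ z ∈ edgeBody a b, ext h z = h a := by
      intro z hz
      obtain ⟨r, -, rfl⟩ := mem_edgeBody_iff.1 hz
      rw [ext_lineMap, ext_pt, ext_pt, ← hab, lineMap_same_apply]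
    exact hF' T hT x (edgeBody_subset_faceBody ha hb hx) y (edgeBody_subset_faceBody ha hb hy)
      ((hconst x hx).trans (hconst y hy).symm) t ht
  · exact key b a hadj.symm hab x (edgeBody_symm a b ▸ hx) y (edgeBody_symm a b ▸ hy) hxn hyn hxy
      hgap t ht

end TriComplex

/-! ### Fluxes through level curves and the node values -/

namespace TriComplex

open AffineMap Set Relation

variable {V : Type*} [Fintype V]

set_option linter.unusedSectionVars false

variable {K : TriComplex V} {h : V → ℝ} {p : ℝ} {start fin base : Set (V → ℝ)}
  {x₀ : ℝ → V → ℝ} {pos : ℝ → (V → ℝ) → ℕ} {S : Finset ℝ} {c : V → V → ℝ}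

theorem finite_crossSet (K : TriComplex V) (h : V → ℝ) (s : ℝ) : (K.crossSet h s).Finite := by
  refine (finite_range fun e : V × V => cross h e.1 e.2 s).subset ?_
  rintro x ⟨⟨a, b, -, hab, hx⟩, rfl⟩
  exact ⟨(a, b), (eq_cross hab hx).symm⟩

theorem lt_right_of_mem {a b : V} {x : V → ℝ} (hx : x ∈ edgeBody a b) (ha : h a < ext h x) :
    h a < h b ∧ ext h x ≤ h b := by
  have hab : h a < h b := by
    by_contra hcon
    rw [edgeBody_symm] at hx
    have := ext_mem_of_mem_edgeBody (not_lt.1 hcon) hx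
    linarith
  exact ⟨hab, (ext_mem_of_mem_edgeBody hab.le hx).2⟩

open Classical in
-- The conductance of a part of an edge is inversely proportional to the change of `h` along it. So
-- the flux through the part is that through the whole edge, and it does not depend on where the
-- edge is cut.
theorem normalBelow_eq (K : TriComplex V) (c : V → V → ℝ) (h : V → ℝ) (x : V → ℝ) :
    K.normalBelow c h x = ∑ a, ∑ b, if K.graph.Adj a b ∧ x ∈ edgeBody a b ∧ h a < ext h x
      then c a b * (h b - h a) else 0 := by
  unfold normalBelow
  refine Finset.sum_congr rfl fun a _ => Finset.sum_congr rfl fun b _ => ?_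
  split_ifs with h1
  · have h2 : h a - ext h x ≠ 0 := by linarith [h1.2.2]
    unfold insertedCond
    field_simp
    ring
  · rfl

/-- No term is negative. A positive one comes from the edge through `x` or, if `x` is the lower end
of that edge, from a descending edge supplied by `down_ne`. -/
theorem normalBelow_pos (hL : K.LevelRegular h) (hc : K.IsConductance c) {x : V → ℝ}
    (hx : K.IsCross h x) (hbot : ∃ v, h v < ext h x) : 0 < K.normalBelow c h x := by
  classical
  rw [normalBelow_eq]
  have hnn : ∀ a b, 0 ≤ (if K.graph.Adj a b ∧ x ∈ edgeBody a b ∧ h a < ext h x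
      then c a b * (h b - h a) else 0) := by
    intro a b
    split_ifs with h1
    · have := (lt_right_of_mem h1.2.1 h1.2.2).1
      exact mul_nonneg (hc.2 a b h1.1).le (by linarith)
    · exact le_rfl
  have key : ∃ a b, K.graph.Adj a b ∧ x ∈ edgeBody a b ∧ h a < ext h x := by
    obtain ⟨a, b, hadj, hab, hxe⟩ := hx
    rcases (ext_mem_of_mem_edgeBody hab.le hxe).1.lt_or_eq with h1 | h1
    · exact ⟨a, b, hadj, hxe, h1⟩
    · obtain rfl := eq_left_of_ext_eq hab.ne hxe h1.symm
      rw [← h1] at hbot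
      obtain ⟨u, hu, hlt⟩ := hL.down_ne a hbot
      exact ⟨u, a, hu.symm, right_mem_edgeBody _ _, by rw [ext_pt]; exact hlt⟩
  obtain ⟨a, b, hab⟩ := key
  refine Finset.sum_pos' (fun a _ => Finset.sum_nonneg fun b _ => hnn a b)
    ⟨a, Finset.mem_univ _, Finset.sum_pos' (fun b _ => hnn a b) ⟨b, Finset.mem_univ _, ?_⟩⟩
  rw [if_pos hab]
  have := (lt_right_of_mem hab.2.1 hab.2.2).1
  exact mul_pos (hc.2 a b hab.1) (by linarith)

theorem absNormal_pt (K : TriComplex V) (c : V → V → ℝ) (h : V → ℝ) (v : V) :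
    K.absNormal c h (pt v) = |K.lap c h v| := by
  classical
  unfold absNormal
  rw [Finset.sum_eq_single v (fun w _ hw => if_neg fun h1 => hw (pt_injective h1).symm)
    (fun h1 => absurd (Finset.mem_univ v) h1), if_pos rfl]

theorem lap_neg_of_min (hL : K.LevelRegular h) (hc : K.IsConductance c) {v : V}
    (hmin : ∀ u, h v ≤ h u) (hup : ∃ u, h v < h u) : K.lap c h v < 0 := by
  classical
  have : 0 < ∑ y, if K.graph.Adj v y then c v y * (h y - h v) else 0 := by
    obtain ⟨u, hu, hlt⟩ := hL.up_ne v hup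
    refine Finset.sum_pos' (fun y _ => ?_) ⟨u, Finset.mem_univ _, ?_⟩
    · split_ifs with h1
      · exact mul_nonneg (hc.2 v y h1).le (by linarith [hmin y])
      · exact le_rfl
    · rw [if_pos hu]
      exact mul_pos (hc.2 v u hu) (by linarith)
  have h2 : K.lap c h v = -∑ y, if K.graph.Adj v y then c v y * (h y - h v) else 0 := by
    unfold lap
    rw [← Finset.sum_neg_distrib]
    refine Finset.sum_congr rfl fun y _ => ?_
    split_ifs <;> ring
  linarith

/-- The contribution of a node to the conjugate function. -/
noncomputable def nodeFlux (K : TriComplex V) (c : V → V → ℝ) (h : V → ℝ) (s : ℝ) (u : V → ℝ) :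
    ℝ :=
  if s = 0 then K.absNormal c h u else K.normalBelow c h u

theorem IsQuad.eq_pt (hQ : K.IsQuad h p start fin) {u : V → ℝ} (hu : u ∈ K.crossSet h 0) :
    ∃ v, u = pt v ∧ h v = 0 := by
  obtain ⟨⟨a, b, -, hab, hue⟩, hu0⟩ := hu
  have h1 := (ext_mem_of_mem_edgeBody hab.le hue).1
  have h2 : h a = 0 := le_antisymm (by linarith) (hQ.nonneg a)
  exact ⟨a, eq_left_of_ext_eq hab.ne hue (hu0.trans h2.symm), h2⟩

theorem IsQuad.lap_neg (hQ : K.IsQuad h p start fin) (hc : K.IsConductance c) {v : V}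
    (hv : h v = 0) : K.lap c h v < 0 := by
  obtain ⟨t, ht⟩ := hQ.exists_top
  exact lap_neg_of_min hQ.reg hc (fun u => hv ▸ hQ.nonneg u) ⟨t, by rw [hv, ht]; exact hQ.pos⟩

theorem IsQuad.nodeFlux_pos (hQ : K.IsQuad h p start fin) (hc : K.IsConductance c) {s : ℝ}
    {u : V → ℝ} (hu : u ∈ K.crossSet h s) : 0 < K.nodeFlux c h s u := by
  unfold nodeFlux
  split_ifs with hs
  · subst hs
    obtain ⟨v, rfl, hv⟩ := hQ.eq_pt hu
    rw [absNormal_pt]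
    exact abs_pos.2 (hQ.lap_neg hc hv).ne
  · obtain ⟨v, hv⟩ := hQ.exists_zero
    refine normalBelow_pos hQ.reg hc hu.1 ⟨v, ?_⟩
    have := (hQ.ext_mem hu.1.mem_body).1
    rw [hv]
    rw [hu.2] at this ⊢
    exact lt_of_le_of_ne this (Ne.symm hs)

open Classical in
/-- The flux through the level curve `h = s`, as a sum over the edges that cross it. -/
theorem sum_normalBelow (K : TriComplex V) (c : V → V → ℝ) (h : V → ℝ) (s : ℝ) :
    ∑ u ∈ (finite_crossSet K h s).toFinset, K.normalBelow c h u =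
      ∑ a, ∑ b, if h a < s ∧ s ≤ h b then
        (if K.graph.Adj a b then c a b * (h b - h a) else 0) else 0 := by
  simp only [normalBelow_eq]
  rw [Finset.sum_comm]
  refine Finset.sum_congr rfl fun a _ => ?_
  rw [Finset.sum_comm]
  refine Finset.sum_congr rfl fun b _ => ?_
  by_cases hab : K.graph.Adj a b ∧ h a < s ∧ s ≤ h b
  · obtain ⟨hadj, ha, hb⟩ := hab
    have hlt : h a < h b := ha.trans_le hb
    have hmem := cross_mem_crossSet hadj hlt ha.le hb
    rw [if_pos ⟨ha, hb⟩, if_pos hadj, Finset.sum_eq_single (cross h a b s)]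
    · rw [if_pos ⟨hadj, cross_mem hlt ha.le hb, by rw [hmem.2]; exact ha⟩]
    · intro u hu hne
      rw [Set.Finite.mem_toFinset] at hu
      refine if_neg fun h1 => hne ?_
      rw [← hu.2]
      exact eq_cross hlt h1.2.1
    · intro h1
      exact absurd ((Set.Finite.mem_toFinset _).2 hmem) h1
  · rw [Finset.sum_eq_zero]
    · by_cases h1 : h a < s ∧ s ≤ h b
      · rw [if_pos h1, if_neg fun h2 => hab ⟨h2, h1⟩]
      · rw [if_neg h1]
    · intro u hu
      rw [Set.Finite.mem_toFinset] at hu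
      refine if_neg fun h1 => hab ⟨h1.1, ?_, ?_⟩
      · rw [← hu.2]; exact h1.2.2
      · rw [← hu.2]; exact (lt_right_of_mem h1.2.1 h1.2.2).2

/-- The flux through all level curves is the same. -/
theorem IsQuad.sum_nodeFlux (hQ : K.IsQuad h p start fin) (hc : K.IsConductance c)
    (hlap : ∀ v, 0 < h v → h v < p → K.lap c h v = 0) {s : ℝ} (hs : 0 ≤ s) (hsp : s ≤ p) :
    ∑ u ∈ (finite_crossSet K h s).toFinset, K.nodeFlux c h s u =
      ∑ v with h v = 0, |K.lap c h v| := by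
  classical
  unfold nodeFlux
  rcases hs.eq_or_lt with rfl | hs
  · simp only [if_pos]
    symm
    refine Finset.sum_bij (fun v _ => pt v) ?_ (fun v _ w _ hvw => pt_injective hvw) ?_
      fun v _ => (absNormal_pt K c h v).symm
    · intro v hv
      rw [Set.Finite.mem_toFinset]
      exact ⟨hQ.reg.pt_cross v, by rw [ext_pt]; simpa using hv⟩
    · intro u hu
      rw [Set.Finite.mem_toFinset] at hu
      obtain ⟨v, rfl, hv⟩ := hQ.eq_pt hu
      exact ⟨v, by simpa using hv, rfl⟩
  · simp only [if_neg hs.ne']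
    rw [sum_normalBelow]
    set t : V → V → ℝ := fun a b => if K.graph.Adj a b then c a b * (h b - h a) else 0 with ht
    have hanti : ∀ a b, t a b = -t b a := by
      intro a b
      simp only [ht, K.graph.adj_comm b a, hc.1 b a]
      split_ifs <;> ring
    have hlapt : ∀ a, ∑ b, t a b = -K.lap c h a := by
      intro a
      unfold lap
      rw [← Finset.sum_neg_distrib]
      refine Finset.sum_congr rfl fun b _ => ?_
      simp only [ht]
      split_ifs <;> ring
    -- Edges with both ends below the level cancel by antisymmetry.
    have h1 : ∑ a, ∑ b, (if h a < s ∧ h b < s then t a b else 0) = 0 := by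
      have h2 : ∑ a, ∑ b, (if h a < s ∧ h b < s then t a b else 0) =
          -∑ a, ∑ b, (if h a < s ∧ h b < s then t a b else 0) := by
        conv_lhs => rw [Finset.sum_comm]
        rw [← Finset.sum_neg_distrib]
        refine Finset.sum_congr rfl fun a _ => ?_
        rw [← Finset.sum_neg_distrib]
        refine Finset.sum_congr rfl fun b _ => ?_
        rw [hanti b a]
        by_cases ha : h a < s <;> by_cases hb : h b < s <;> simp [ha, hb]
      linarith
    -- The flux through the level is therefore the sum of `-K.lap c h a` over all vertices below it,
    -- and only those with `h a = 0` contribute.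
    have h2 : ∑ a, ∑ b, (if h a < s ∧ s ≤ h b then t a b else 0) =
        ∑ a, if h a < s then -K.lap c h a else 0 := by
      have h3 : ∑ a, ∑ b, (if h a < s ∧ s ≤ h b then t a b else 0) =
          ∑ a, ∑ b, (if h a < s ∧ s ≤ h b then t a b else 0) +
            ∑ a, ∑ b, (if h a < s ∧ h b < s then t a b else 0) := by rw [h1, add_zero]
      rw [h3, ← Finset.sum_add_distrib]
      refine Finset.sum_congr rfl fun a _ => ?_
      rw [← Finset.sum_add_distrib, ← hlapt]
      by_cases ha : h a < s
      · rw [if_pos ha]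
        refine Finset.sum_congr rfl fun b _ => ?_
        rcases lt_or_ge (h b) s with hb | hb
        · simp [ha, hb, not_le.2 hb]
        · simp [ha, hb, not_lt.2 hb]
      · simp [ha]
    rw [h2, Finset.sum_filter]
    refine Finset.sum_congr rfl fun a _ => ?_
    rcases (hQ.nonneg a).eq_or_lt with ha | ha
    · rw [if_pos (by linarith), if_pos ha.symm, abs_of_neg (hQ.lap_neg hc ha.symm)]
    · rw [if_neg ha.ne']
      split_ifs with h3
      · rw [hlap a ha (by linarith), neg_zero]
      · rfl

open Classical in
/-- The node values of the conjugate function, in terms of the order along the level curves. -/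
noncomputable def orderValue (K : TriComplex V) (c : V → V → ℝ) (h : V → ℝ)
    (start : Set (V → ℝ)) (pos : ℝ → (V → ℝ) → ℕ) (x : V → ℝ) : ℝ :=
  if x ∈ start then 0 else
    ∑ u ∈ (finite_crossSet K h (ext h x)).toFinset with pos (ext h x) u ≤ pos (ext h x) x,
      K.nodeFlux c h (ext h x) u

open Classical in
theorem orderValue_of_mem {s : ℝ} {x : V → ℝ} (hx : x ∈ K.crossSet h s) :
    K.orderValue c h start pos x = if x ∈ start then 0 else
      ∑ u ∈ (finite_crossSet K h s).toFinset with pos s u ≤ pos s x, K.nodeFlux c h s u := by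
  obtain ⟨-, rfl⟩ := hx
  rfl

/-- Partial sums of positive terms increase strictly. The sum is complete at the last point, which
lies on `fin`, and its value does not depend on the level. -/
theorem IsQuad.isMonotoneValue (hQ : K.IsQuad h p start fin)
    (ho : K.IsLevelOrder h p start x₀ pos) (hc : K.IsConductance c)
    (hlap : ∀ v, 0 < h v → h v < p → K.lap c h v = 0) (hS' : ∀ s ∈ S, 0 ≤ s ∧ s ≤ p) :
    K.IsMonotoneValue h S start fin pos (∑ v with h v = 0, |K.lap c h v|)
      (K.orderValue c h start pos) where
  lt := by
    classical
    rintro s hs x hx y hy hlt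
    have hs' := hS' s hs
    -- The exceptional value `0` on `start` concerns only position `0`, and `y` has a larger
    -- position.
    have hy' : y ∉ start := by
      intro hy'
      have := hQ.eq_start ho hy'
      rw [hy.2] at this
      rw [this, (ho s hs'.1 hs'.2).2.zero] at hlt
      omega
    rw [orderValue_of_mem hx, orderValue_of_mem hy, if_neg hy']
    have hpos : ∀ u ∈ (finite_crossSet K h s).toFinset, 0 < K.nodeFlux c h s u :=
      fun u hu => hQ.nodeFlux_pos hc ((Set.Finite.mem_toFinset _).1 hu)
    have hymem : y ∈ (finite_crossSet K h s).toFinset.filter fun u => pos s u ≤ pos s y :=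
      Finset.mem_filter.2 ⟨(Set.Finite.mem_toFinset _).2 hy, le_rfl⟩
    split_ifs with hx'
    · exact Finset.sum_pos (fun u hu => hpos u (Finset.mem_filter.1 hu).1) ⟨y, hymem⟩
    · refine Finset.sum_lt_sum_of_subset (i := y) (fun u hu => ?_) hymem (fun hcon => ?_)
        (hpos y (Finset.mem_filter.1 hymem).1) fun u hu _ => (hpos u (Finset.mem_filter.1 hu).1).le
      · rw [Finset.mem_filter] at hu ⊢
        exact ⟨hu.1, hu.2.trans hlt.le⟩
      · exact absurd (Finset.mem_filter.1 hcon).2 (not_le.2 hlt)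
  start x hx _ := by
    unfold orderValue
    rw [if_pos hx]
  fin x hx hxS := by
    classical
    unfold orderValue
    rw [if_neg fun hx' => hQ.disjoint.le_bot ⟨hx', hx⟩]
    have hs := hS' _ hxS
    rw [← hQ.sum_nodeFlux hc hlap hs.1 hs.2, Finset.filter_true_of_mem]
    intro u hu
    exact hQ.pos_le_fin ho hx ((Set.Finite.mem_toFinset _).1 hu)

/-- The node values of the conjugate function do not depend on a choice of the order. -/
theorem IsQuad.nodeValue_eq (hQ : K.IsQuad h p start fin) (ho : K.IsLevelOrder h p start x₀ pos)
    (hS : ∀ v, h v ∈ S) (hbase : ∀ u ∈ K.body, u ∈ base ↔ ext h u = 0) {W : ℝ} {F : (V → ℝ) → ℝ}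
    (hF : K.IsCoordinate h p start fin W F)
    (hlt : ∀ s ∈ S, ∀ x ∈ K.crossSet h s, ∀ y ∈ K.crossSet h s, pos s x < pos s y → F x < F y)
    {x : V → ℝ} (hx : K.IsNode h S x) :
    K.nodeValue c h S start base x = K.orderValue c h start pos x := by
  classical
  obtain ⟨hxS, hxc⟩ := hx.mem_crossSet hQ.reg hS
  -- In the coordinates `(h, F)` the arc consists of the points of the level with smaller or equal
  -- `F`. At the crossing points this order is that of `pos`.
  have hset : {u | K.IsNode h S u ∧ u ∈ K.arcTo h start x} =
      ((finite_crossSet K h (ext h x)).toFinset.filter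
        fun u => pos (ext h x) u ≤ pos (ext h x) x : Finset (V → ℝ)) := by
    ext u
    rw [hF.arcTo_eq hxc.1.mem_body, Finset.coe_filter]
    simp only [mem_ofPred_eq, Set.Finite.mem_toFinset]
    have key : ∀ u ∈ K.crossSet h (ext h x), F u ≤ F x ↔ pos (ext h x) u ≤ pos (ext h x) x := by
      intro u hu
      constructor
      · intro h1
        by_contra h2
        exact absurd h1 (not_le.2 (hlt _ hxS x hxc u hu (not_le.1 h2)))
      · intro h1
        rcases h1.lt_or_eq with h2 | h2
        · exact (hlt _ hxS u hu x hxc h2).le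
        · have hs := hQ.ext_mem hxc.1.mem_body
          rw [(ho _ hs.1 hs.2).2.inj hu hxc h2]
    constructor
    · rintro ⟨h1, h2, h3⟩
      obtain ⟨-, h4⟩ := h1.mem_crossSet hQ.reg hS
      rw [h2.2] at h4
      exact ⟨h4, (key u h4).1 h3⟩
    · rintro ⟨h1, h2⟩
      exact ⟨isNode_of_mem_crossSet hxS h1, ⟨h1.1.mem_body, h1.2⟩, (key u h1).2 h2⟩
  unfold nodeValue orderValue
  split_ifs with h1 h2
  · rfl
  · rw [hset, finsum_mem_coe_finset]
    refine Finset.sum_congr rfl fun u _ => ?_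
    rw [nodeFlux, if_pos ((hbase x hxc.1.mem_body).1 h2)]
  · rw [hset, finsum_mem_coe_finset]
    refine Finset.sum_congr rfl fun u _ => ?_
    rw [nodeFlux, if_neg fun h0 => h2 ((hbase x hxc.1.mem_body).2 h0)]

/-- Existence of the conjugate function of a quadrilateral; together with `h`, every such function
gives coordinates. -/
theorem IsQuad.conjugate (hQ : K.IsQuad h p start fin) (hc : K.IsConductance c)
    (hlap : ∀ v, 0 < h v → h v < p → K.lap c h v = 0) (hS : ∀ v, h v ∈ S)
    (hS' : ∀ s ∈ S, 0 ≤ s ∧ s ≤ p) (hbase : ∀ u ∈ K.body, u ∈ base ↔ ext h u = 0) :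
    (∃ F, K.IsConjugate c h S start base F) ∧
      ∃ W, ∀ F, K.IsConjugate c h S start base F → K.IsCoordinate h p start fin W F := by
  obtain ⟨x₀, pos, ho⟩ := hQ.exists_levelOrder
  have hnv := hQ.isMonotoneValue (S := S) ho hc hlap hS'
  -- This auxiliary function does not involve arcs. Its coordinates identify the arcs in
  -- `nodeValue`, after which it is itself a conjugate function.
  obtain ⟨F, hF⟩ := hQ.reg.exists_isExtension hS (K.orderValue c h start pos)
  have hcoord := hQ.isCoordinate ho hS hS' hnv hF
  have hval : ∀ x, K.IsNode h S x →
      K.nodeValue c h S start base x = K.orderValue c h start pos x := fun x hx =>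
    hQ.nodeValue_eq ho hS hbase hcoord (fun s hs x hx y hy hlt =>
      hQ.lt_of_pos_lt ho hS hS' hnv hF (hS' s hs).1 (hS' s hs).2 hx hy hlt) hx
  refine ⟨⟨F, fun x hx => by rw [hF.node x hx, hval x hx], hF.edge, hF.chord⟩,
    ∑ v with h v = 0, |K.lap c h v|, fun G hG => ?_⟩
  exact hQ.isCoordinate ho hS hS' hnv ⟨fun x hx => by rw [hG.node x hx, hval x hx], hG.edge, hG.chord⟩

end TriComplex

/-! ### Parity in vertex links and the Euler characteristic -/

namespace TriComplex

open Relation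

variable {V : Type*}

set_option linter.unusedSectionVars false

/-- The link of every vertex is connected. -/
def LinkConnected (K : TriComplex V) : Prop :=
  ∀ v T T', T ∈ K.tri → T' ∈ K.tri → v ∈ T → v ∈ T' →
    ReflTransGen (fun R R' => R' ∈ K.tri ∧ v ∈ R' ∧ ∃ y, y ≠ v ∧ y ∈ R ∧ y ∈ R') T T'

/-- A set that contains some but not all vertices of a link separates two vertices of a triangle. -/
theorem LinkConnected.exists_mixed {K : TriComplex V} (hK : K.LinkConnected) {v : V} {X : Set V}
    {y z : V} (hy : K.graph.Adj v y) (hyX : y ∈ X) (hz : K.graph.Adj v z) (hzX : z ∉ X) :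
    ∃ T ∈ K.tri, v ∈ T ∧ ∃ y ∈ T, y ≠ v ∧ y ∈ X ∧ ∃ z ∈ T, z ≠ v ∧ z ∉ X := by
  by_contra hcon
  push Not at hcon
  obtain ⟨hvy, T, hT, hvT, hyT⟩ := hy
  obtain ⟨hvz, T', hT', hvT', hzT'⟩ := hz
  -- Without a mixed triangle, membership in `X` spreads from triangle to triangle around `v`.
  have key : ∀ R, ReflTransGen (fun R R' => R' ∈ K.tri ∧ v ∈ R' ∧ ∃ y, y ≠ v ∧ y ∈ R ∧ y ∈ R') T R →
      ∀ w ∈ R, w ≠ v → w ∈ X := by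
    intro R hR
    induction hR with
    | refl => exact hcon T hT hvT y hyT hvy.symm hyX
    | tail _ h ih =>
      obtain ⟨h1, h2, w, hw, hw1, hw2⟩ := h
      exact hcon _ h1 h2 w hw2 hw (ih w hw1 hw)
  exact hzX (key T' (hK v T T' hT hT' hvT hvT') z hzT' hvz.symm)

variable [Fintype V]

section

open Classical

/-- The triangles at a vertex. -/
noncomputable def star (K : TriComplex V) (v : V) : Finset (Finset V) :=
  Finset.univ.filter fun T => T ∈ K.tri ∧ v ∈ T

/-- The neighbours of a vertex. -/
noncomputable def link (K : TriComplex V) (v : V) : Finset V :=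
  Finset.univ.filter fun u => K.graph.Adj v u

/-- The number of triangles that contain two given vertices. -/
noncomputable def edgeDeg (K : TriComplex V) (a b : V) : ℕ :=
  (Finset.univ.filter fun T => T ∈ K.tri ∧ a ∈ T ∧ b ∈ T).card

/-- The triangles at `v` with exactly one further vertex in `X`. -/
noncomputable def mixed (K : TriComplex V) (v : V) (X : Finset V) : Finset (Finset V) :=
  (K.star v).filter fun T => (T ∩ X).card = 1

/-- The triangles of which `v` is the middle vertex with respect to `h`. -/
noncomputable def mid (K : TriComplex V) (h : V → ℝ) (v : V) : Finset (Finset V) :=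
  (K.star v).filter fun T => (∃ a ∈ T, h a < h v) ∧ ∃ b ∈ T, h v < h b

end

variable {K : TriComplex V}

theorem mem_star {v : V} {T : Finset V} : T ∈ K.star v ↔ T ∈ K.tri ∧ v ∈ T := by
  simp [star]

theorem mem_link {v u : V} : u ∈ K.link v ↔ K.graph.Adj v u := by
  simp [link]

theorem mem_mid {h : V → ℝ} {v : V} {T : Finset V} :
    T ∈ K.mid h v ↔ T ∈ K.tri ∧ v ∈ T ∧ (∃ a ∈ T, h a < h v) ∧ ∃ b ∈ T, h v < h b := by
  simp [mid, mem_star, and_assoc]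

theorem edgeDeg_comm (a b : V) : K.edgeDeg a b = K.edgeDeg b a := by
  unfold edgeDeg
  congr 1
  ext T
  simp [and_comm]

theorem edgeDeg_eq_one_iff {a b : V} (hab : a ≠ b) : K.edgeDeg a b = 1 ↔ K.BdryAdj a b := by
  classical
  unfold edgeDeg BdryAdj
  rw [Finset.card_eq_one]
  constructor
  · rintro ⟨T, hT⟩
    refine ⟨hab, T, ?_, fun T' hT' => ?_⟩
    · have : T ∈ ({T} : Finset (Finset V)) := by simp
      rw [← hT] at this
      simpa using this
    · have : T' ∈ Finset.univ.filter fun T => T ∈ K.tri ∧ a ∈ T ∧ b ∈ T := by simpa using hT'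
      rw [hT] at this
      simpa using this
  · rintro ⟨-, T, hT, hu⟩
    refine ⟨T, ?_⟩
    ext T'
    simp only [Finset.mem_filter, Finset.mem_univ, true_and, Finset.mem_singleton]
    exact ⟨hu T', by rintro rfl; exact hT⟩

theorem edgeDeg_pos {a b : V} (hab : K.graph.Adj a b) : 0 < K.edgeDeg a b := by
  obtain ⟨-, T, hT⟩ := hab
  exact Finset.card_pos.2 ⟨T, by simpa using hT⟩

theorem eq_of_edgeDeg_le_one {a b : V} (h1 : K.edgeDeg a b ≤ 1) {T T' : Finset V} (hT : T ∈ K.tri)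
    (ha : a ∈ T) (hb : b ∈ T) (hT' : T' ∈ K.tri) (ha' : a ∈ T') (hb' : b ∈ T') : T = T' :=
  Finset.card_le_one.1 h1 T (by simpa using ⟨hT, ha, hb⟩) T' (by simpa using ⟨hT', ha', hb'⟩)

theorem eq_of_card_le_two {α : Type*} {A : Finset α} (hA : A.card ≤ 2) {x y z : α} (hx : x ∈ A)
    (hy : y ∈ A) (hz : z ∈ A) : x = y ∨ x = z ∨ y = z := by
  by_contra hcon
  push Not at hcon
  have := Finset.two_lt_card.2 ⟨x, hx, y, hy, z, hz, hcon⟩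
  omega

theorem eq_of_edgeDeg_le_two {a b : V} (h2 : K.edgeDeg a b ≤ 2) {T₁ T₂ T₃ : Finset V}
    (h₁ : T₁ ∈ K.tri) (ha₁ : a ∈ T₁) (hb₁ : b ∈ T₁) (h₂ : T₂ ∈ K.tri) (ha₂ : a ∈ T₂) (hb₂ : b ∈ T₂)
    (h₃ : T₃ ∈ K.tri) (ha₃ : a ∈ T₃) (hb₃ : b ∈ T₃) : T₁ = T₂ ∨ T₁ = T₃ ∨ T₂ = T₃ :=
  eq_of_card_le_two h2 (by simpa using ⟨h₁, ha₁, hb₁⟩) (by simpa using ⟨h₂, ha₂, hb₂⟩)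
    (by simpa using ⟨h₃, ha₃, hb₃⟩)

theorem mem_mixed {v : V} {X : Finset V} (hv : v ∉ X) {T : Finset V} :
    T ∈ K.mixed v X ↔ T ∈ K.tri ∧ v ∈ T ∧ ∃ y ∈ T, y ∈ X ∧ ∃ z ∈ T, z ≠ v ∧ z ∉ X := by
  classical
  simp only [mixed, Finset.mem_filter, mem_star, and_assoc]
  refine and_congr_right fun hT => and_congr_right fun hvT => ?_
  have hcard := K.card_tri T hT
  obtain ⟨a, b, c, hab, hac, hbc, rfl⟩ := Finset.card_eq_three.1 hcard
  rw [Finset.card_eq_one]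
  constructor
  · rintro ⟨y, hy⟩
    have hmem : ∀ x, x ∈ ({a, b, c} : Finset V) ∧ x ∈ X ↔ x = y := fun x => by
      have := Finset.ext_iff.1 hy x
      simpa [Finset.mem_inter] using this
    obtain ⟨hyT, hyX⟩ := (hmem y).2 rfl
    refine ⟨y, hyT, hyX, ?_⟩
    have hyv : y ≠ v := by rintro rfl; exact hv hyX
    by_contra hcon
    push Not at hcon
    have : ∀ x ∈ ({a, b, c} : Finset V), x = v ∨ x = y := fun x hx => by
      by_cases hxv : x = v
      · exact Or.inl hxv
      · exact Or.inr ((hmem x).1 ⟨hx, hcon x hx hxv⟩)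
    have h1 := this a (by simp)
    have h2 := this b (by simp)
    have h3 := this c (by simp)
    grind
  · rintro ⟨y, hyT, hyX, z, hzT, hzv, hzX⟩
    refine ⟨y, ?_⟩
    ext x
    simp only [Finset.mem_inter, Finset.mem_insert, Finset.mem_singleton] at *
    grind

open Classical in
-- Double counting of the pairs of a vertex in `X` and a triangle that contains it and `v`.
theorem sum_edgeDeg (K : TriComplex V) (v : V) (X : Finset V) :
    ∑ u ∈ X, K.edgeDeg v u = ∑ T ∈ K.star v, (T ∩ X).card := by
  classical
  have h1 : ∀ u, K.edgeDeg v u = ∑ T ∈ K.star v, if u ∈ T then 1 else 0 := by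
    intro u
    rw [← Finset.card_filter]
    unfold edgeDeg star
    rw [Finset.filter_filter]
    congr 1
    ext T
    simp [and_assoc]
  simp only [h1]
  rw [Finset.sum_comm]
  refine Finset.sum_congr rfl fun T _ => ?_
  rw [← Finset.card_filter, Finset.filter_mem_eq_inter, Finset.inter_comm]

/-- Count the pairs of an edge from `v` into `X` and a triangle on it. By edges this is even up to
the number of edges with one triangle; by triangles the mixed ones are the only odd contributions.
-/
theorem even_mixed_add {v : V} {X : Finset V} (hv : v ∉ X)
    (hX : ∀ u ∈ X, K.edgeDeg v u = 1 ∨ K.edgeDeg v u = 2) :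
    Even ((K.mixed v X).card + (X.filter fun u => K.edgeDeg v u = 1).card) := by
  classical
  have h1 : ∑ u ∈ X, K.edgeDeg v u + (X.filter fun u => K.edgeDeg v u = 1).card = 2 * X.card := by
    rw [Finset.card_filter, ← Finset.sum_add_distrib, mul_comm, ← smul_eq_mul, ← Finset.sum_const]
    refine Finset.sum_congr rfl fun u hu => ?_
    rcases hX u hu with h | h <;> simp [h]
  have h2 : ∃ m, ∑ T ∈ K.star v, (T ∩ X).card = 2 * m + (K.mixed v X).card := by
    refine ⟨∑ T ∈ K.star v, if (T ∩ X).card = 2 then 1 else 0, ?_⟩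
    unfold mixed
    rw [Finset.card_filter, Finset.mul_sum, ← Finset.sum_add_distrib]
    refine Finset.sum_congr rfl fun T hT => ?_
    rw [mem_star] at hT
    have h3 : (T ∩ X).card ≤ 2 := by
      have h4 : T ∩ X ⊆ T.erase v := fun x hx => by
        rw [Finset.mem_inter] at hx
        exact Finset.mem_erase.2 ⟨by rintro rfl; exact hv hx.2, hx.1⟩
      have h5 := Finset.card_le_card h4
      rw [Finset.card_erase_of_mem hT.2, K.card_tri T hT.1] at h5
      exact h5
    split_ifs <;> omega
  obtain ⟨m, hm⟩ := h2
  rw [sum_edgeDeg, hm] at h1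
  exact ⟨X.card - m, by omega⟩

/-- A vertex on a boundary edge lies on at least two boundary edges. -/
theorem two_le_card_bdry {v : V} (hv : ∀ u, K.graph.Adj v u → K.edgeDeg v u ≤ 2) {y : V}
    (hy : K.graph.Adj v y) (hy1 : K.edgeDeg v y = 1) :
    2 ≤ ((K.link v).filter fun u => K.edgeDeg v u = 1).card := by
  classical
  have hvl : v ∉ K.link v := fun h => (mem_link.1 h).1 rfl
  have h1 := even_mixed_add (K := K) hvl fun u hu => by
    have h2 := hv u (mem_link.1 hu)
    have h3 := edgeDeg_pos (mem_link.1 hu)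
    omega
  -- For the whole link no triangle is mixed, so the number of boundary edges at `v` is even.
  have h2 : K.mixed v (K.link v) = ∅ := by
    rw [Finset.eq_empty_iff_forall_notMem]
    intro T hT
    obtain ⟨h3, h4, -, -, -, z, hz, hzv, hzl⟩ := (mem_mixed hvl).1 hT
    exact hzl (mem_link.2 (adj_of_mem h3 h4 hz hzv.symm))
  rw [h2, Finset.card_empty, zero_add] at h1
  have h3 : 0 < ((K.link v).filter fun u => K.edgeDeg v u = 1).card :=
    Finset.card_pos.2 ⟨y, by simp [mem_link, hy, hy1]⟩
  obtain ⟨m, hm⟩ := h1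
  omega

theorem exists_second_bdry {v : V} (hv : ∀ u, K.graph.Adj v u → K.edgeDeg v u ≤ 2) {y : V}
    (hy : K.graph.Adj v y) (hy1 : K.edgeDeg v y = 1) :
    ∃ z, z ≠ y ∧ K.graph.Adj v z ∧ K.edgeDeg v z = 1 := by
  obtain ⟨z, hz, hzy⟩ := Finset.exists_mem_ne (two_le_card_bdry hv hy hy1) y
  rw [Finset.mem_filter, mem_link] at hz
  exact ⟨z, hzy, hz⟩

/-! ### Middle vertices -/

variable {h : V → ℝ}

/-- The neighbours with larger value. -/
noncomputable def upLink (K : TriComplex V) (h : V → ℝ) (v : V) : Finset V := by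
  classical
  exact (K.link v).filter fun u => h v < h u

theorem mem_upLink {v u : V} : u ∈ K.upLink h v ↔ K.graph.Adj v u ∧ h v < h u := by
  simp [upLink, mem_link]

theorem notMem_upLink (v : V) : v ∉ K.upLink h v := fun hv => (mem_upLink.1 hv).1.1 rfl

theorem mixed_upLink {v : V} (hne : ∀ u, K.graph.Adj v u → h u ≠ h v) :
    K.mixed v (K.upLink h v) = K.mid h v := by
  classical
  ext T
  rw [mem_mixed (notMem_upLink v), mem_mid]
  refine and_congr_right fun hT => and_congr_right fun hv => ?_
  constructor
  · rintro ⟨y, hy, hyu, z, hz, hzv, hzu⟩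
    have hadj := adj_of_mem hT hv hz hzv.symm
    refine ⟨⟨z, hz, lt_of_le_of_ne (not_lt.1 fun h1 => hzu (mem_upLink.2 ⟨hadj, h1⟩)) (hne z hadj)⟩,
      y, hy, (mem_upLink.1 hyu).2⟩
  · rintro ⟨⟨a, ha, hav⟩, b, hb, hvb⟩
    exact ⟨b, hb, mem_upLink.2 ⟨adj_of_mem_lt hT hv hb hvb, hvb⟩, a, ha,
      by rintro rfl; exact lt_irrefl _ hav, fun h1 => lt_asymm hav (mem_upLink.1 h1).2⟩

/-- Going around `v` from a higher to a lower neighbour, some triangle contains one of each kind. -/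
theorem LinkConnected.mid_nonempty (hK : K.LinkConnected) {v : V}
    (hne : ∀ u, K.graph.Adj v u → h u ≠ h v) (hup : ∃ u, K.graph.Adj v u ∧ h v < h u)
    (hdown : ∃ u, K.graph.Adj v u ∧ h u < h v) : (K.mid h v).Nonempty := by
  classical
  obtain ⟨y, hy, hy'⟩ := hup
  obtain ⟨z, hz, hz'⟩ := hdown
  obtain ⟨T, hT, hv, y, hy, -, hyX, z, hz, hzv, hzX⟩ := hK.exists_mixed (X := K.upLink h v) hy
    (mem_upLink.2 ⟨hy, hy'⟩) hz (fun h1 => lt_asymm hz' (mem_upLink.1 h1).2)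
  rw [← mixed_upLink hne]
  exact ⟨T, (mem_mixed (notMem_upLink v)).2 ⟨hT, hv, y, hy, hyX, z, hz, hzv, hzX⟩⟩

/-- Without boundary edges at `v` the number of such triangles is even, and it is not zero. -/
theorem LinkConnected.two_le_mid (hK : K.LinkConnected) {v : V}
    (hne : ∀ u, K.graph.Adj v u → h u ≠ h v) (hup : ∃ u, K.graph.Adj v u ∧ h v < h u)
    (hdown : ∃ u, K.graph.Adj v u ∧ h u < h v) (hdeg : ∀ u, K.graph.Adj v u → K.edgeDeg v u = 2) :
    2 ≤ (K.mid h v).card := by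
  classical
  have h1 := Finset.card_pos.2 (hK.mid_nonempty hne hup hdown)
  have h2 := even_mixed_add (K := K) (notMem_upLink (h := h) v) fun u hu =>
    Or.inr (hdeg u (mem_upLink.1 hu).1)
  rw [mixed_upLink hne, Finset.filter_false_of_mem, Finset.card_empty, add_zero] at h2
  · obtain ⟨m, hm⟩ := h2
    omega
  · intro u hu
    rw [hdeg u (mem_upLink.1 hu).1]
    norm_num

/-- A boundary vertex that is the middle vertex of one triangle has a higher neighbour on the
boundary. -/
theorem exists_up_bdry {v : V} (hne : ∀ u, K.graph.Adj v u → h u ≠ h v)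
    (hdeg : ∀ u, K.graph.Adj v u → K.edgeDeg v u ≤ 2) (hmid : (K.mid h v).card = 1) :
    ∃ u, K.graph.Adj v u ∧ h v < h u ∧ K.edgeDeg v u = 1 := by
  classical
  have h2 := even_mixed_add (K := K) (notMem_upLink (h := h) v) fun u hu => by
    have h2 := hdeg u (mem_upLink.1 hu).1
    have h3 := edgeDeg_pos (mem_upLink.1 hu).1
    omega
  -- One mixed triangle forces an odd number of ascending boundary edges.
  rw [mixed_upLink hne, hmid] at h2
  have h3 : 0 < ((K.upLink h v).filter fun u => K.edgeDeg v u = 1).card := by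
    obtain ⟨m, hm⟩ := h2
    omega
  obtain ⟨u, hu⟩ := Finset.card_pos.1 h3
  rw [Finset.mem_filter, mem_upLink] at hu
  exact ⟨u, hu.1.1, hu.1.2, hu.2⟩

/-- Two vertices of the upper link of `v` are adjacent in the link of `v`. -/
def UpRel (K : TriComplex V) (h : V → ℝ) (v y z : V) : Prop :=
  h v < h y ∧ h v < h z ∧ ∃ T ∈ K.tri, v ∈ T ∧ y ∈ T ∧ z ∈ T

theorem UpRel.symm {v y z : V} (hyz : K.UpRel h v y z) : K.UpRel h v z y := by
  obtain ⟨h1, h2, T, hT, h3, h4, h5⟩ := hyz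
  exact ⟨h2, h1, T, hT, h3, h5, h4⟩

instance (v : V) : Std.Symm (K.UpRel h v) := ⟨fun _ _ => UpRel.symm⟩

/-- If a vertex is the middle vertex of few triangles, then its upper link is connected. -/
theorem LinkConnected.upLink_connected (hK : K.LinkConnected) {v : V}
    (hne : ∀ u, K.graph.Adj v u → h u ≠ h v) (hdown : ∃ u, K.graph.Adj v u ∧ h u < h v)
    (hmid : (K.mid h v).card ≤ 1 ∨
      (K.mid h v).card ≤ 2 ∧ ∀ u, K.graph.Adj v u → K.edgeDeg v u = 2)
    {u u' : V} (hu : K.graph.Adj v u) (hvu : h v < h u) (hu' : K.graph.Adj v u')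
    (hvu' : h v < h u') : ReflTransGen (K.UpRel h v) u u' := by
  classical
  by_contra hcon
  obtain ⟨d, hd, hd'⟩ := hdown
  -- `C x` is the component of `x` in the upper link. Each component is separated from `d` by a
  -- mixed triangle; such triangles have `v` as middle vertex, and different components do not share
  -- them.
  let C : V → Finset V := fun x => (K.upLink h v).filter fun y => ReflTransGen (K.UpRel h v) x y
  have hC : ∀ x y, y ∈ C x ↔ (K.graph.Adj v y ∧ h v < h y) ∧ ReflTransGen (K.UpRel h v) x y := by
    intro x y
    simp [C, mem_upLink]
  have hvC : ∀ x, v ∉ C x := fun x hx => ((hC x v).1 hx).1.1.1 rfl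
  have hsub : ∀ x, K.mixed v (C x) ⊆ K.mid h v := by
    intro x T hT
    obtain ⟨hT, hv, y, hy, hyC, z, hz, hzv, hzC⟩ := (mem_mixed (hvC x)).1 hT
    rw [hC] at hyC
    have hadj := adj_of_mem hT hv hz hzv.symm
    refine mem_mid.2 ⟨hT, hv, ⟨z, hz, ?_⟩, y, hy, hyC.1.2⟩
    refine lt_of_le_of_ne (not_lt.1 fun h1 => hzC ?_) (hne z hadj)
    exact (hC x z).2 ⟨⟨hadj, h1⟩, hyC.2.tail ⟨hyC.1.2, h1, T, hT, hv, hy, hz⟩⟩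
  have hne' : ∀ x, K.graph.Adj v x → h v < h x → (K.mixed v (C x)).Nonempty := by
    intro x hx hvx
    obtain ⟨T, hT, hv, y, hy, -, hyX, z, hz, hzv, hzX⟩ := hK.exists_mixed (X := C x) hx
      ((hC x x).2 ⟨⟨hx, hvx⟩, ReflTransGen.refl⟩) hd
      (fun h1 => lt_asymm hd' ((hC x d).1 h1).1.2)
    exact ⟨T, (mem_mixed (hvC x)).2 ⟨hT, hv, y, hy, hyX, z, hz, hzv, hzX⟩⟩
  have hdisj : Disjoint (K.mixed v (C u)) (K.mixed v (C u')) := by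
    rw [Finset.disjoint_left]
    intro T h1 h2
    obtain ⟨hT, hv, y, hy, hyC, -⟩ := (mem_mixed (hvC u)).1 h1
    obtain ⟨-, -, z, hz, hzC, -⟩ := (mem_mixed (hvC u')).1 h2
    rw [hC] at hyC hzC
    exact hcon ((hyC.2.tail ⟨hyC.1.2, hzC.1.2, T, hT, hv, hy, hz⟩).trans
      (ReflTransGen.stdSymm.symm _ _ hzC.2))
  have hcard := Finset.card_le_card (Finset.union_subset (hsub u) (hsub u'))
  rw [Finset.card_union_of_disjoint hdisj] at hcard
  have p1 := Finset.card_pos.2 (hne' u hu hvu)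
  have p2 := Finset.card_pos.2 (hne' u' hu' hvu')
  rcases hmid with h1 | ⟨h1, hdeg⟩
  · omega
  -- Without boundary edges each component has an even, hence at least two, and two components at
  -- least four.
  · have heven : ∀ x, Even (K.mixed v (C x)).card := by
      intro x
      have h2 := even_mixed_add (K := K) (hvC x) fun y hy => Or.inr (hdeg y ((hC x y).1 hy).1.1)
      rwa [Finset.filter_false_of_mem, Finset.card_empty, add_zero] at h2
      intro y hy
      rw [hdeg y ((hC x y).1 hy).1.1]
      norm_num
    obtain ⟨m, hm⟩ := heven u
    obtain ⟨m', hm'⟩ := heven u'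
    omega

/-- The upper link of a minimum is connected, if the edges at it on which `h` is constant are
boundary edges. -/
theorem LinkConnected.upLink_connected_of_min (hK : K.LinkConnected) {v : V}
    (hmin : ∀ u, h v ≤ h u) (hbd : ∀ u, K.graph.Adj v u → h u = h v → K.edgeDeg v u ≤ 1)
    {u u' : V} (hu : K.graph.Adj v u) (hvu : h v < h u) (hu' : K.graph.Adj v u')
    (hvu' : h v < h u') : ReflTransGen (K.UpRel h v) u u' := by
  classical
  by_contra hcon
  -- The component of `u`, enlarged by the neighbours at the level of `v` that share a triangle at
  -- `v` with it.
  let X : Set V := {y | ReflTransGen (K.UpRel h v) u y ∧ h v < h y ∨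
    h y = h v ∧ ∃ z, ReflTransGen (K.UpRel h v) u z ∧ h v < h z ∧
      ∃ T ∈ K.tri, v ∈ T ∧ y ∈ T ∧ z ∈ T}
  obtain ⟨T, hT, hv, y, hy, hyv, hyX, z, hz, hzv, hzX⟩ := hK.exists_mixed (X := X) hu
    (Or.inl ⟨ReflTransGen.refl, hvu⟩) hu' (by
      rintro (h1 | h1)
      · exact hcon h1.1
      · exact hvu'.ne' h1.1)
  rcases hyX with ⟨hy1, hy2⟩ | ⟨hy1, w, hw1, hw2, T', hT', hv', hyT', hwT'⟩
  · rcases (hmin z).lt_or_eq with h1 | h1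
    · exact hzX (Or.inl ⟨hy1.tail ⟨hy2, h1, T, hT, hv, hy, hz⟩, h1⟩)
    · exact hzX (Or.inr ⟨h1.symm, y, hy1, hy2, T, hT, hv, hz, hy⟩)
  -- The level edge `v y` lies in one triangle only, so the mixed triangle is the one that put `y`
  -- into `X`. It would then have four vertices.
  · have hadj := adj_of_mem hT hv hy hyv.symm
    obtain rfl := eq_of_edgeDeg_le_one (hbd y hadj hy1) hT hv hy hT' hv' hyT'
    have hzy : z ≠ y := by
      rintro rfl
      exact hzX (Or.inr ⟨hy1, w, hw1, hw2, T, hT, hv, hy, hwT'⟩)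
    have hzw : z ≠ w := by
      rintro rfl
      exact hzX (Or.inl ⟨hw1, hw2⟩)
    have hyw : y ≠ w := by
      rintro rfl
      exact hw2.ne' hy1
    have hvw : v ≠ w := by
      rintro rfl
      exact lt_irrefl _ hw2
    have hsub : ({v, y, z, w} : Finset V) ⊆ T := by
      intro x hx
      simp only [Finset.mem_insert, Finset.mem_singleton] at hx
      rcases hx with rfl | rfl | rfl | rfl <;> assumption
    have hcard := Finset.card_le_card hsub
    rw [K.card_tri T hT, Finset.card_insert_of_notMem (by simp [hyv.symm, hzv.symm, hvw]),
      Finset.card_insert_of_notMem (by simp [hzy.symm, hyw]),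
      Finset.card_insert_of_notMem (by simp [hzw]), Finset.card_singleton] at hcard
    omega

/-! ### The number of triangles of an annulus -/

theorem IsAnnulus.edgeDeg_le {E₁ E₂ : Finset V} (hA : K.IsAnnulus E₁ E₂) {a b : V} (hab : a ≠ b) :
    K.edgeDeg a b ≤ 2 := by
  classical
  have := hA.edge_le_two a b hab
  rw [Set.ncard_eq_toFinset_card'] at this
  unfold edgeDeg
  convert this using 2
  ext T
  simp
  tauto

/-- The triangles of a complex, as a finite set. -/
noncomputable def triangles (K : TriComplex V) : Finset (Finset V) := by
  classical
  exact Finset.univ.filter fun T => T ∈ K.tri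

theorem mem_triangles {T : Finset V} : T ∈ K.triangles ↔ T ∈ K.tri := by
  simp [triangles]

/-- Write `V`, `E`, `F` for the numbers of vertices, edges and triangles. At a vertex, twice the
number of triangles plus the number of boundary edges is twice the number of edges. The sum over all
vertices is `6F + B = 4E`, where `B ≥ 2(|E₁| + |E₂|)` because a boundary vertex has at least two
boundary edges. Now insert `E = V + F`. -/
theorem IsAnnulus.card_triangles {E₁ E₂ : Finset V} (hA : K.IsAnnulus E₁ E₂) :
    K.triangles.card + E₁.card + E₂.card ≤ 2 * Fintype.card V := by
  classical
  have hle : ∀ v u, K.graph.Adj v u → K.edgeDeg v u ≤ 2 := fun v u h => hA.edgeDeg_le h.1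
  set B : V → ℕ := fun v => ((K.link v).filter fun u => K.edgeDeg v u = 1).card with hB
  have h1 : ∀ v, ∑ u ∈ K.link v, K.edgeDeg v u + B v = 2 * (K.link v).card := by
    intro v
    rw [hB]
    simp only
    rw [Finset.card_filter, ← Finset.sum_add_distrib, mul_comm, ← smul_eq_mul, ← Finset.sum_const]
    refine Finset.sum_congr rfl fun u hu => ?_
    have h2 := hle v u (mem_link.1 hu)
    have h3 := edgeDeg_pos (mem_link.1 hu)
    split_ifs <;> omega
  have h2 : ∀ v, ∑ u ∈ K.link v, K.edgeDeg v u = 2 * (K.star v).card := by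
    intro v
    rw [sum_edgeDeg, mul_comm, ← smul_eq_mul, ← Finset.sum_const]
    refine Finset.sum_congr rfl fun T hT => ?_
    rw [mem_star] at hT
    have : T ∩ K.link v = T.erase v := by
      ext x
      simp only [Finset.mem_inter, mem_link, Finset.mem_erase]
      constructor
      · rintro ⟨hx, hadj⟩
        exact ⟨hadj.1.symm, hx⟩
      · rintro ⟨hxv, hx⟩
        exact ⟨hx, adj_of_mem hT.1 hT.2 hx hxv.symm⟩
    rw [this, Finset.card_erase_of_mem hT.2, K.card_tri T hT.1]
  have h3 : ∑ v, (K.star v).card = 3 * K.triangles.card := by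
    have : ∀ v, (K.star v).card = ∑ T ∈ K.triangles, if v ∈ T then 1 else 0 := by
      intro v
      rw [← Finset.card_filter]
      congr 1
      ext T
      simp [mem_star, mem_triangles]
    simp only [this]
    rw [Finset.sum_comm, mul_comm, ← smul_eq_mul, ← Finset.sum_const]
    refine Finset.sum_congr rfl fun T hT => ?_
    rw [← Finset.card_filter, Finset.filter_mem_eq_inter, Finset.univ_inter,
      K.card_tri T (mem_triangles.1 hT)]
  have h4 : ∑ v, (K.link v).card = 2 * K.graph.edgeSet.ncard := by
    have h5 := K.graph.sum_degrees_eq_twice_card_edges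
    rw [Set.ncard_eq_toFinset_card', Set.toFinset_card, ← SimpleGraph.edgeFinset_card, ← h5]
    refine Finset.sum_congr rfl fun v _ => ?_
    rw [SimpleGraph.degree]
    congr 1
    ext u
    simp [mem_link]
  have h5 : K.tri.ncard = K.triangles.card := by
    rw [Set.ncard_eq_toFinset_card']
    congr 1
    ext T
    simp [mem_triangles]
  have h6 : 2 * (E₁.card + E₂.card) ≤ ∑ v, B v := by
    rw [← Finset.card_union_of_disjoint hA.disjoint, mul_comm, ← smul_eq_mul, ← Finset.sum_const]
    refine (Finset.sum_le_sum fun v hv => ?_).trans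
      (Finset.sum_le_sum_of_subset (Finset.subset_univ (E₁ ∪ E₂)))
    rw [Finset.mem_union] at hv
    obtain ⟨u, hu⟩ := (hA.mem_boundary v).1 hv
    have hdeg := (edgeDeg_eq_one_iff hu.1).2 hu
    obtain ⟨hne, T, ⟨hT, hvT, huT⟩, -⟩ := hu
    exact two_le_card_bdry (hle v) ⟨hne, T, hT, hvT, huT⟩ hdeg
  have h7 : ∑ v, (2 * (K.star v).card + B v) = ∑ v, 2 * (K.link v).card :=
    Finset.sum_congr rfl fun v _ => by rw [← h2, h1]
  rw [Finset.sum_add_distrib, ← Finset.mul_sum, ← Finset.mul_sum, h3, h4] at h7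
  have h8 := hA.euler
  rw [h5, Nat.card_eq_fintype_card] at h8
  omega

end TriComplex

/-! ### The complex cut open along a path -/

namespace TriComplex

open Relation

variable {V : Type*}

set_option linter.unusedSectionVars false

theorem PathEdge.symm {n : ℕ} {γ : Fin (n + 1) → V} {u v : V} (huv : PathEdge γ u v) :
    PathEdge γ v u := by
  obtain ⟨i, hi⟩ := huv
  exact ⟨i, hi.symm⟩

variable {K : TriComplex V} {n : ℕ} {γ : Fin (n + 1) → V}

/-! ### Triangles of the complex cut open along a path -/

open Classical in
/-- A triangle of `K` as a triangle of the cut complex. -/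
noncomputable def cutTri (K : TriComplex V) (γ : Fin (n + 1) → V) (T : Finset V) (hT : T ∈ K.tri) :
    Finset (K.CutVertex γ) :=
  T.attach.image fun v => K.cutMk γ T hT v.1 v.2

theorem cutTri_mem {T : Finset V} (hT : T ∈ K.tri) : K.cutTri γ T hT ∈ (K.cut γ).tri := ⟨T, hT, rfl⟩

theorem mem_cutTri {T : Finset V} {hT : T ∈ K.tri} {w : K.CutVertex γ} :
    w ∈ K.cutTri γ T hT ↔ ∃ hv : K.cutProj γ w ∈ T, K.cutMk γ T hT (K.cutProj γ w) hv = w := by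
  classical
  unfold cutTri
  rw [Finset.mem_image]
  constructor
  · rintro ⟨⟨v, hv⟩, -, rfl⟩
    exact ⟨hv, rfl⟩
  · rintro ⟨hv, hw⟩
    exact ⟨⟨_, hv⟩, Finset.mem_attach _ _, hw⟩

theorem cutMk_mem_cutTri {T : Finset V} {hT : T ∈ K.tri} {v : V} (hv : v ∈ T) :
    K.cutMk γ T hT v hv ∈ K.cutTri γ T hT := mem_cutTri.2 ⟨hv, rfl⟩

theorem eq_of_mem_cutTri {T : Finset V} {hT : T ∈ K.tri} {w w' : K.CutVertex γ}
    (hw : w ∈ K.cutTri γ T hT) (hw' : w' ∈ K.cutTri γ T hT)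
    (hp : K.cutProj γ w = K.cutProj γ w') : w = w' := by
  obtain ⟨h1, h2⟩ := mem_cutTri.1 hw
  obtain ⟨h3, h4⟩ := mem_cutTri.1 hw'
  rw [← h2, ← h4]
  congr 1

theorem cutTri_injective {T₁ T₂ : Finset V} {h₁ : T₁ ∈ K.tri} {h₂ : T₂ ∈ K.tri}
    (h : K.cutTri γ T₁ h₁ = K.cutTri γ T₂ h₂) : T₁ = T₂ := by
  have key : ∀ {T₁ T₂ : Finset V} {h₁ : T₁ ∈ K.tri} {h₂ : T₂ ∈ K.tri},
      K.cutTri γ T₁ h₁ = K.cutTri γ T₂ h₂ → T₁ ⊆ T₂ := by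
    intro T₁ T₂ h₁ h₂ h v hv
    have := cutMk_mem_cutTri (γ := γ) (hT := h₁) hv
    rw [h] at this
    exact (mem_cutTri.1 this).1
  exact Finset.Subset.antisymm (key h) (key h.symm)

theorem cutMk_eq {T₁ T₂ : Finset V} (h₁ : T₁ ∈ K.tri) (h₂ : T₂ ∈ K.tri) {u v : V} (huv : u ≠ v)
    (hu₁ : u ∈ T₁) (hv₁ : v ∈ T₁) (hu₂ : u ∈ T₂) (hv₂ : v ∈ T₂) (hγ : ¬ PathEdge γ u v) :
    K.cutMk γ T₁ h₁ u hu₁ = K.cutMk γ T₂ h₂ u hu₂ :=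
  Quot.sound ⟨rfl, v, huv.symm, hv₁, hv₂, hγ⟩

theorem cutProj_ne {a b : K.CutVertex γ} (hab : (K.cut γ).graph.Adj a b) :
    K.cutProj γ a ≠ K.cutProj γ b := by
  obtain ⟨hne, T', ⟨T, hT, rfl⟩, ha, hb⟩ := hab
  exact fun h => hne (eq_of_mem_cutTri ha hb h)

theorem cut_adj {a b : K.CutVertex γ} (hab : (K.cut γ).graph.Adj a b) :
    K.graph.Adj (K.cutProj γ a) (K.cutProj γ b) := by
  have h := cutProj_ne hab
  obtain ⟨hne, T', ⟨T, hT, rfl⟩, ha, hb⟩ := hab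
  exact ⟨h, T, hT, (mem_cutTri.1 ha).1, (mem_cutTri.1 hb).1⟩

/-- Over an edge that does not belong to the path, nothing is cut. -/
theorem mem_cutTri_of_not_pathEdge {a b : K.CutVertex γ} (hab : (K.cut γ).graph.Adj a b)
    (hγ : ¬ PathEdge γ (K.cutProj γ a) (K.cutProj γ b)) {T : Finset V} (hT : T ∈ K.tri)
    (ha : K.cutProj γ a ∈ T) (hb : K.cutProj γ b ∈ T) :
    a ∈ K.cutTri γ T hT ∧ b ∈ K.cutTri γ T hT := by
  have hne := cutProj_ne hab
  obtain ⟨-, T', ⟨T₁, hT₁, rfl⟩, ha', hb'⟩ := hab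
  obtain ⟨h1, h2⟩ := mem_cutTri.1 ha'
  obtain ⟨h3, h4⟩ := mem_cutTri.1 hb'
  refine ⟨mem_cutTri.2 ⟨ha, ?_⟩, mem_cutTri.2 ⟨hb, ?_⟩⟩
  · exact (cutMk_eq hT hT₁ hne ha hb h1 h3 hγ).trans h2
  · exact (cutMk_eq hT hT₁ hne.symm hb ha h3 h1 fun h => hγ h.symm).trans h4

/-- A vertex of the cut complex is a class of corners under steps across edges outside the path, and
a chain of such steps is a chain of triangles around that vertex. No assumption on the links of `K`
is needed. -/
theorem linkConnected_cut (K : TriComplex V) (γ : Fin (n + 1) → V) :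
    (K.cut γ).LinkConnected := by
  -- Conditions on both triangles make the relation symmetric, as inverse steps in the generated
  -- equivalence require.
  have key : ∀ f f' : K.Flag, EqvGen (K.FlagStep γ) f f' → ∀ w : K.CutVertex γ,
      w = Quot.mk _ f →
      ReflTransGen (fun R R' => R ∈ (K.cut γ).tri ∧ w ∈ R ∧ R' ∈ (K.cut γ).tri ∧ w ∈ R' ∧
        ∃ y, y ≠ w ∧ y ∈ R ∧ y ∈ R')
        (K.cutTri γ f.1.1 f.2.1) (K.cutTri γ f'.1.1 f'.2.1) := by
    intro f f' hff'
    induction hff' with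
    | rel f f' h =>
      rintro w rfl
      refine ReflTransGen.single ?_
      have heq : (Quot.mk _ f : K.CutVertex γ) = Quot.mk _ f' := Quot.sound h
      obtain ⟨⟨T, v⟩, hT, hv⟩ := f
      obtain ⟨⟨T', v'⟩, hT', hv'⟩ := f'
      obtain ⟨h1, y, hyv, hyT, hyT', hγ⟩ := h
      simp only at hT hv hT' hv' h1 hyv hyT hyT' hγ
      subst h1
      refine ⟨cutTri_mem hT, cutMk_mem_cutTri hv, cutTri_mem hT', heq ▸ cutMk_mem_cutTri hv',
        K.cutMk γ T hT y hyT, fun h => hyv (congrArg (K.cutProj γ) h), cutMk_mem_cutTri hyT, ?_⟩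
      rw [cutMk_eq hT hT' hyv hyT hv hyT' hv' fun h => hγ h.symm]
      exact cutMk_mem_cutTri hyT'
    | refl f => exact fun _ _ => ReflTransGen.refl
    | symm f f' h ih =>
      intro w hw
      have hw' : w = Quot.mk _ f := hw.trans (Quot.eqvGen_sound h).symm
      have : Std.Symm fun R R' => R ∈ (K.cut γ).tri ∧ w ∈ R ∧ R' ∈ (K.cut γ).tri ∧ w ∈ R' ∧
          ∃ y, y ≠ w ∧ y ∈ R ∧ y ∈ R' :=
        ⟨fun R R' ⟨h1, h2, h3, h4, y, h5, h6, h7⟩ => ⟨h3, h4, h1, h2, y, h5, h7, h6⟩⟩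
      exact ReflTransGen.stdSymm.symm _ _ (ih w hw')
    | trans f f' f'' h _ ih ih' =>
      intro w hw
      exact (ih w hw).trans (ih' w (hw.trans (Quot.eqvGen_sound h)))
  rintro w _ _ ⟨T, hT, rfl⟩ ⟨T', hT', rfl⟩ hw hw'
  obtain ⟨h1, h2⟩ := mem_cutTri.1 hw
  obtain ⟨h3, h4⟩ := mem_cutTri.1 hw'
  refine ReflTransGen.mono (fun R R' h => h.2.2) _ _
    (key ⟨(T, _), hT, h1⟩ ⟨(T', _), hT', h3⟩ ?_ w h2.symm)
  exact Quot.eqvGen_exact (h2.trans h4.symm)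

variable [Fintype V]

/-- Projection is injective on triangles: the image of a triangle of the cut complex is the triangle
it comes from. -/
theorem edgeDeg_cut_le (a b : K.CutVertex γ) :
    (K.cut γ).edgeDeg a b ≤ K.edgeDeg (K.cutProj γ a) (K.cutProj γ b) := by
  classical
  unfold edgeDeg
  refine Finset.card_le_card_of_injOn (fun T' => T'.image (K.cutProj γ)) ?_ ?_
  · intro T' hT'
    simp only [Finset.coe_filter, Finset.mem_univ, true_and, Set.mem_ofPred_eq] at hT' ⊢
    obtain ⟨⟨T, hT, rfl⟩, ha, hb⟩ := hT'
    have : (K.cutTri γ T hT).image (K.cutProj γ) = T := by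
      ext v
      rw [Finset.mem_image]
      constructor
      · rintro ⟨w, hw, rfl⟩
        exact (mem_cutTri.1 hw).1
      · intro hv
        exact ⟨_, cutMk_mem_cutTri hv, rfl⟩
    refine ⟨?_, Finset.mem_image_of_mem _ ha, Finset.mem_image_of_mem _ hb⟩
    exact this.symm ▸ hT
  · intro T₁ h₁ T₂ h₂ h
    simp only [Finset.coe_filter, Finset.mem_univ, true_and, Set.mem_ofPred_eq] at h₁ h₂ h
    obtain ⟨⟨T₁, hT₁, rfl⟩, -⟩ := h₁
    obtain ⟨⟨T₂, hT₂, rfl⟩, -⟩ := h₂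
    have this : ∀ (T : Finset V) (hT : T ∈ K.tri), (K.cutTri γ T hT).image (K.cutProj γ) = T := by
      intro T hT
      ext v
      rw [Finset.mem_image]
      constructor
      · rintro ⟨w, hw, rfl⟩
        exact (mem_cutTri.1 hw).1
      · intro hv
        exact ⟨_, cutMk_mem_cutTri hv, rfl⟩
    have e : T₁ = T₂ := by
      rw [← this T₁ hT₁, ← this T₂ hT₂]
      exact h
    subst e
    rfl

theorem edgeDeg_cut_eq {a b : K.CutVertex γ} (hab : (K.cut γ).graph.Adj a b)
    (hγ : ¬ PathEdge γ (K.cutProj γ a) (K.cutProj γ b)) :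
    (K.cut γ).edgeDeg a b = K.edgeDeg (K.cutProj γ a) (K.cutProj γ b) := by
  classical
  refine le_antisymm (edgeDeg_cut_le a b) ?_
  unfold edgeDeg
  refine Finset.card_le_card_of_injOn
    (fun T => if hT : T ∈ K.tri then K.cutTri γ T hT else ∅) ?_ ?_
  · intro T hT
    simp only [Finset.coe_filter, Finset.mem_univ, true_and, Set.mem_ofPred_eq] at hT ⊢
    rw [dif_pos hT.1]
    exact ⟨cutTri_mem hT.1, mem_cutTri_of_not_pathEdge hab hγ hT.1 hT.2.1 hT.2.2⟩
  · intro T₁ h₁ T₂ h₂ h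
    simp only [Finset.coe_filter, Finset.mem_univ, true_and, Set.mem_ofPred_eq] at h₁ h₂ h
    rw [dif_pos h₁.1, dif_pos h₂.1] at h
    exact cutTri_injective h

theorem card_triangles_cut_le : (K.cut γ).triangles.card ≤ K.triangles.card := by
  classical
  have hsub : (K.cut γ).triangles ⊆
      K.triangles.attach.image fun T => K.cutTri γ T.1 (mem_triangles.1 T.2) := by
    intro T' hT'
    obtain ⟨T, hT, rfl⟩ := mem_triangles.1 hT'
    exact Finset.mem_image.2 ⟨⟨T, mem_triangles.2 hT⟩, Finset.mem_attach _ _, rfl⟩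
  refine (Finset.card_le_card hsub).trans (Finset.card_image_le.trans ?_)
  rw [Finset.card_attach]

/-! ### Both copies of the path -/

namespace IsBaseTop

variable {base top : Fin (n + 1) → K.CutVertex γ} (hbt : K.IsBaseTop γ base top)

include hbt

theorem swap : K.IsBaseTop γ top base :=
  ⟨hbt.proj_top, hbt.proj_base, hbt.adj_top, hbt.adj_base, fun i => (hbt.ne i).symm⟩

theorem base_injective (hγ : Function.Injective γ) : Function.Injective base := fun i j h =>
  hγ (by rw [← hbt.proj_base, ← hbt.proj_base, h])

theorem base_ne_top (hγ : Function.Injective γ) (i j : Fin (n + 1)) : base i ≠ top j := by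
  intro h
  have : γ i = γ j := by rw [← hbt.proj_base, ← hbt.proj_top, h]
  obtain rfl := hγ this
  exact hbt.ne i h

/-- The two triangles at an edge of the path. -/
theorem exists_triangles {E₁ E₂ : Finset V} (hA : K.IsAnnulus E₁ E₂) (i : Fin n) :
    ∃ T₁, ∃ h₁ : T₁ ∈ K.tri, ∃ T₂, ∃ h₂ : T₂ ∈ K.tri, T₁ ≠ T₂ ∧
      (base i.castSucc ∈ K.cutTri γ T₁ h₁ ∧ base i.succ ∈ K.cutTri γ T₁ h₁) ∧
      (top i.castSucc ∈ K.cutTri γ T₂ h₂ ∧ top i.succ ∈ K.cutTri γ T₂ h₂) ∧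
      ∀ T ∈ K.tri, γ i.castSucc ∈ T → γ i.succ ∈ T → T = T₁ ∨ T = T₂ := by
  have hne := cutProj_ne (hbt.adj_base i)
  obtain ⟨-, -, ⟨T₁, h₁, rfl⟩, a₁, b₁⟩ := hbt.adj_base i
  obtain ⟨-, -, ⟨T₂, h₂, rfl⟩, a₂, b₂⟩ := hbt.adj_top i
  -- A triangle has only one corner over each vertex, so a common triangle would identify the two
  -- copies.
  have hT : T₁ ≠ T₂ := by
    rintro rfl
    exact hbt.ne _ (eq_of_mem_cutTri a₁ a₂ (by rw [hbt.proj_base, hbt.proj_top]))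
  refine ⟨T₁, h₁, T₂, h₂, hT, ⟨a₁, b₁⟩, ⟨a₂, b₂⟩, fun T hT' ha hb => ?_⟩
  have p1 := (mem_cutTri.1 a₁).1
  have p2 := (mem_cutTri.1 b₁).1
  have p3 := (mem_cutTri.1 a₂).1
  have p4 := (mem_cutTri.1 b₂).1
  rw [hbt.proj_base] at p1 p2
  rw [hbt.proj_top] at p3 p4
  rw [hbt.proj_base, hbt.proj_base] at hne
  rcases eq_of_edgeDeg_le_two (hA.edgeDeg_le hne) hT' ha hb h₁ p1 p2 h₂ p3 p4 with h | h | h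
  exacts [Or.inl h, Or.inr h, absurd h hT]

/-- An edge of the path lies in only two triangles, one of which carries its copy on the base and
the other its copy on the top. -/
theorem pathEdge_of_proj {E₁ E₂ : Finset V} (hA : K.IsAnnulus E₁ E₂) {a b : K.CutVertex γ}
    (hab : (K.cut γ).graph.Adj a b) (hγ : PathEdge γ (K.cutProj γ a) (K.cutProj γ b)) :
    PathEdge base a b ∨ PathEdge top a b := by
  have key : ∀ i a b, (K.cut γ).graph.Adj a b → K.cutProj γ a = γ (Fin.castSucc i) →
      K.cutProj γ b = γ i.succ → (a = base i.castSucc ∧ b = base i.succ) ∨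
        (a = top i.castSucc ∧ b = top i.succ) := by
    intro i a b hab ha hb
    obtain ⟨T₁, h₁, T₂, h₂, -, ⟨a₁, b₁⟩, ⟨a₂, b₂⟩, hu⟩ := hbt.exists_triangles hA i
    obtain ⟨-, -, ⟨T, hT, rfl⟩, haT, hbT⟩ := hab
    rcases hu T hT (ha ▸ (mem_cutTri.1 haT).1) (hb ▸ (mem_cutTri.1 hbT).1) with rfl | rfl
    · exact Or.inl ⟨eq_of_mem_cutTri haT a₁ (by rw [ha, hbt.proj_base]),
        eq_of_mem_cutTri hbT b₁ (by rw [hb, hbt.proj_base])⟩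
    · exact Or.inr ⟨eq_of_mem_cutTri haT a₂ (by rw [ha, hbt.proj_top]),
        eq_of_mem_cutTri hbT b₂ (by rw [hb, hbt.proj_top])⟩
  obtain ⟨i, ⟨ha, hb⟩ | ⟨hb, ha⟩⟩ := hγ
  · rcases key i a b hab ha hb with h | h
    exacts [Or.inl ⟨i, Or.inl h⟩, Or.inr ⟨i, Or.inl h⟩]
  · rcases key i b a hab.symm hb ha with h | h
    exacts [Or.inl ⟨i, Or.inr h⟩, Or.inr ⟨i, Or.inr h⟩]

/-- Of the two triangles over a path edge, the second carries the copy on the top. -/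
theorem edgeDeg_base {E₁ E₂ : Finset V} (hA : K.IsAnnulus E₁ E₂) {a b : K.CutVertex γ}
    (hab : PathEdge base a b) : (K.cut γ).edgeDeg a b ≤ 1 := by
  classical
  have key : ∀ i : Fin n, (K.cut γ).edgeDeg (base i.castSucc) (base i.succ) ≤ 1 := by
    intro i
    obtain ⟨T₁, h₁, T₂, h₂, -, ⟨a₁, b₁⟩, ⟨a₂, b₂⟩, hu⟩ := hbt.exists_triangles hA i
    have : ∀ T' ∈ (K.cut γ).tri, base i.castSucc ∈ T' → base i.succ ∈ T' →
        T' = K.cutTri γ T₁ h₁ := by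
      rintro _ ⟨T, hT, rfl⟩ ha hb
      have ha' := (mem_cutTri.1 ha).1
      have hb' := (mem_cutTri.1 hb).1
      rw [hbt.proj_base] at ha' hb'
      rcases hu T hT ha' hb' with rfl | rfl
      · rfl
      · exact absurd (eq_of_mem_cutTri ha a₂ (by rw [hbt.proj_base, hbt.proj_top])) (hbt.ne _)
    refine Finset.card_le_one.2 fun T hT T' hT' => ?_
    simp only [Finset.mem_filter, Finset.mem_univ, true_and] at hT hT'
    rw [this T hT.1 hT.2.1 hT.2.2, this T' hT'.1 hT'.2.1 hT'.2.2]
  obtain ⟨i, ⟨rfl, rfl⟩ | ⟨rfl, rfl⟩⟩ := hab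
  · exact key i
  · rw [edgeDeg_comm]
    exact key i

/-- The two copies lie in different triangles over the edge; so no edge of the path is a boundary
edge of the annulus. -/
theorem two_le_edgeDeg {E₁ E₂ : Finset V} (hA : K.IsAnnulus E₁ E₂) {a b : V}
    (hab : PathEdge γ a b) : K.edgeDeg a b ≠ 1 := by
  have key : ∀ i : Fin n, K.edgeDeg (γ i.castSucc) (γ i.succ) ≠ 1 := by
    intro i h
    obtain ⟨T₁, h₁, T₂, h₂, hne, ⟨a₁, b₁⟩, ⟨a₂, b₂⟩, hu⟩ := hbt.exists_triangles hA i
    have p1 := (mem_cutTri.1 a₁).1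
    have p2 := (mem_cutTri.1 b₁).1
    have p3 := (mem_cutTri.1 a₂).1
    have p4 := (mem_cutTri.1 b₂).1
    rw [hbt.proj_base] at p1 p2
    rw [hbt.proj_top] at p3 p4
    exact hne (eq_of_edgeDeg_le_one h.le h₁ p1 p2 h₂ p3 p4)
  obtain ⟨i, ⟨rfl, rfl⟩ | ⟨rfl, rfl⟩⟩ := hab
  · exact key i
  · rw [edgeDeg_comm]
    exact key i

end IsBaseTop

/-! ### Edges of an injective path -/

section PathIndex

variable {W : Type*} {β : Fin (n + 1) → W}

theorem pathEdge_index (hβ : Function.Injective β) {i j : Fin (n + 1)}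
    (hij : PathEdge β (β i) (β j)) : i.1 + 1 = j.1 ∨ j.1 + 1 = i.1 := by
  obtain ⟨l, ⟨h1, h2⟩ | ⟨h1, h2⟩⟩ := hij
  · have := hβ h1
    have := hβ h2
    subst i j
    left; simp
  · have := hβ h1
    have := hβ h2
    subst i j
    right; simp

theorem pathEdge_range {a b : W} (hab : PathEdge β a b) : (∃ i, a = β i) ∧ ∃ j, b = β j := by
  obtain ⟨l, ⟨rfl, rfl⟩ | ⟨rfl, rfl⟩⟩ := hab
  exacts [⟨⟨_, rfl⟩, _, rfl⟩, ⟨⟨_, rfl⟩, _, rfl⟩]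

theorem pathEdge_le_two (hβ : Function.Injective β) {v a₁ a₂ a₃ : W} (h₁ : PathEdge β v a₁)
    (h₂ : PathEdge β v a₂) (h₃ : PathEdge β v a₃) : a₁ = a₂ ∨ a₁ = a₃ ∨ a₂ = a₃ := by
  obtain ⟨⟨i, rfl⟩, j₁, rfl⟩ := pathEdge_range h₁
  obtain ⟨-, j₂, rfl⟩ := pathEdge_range h₂
  obtain ⟨-, j₃, rfl⟩ := pathEdge_range h₃
  have k₁ := pathEdge_index hβ h₁
  have k₂ := pathEdge_index hβ h₂
  have k₃ := pathEdge_index hβ h₃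
  simp only [hβ.eq_iff, Fin.ext_iff]
  omega

theorem pathEdge_unique (hβ : Function.Injective β) {i : Fin (n + 1)} (hi : i = 0 ∨ i = Fin.last n)
    {a₁ a₂ : W} (h₁ : PathEdge β (β i) a₁) (h₂ : PathEdge β (β i) a₂) : a₁ = a₂ := by
  obtain ⟨-, j₁, rfl⟩ := pathEdge_range h₁
  obtain ⟨-, j₂, rfl⟩ := pathEdge_range h₂
  have k₁ := pathEdge_index hβ h₁
  have k₂ := pathEdge_index hβ h₂
  rw [hβ.eq_iff, Fin.ext_iff]
  have := j₁.2
  have := j₂.2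
  rcases hi with rfl | rfl
  · simp only [Fin.val_zero] at k₁ k₂
    omega
  · simp only [Fin.val_last] at k₁ k₂
    omega

theorem exists_pathEdge (hn : n ≠ 0) (β : Fin (n + 1) → W) (i : Fin (n + 1)) :
    ∃ j, PathEdge β (β i) (β j) := by
  rcases Fin.eq_castSucc_or_eq_last i with ⟨l, rfl⟩ | rfl
  · exact ⟨l.succ, l, Or.inl ⟨rfl, rfl⟩⟩
  · obtain ⟨m, rfl⟩ := Nat.exists_eq_succ_of_ne_zero hn
    exact ⟨(Fin.last m).castSucc, Fin.last m, Or.inr ⟨rfl, by rw [Fin.succ_last]⟩⟩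

end PathIndex

end TriComplex

/-! ### Maximum principle for the harmonic conjugate -/

namespace TriComplex

open Relation

variable {V : Type*} [Fintype V] {K : TriComplex V}

set_option linter.unusedSectionVars false

/-! ### Harmonic functions -/

theorem lap_const_sub (c : V → V → ℝ) (f : V → ℝ) (r : ℝ) (v : V) :
    K.lap c (fun w => r - f w) v = -K.lap c f v := by
  unfold lap
  rw [← Finset.sum_neg_distrib]
  refine Finset.sum_congr rfl fun u _ => ?_
  split_ifs
  · ring
  · simp

/-- If no neighbour were higher, the Laplacian would be a sum of nonnegative terms equal to zero, so
all neighbours would have the value at `v`. -/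
theorem exists_adj_gt_of_lap_eq_zero {c : V → V → ℝ} (hc : K.IsConductance c) {f : V → ℝ} {v u : V}
    (hlap : K.lap c f v = 0) (hu : K.graph.Adj v u) (hne : f u ≠ f v) :
    ∃ w, K.graph.Adj v w ∧ f v < f w := by
  by_contra hcon
  push Not at hcon
  unfold lap at hlap
  rw [Finset.sum_eq_zero_iff_of_nonneg] at hlap
  · have := hlap u (Finset.mem_univ u)
    rw [if_pos hu] at this
    rcases mul_eq_zero.1 this with h1 | h1
    · exact (hc.2 v u hu).ne' h1
    · exact hne (by linarith)
  · intro w _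
    split_ifs with hw
    · exact mul_nonneg (hc.2 v w hw).le (sub_nonneg.2 (hcon w hw))
    · exact le_rfl

/-- By Green's formula, the Dirichlet energy of a non-constant function is positive. -/
theorem sum_mul_lap_pos {c : V → V → ℝ} (hc : K.IsConductance c) {f : V → ℝ} {a b : V}
    (hab : K.graph.Adj a b) (hne : f a ≠ f b) : 0 < ∑ v, f v * K.lap c f v := by
  classical
  let D : V → V → ℝ := fun x y => if K.graph.Adj x y then c x y * (f x - f y) else 0
  have hD : ∀ x y, D y x = -D x y := by
    intro x y
    simp only [D, K.graph.adj_comm y x, hc.1 y x]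
    split_ifs
    · ring
    · simp
  have h1 : ∑ v, f v * K.lap c f v = ∑ x, ∑ y, f x * D x y := by
    refine Finset.sum_congr rfl fun v _ => ?_
    rw [lap, Finset.mul_sum]
  have h2 : ∑ x, ∑ y, f x * D x y = ∑ x, ∑ y, f y * D y x := Finset.sum_comm
  have h3 : 2 * ∑ v, f v * K.lap c f v = ∑ x, ∑ y, (f x - f y) * D x y := by
    rw [two_mul]
    nth_rw 2 [h1]
    rw [h2, h1, ← Finset.sum_add_distrib]
    refine Finset.sum_congr rfl fun x _ => ?_
    rw [← Finset.sum_add_distrib]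
    refine Finset.sum_congr rfl fun y _ => ?_
    rw [hD x y]
    ring
  have h4 : ∀ x y, 0 ≤ (f x - f y) * D x y := by
    intro x y
    simp only [D]
    split_ifs with h
    · have := hc.2 x y h
      nlinarith [mul_nonneg this.le (mul_self_nonneg (f x - f y))]
    · simp
  have h5 : 0 < (f a - f b) * D a b := by
    simp only [D, if_pos hab]
    have := mul_pos (hc.2 a b hab) (mul_self_pos.2 (sub_ne_zero.2 hne))
    nlinarith
  have h6 : 0 < ∑ x, ∑ y, (f x - f y) * D x y :=
    Finset.sum_pos' (fun x _ => Finset.sum_nonneg fun y _ => h4 x y)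
      ⟨a, Finset.mem_univ a, Finset.sum_pos' (fun y _ => h4 a y) ⟨b, Finset.mem_univ b, h5⟩⟩
  linarith

section Slit

variable {E₁ E₂ : Finset V} {c : V → V → ℝ} {k : ℝ} {g : V → ℝ} {n : ℕ} {γ : Fin (n + 1) → V}

/-- Only `E₁` contributes to the sum of `g v * K.lap c g v`, so the Dirichlet energy is `k` times
the period. -/
theorem IsDirichletSolution.period_pos (hg : K.IsDirichletSolution E₁ E₂ c k g)
    (hc : K.IsConductance c) (hk : 0 < k) {a b : V} (hab : K.graph.Adj a b) (hne : g a ≠ g b) :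
    0 < K.period E₁ c g := by
  have h1 : ∑ v, g v * K.lap c g v = k * K.period E₁ c g := by
    rw [period, Finset.mul_sum]
    refine (Finset.sum_subset (Finset.subset_univ E₁) fun v _ hv => ?_).symm.trans
      (Finset.sum_congr rfl fun v hv => by rw [hg.outer v hv])
    by_cases hv' : v ∈ E₂
    · rw [hg.inner v hv', zero_mul]
    · rw [hg.harmonic v hv hv', mul_zero]
  have h2 := sum_mul_lap_pos hc hab hne
  rw [h1] at h2
  exact pos_of_mul_pos_right h2 hk.le

theorem IsSlit.injective (hγ : K.IsSlit E₁ E₂ g γ) : Function.Injective γ := fun _ _ hij =>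
  hγ.anti.injective (congrArg g hij)

/-- Along the slit `g` decreases strictly, so the boundary value `k` occurs only at its start. -/
theorem IsSlit.mem_outer_iff (hγ : K.IsSlit E₁ E₂ g γ) (hg : K.IsDirichletSolution E₁ E₂ c k g)
    (i : Fin (n + 1)) : γ i ∈ E₁ ↔ i = 0 := by
  refine ⟨fun hi => hγ.anti.injective ?_, by rintro rfl; exact hγ.start⟩
  simp only [hg.outer _ hi, hg.outer _ hγ.start]

theorem IsSlit.mem_inner_iff (hγ : K.IsSlit E₁ E₂ g γ) (hg : K.IsDirichletSolution E₁ E₂ c k g)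
    (i : Fin (n + 1)) : γ i ∈ E₂ ↔ i = Fin.last n := by
  refine ⟨fun hi => hγ.anti.injective ?_, by rintro rfl; exact hγ.finish⟩
  simp only [hg.inner _ hi, hg.inner _ hγ.finish]

theorem IsSlit.length_ne_zero (hγ : K.IsSlit E₁ E₂ g γ) (hg : K.IsDirichletSolution E₁ E₂ c k g)
    (hk : 0 < k) : n ≠ 0 := by
  rintro rfl
  have h1 := hg.outer _ hγ.start
  have h2 := hg.inner _ hγ.finish
  rw [show Fin.last 0 = 0 from rfl, h1] at h2
  exact hk.ne' h2

end Slit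

theorem IsConductance.cut {c : V → V → ℝ} (hc : K.IsConductance c) {n : ℕ} (γ : Fin (n + 1) → V) :
    (K.cut γ).IsConductance (K.cutCond γ c) :=
  ⟨fun _ _ => hc.1 _ _, fun _ _ h => hc.2 _ _ (cut_adj h)⟩

/-! ### The harmonic conjugate on the cut annulus -/

/-- An annulus that is cut open along a path, with a solution `h` of the Dirichlet-Neumann problem
that is not constant on the edges outside the base and the top. -/
structure IsCutAnnulus (K : TriComplex V) (E₁ E₂ : Finset V) (c : V → V → ℝ) (p : ℝ) {n : ℕ}
    (γ : Fin (n + 1) → V) (base top : Fin (n + 1) → K.CutVertex γ) (h : K.CutVertex γ → ℝ) :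
    Prop where
  annulus : K.IsAnnulus E₁ E₂
  cond : K.IsConductance c
  pos : 0 < p
  inj : Function.Injective γ
  mem_outer_iff : ∀ i, γ i ∈ E₁ ↔ i = 0
  mem_inner_iff : ∀ i, γ i ∈ E₂ ↔ i = Fin.last n
  length_ne_zero : n ≠ 0
  baseTop : K.IsBaseTop γ base top
  sol : K.IsHarmonicConjugate E₁ E₂ c p γ base top h
  pathEdge : ∀ a b, (K.cut γ).graph.Adj a b → h a = h b → PathEdge base a b ∨ PathEdge top a b

namespace IsCutAnnulus

variable {E₁ E₂ : Finset V} {c : V → V → ℝ} {p : ℝ} {n : ℕ} {γ : Fin (n + 1) → V}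
  {base top : Fin (n + 1) → K.CutVertex γ} {h : K.CutVertex γ → ℝ}
  (H : K.IsCutAnnulus E₁ E₂ c p γ base top h)

include H

/-- The symmetry that exchanges base and top; it turns each statement about the base or about higher
neighbours into its counterpart. -/
theorem swap : K.IsCutAnnulus E₁ E₂ c p γ top base fun w => p - h w where
  __ := H
  baseTop := H.baseTop.swap
  sol :=
    { on_top := fun i => by rw [H.sol.on_base, sub_zero]
      on_base := fun i => by rw [H.sol.on_top, sub_self]
      neumann := fun w h1 h2 h3 => by rw [lap_const_sub, H.sol.neumann w h2 h1 h3, neg_zero]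
      harmonic := fun w h1 h2 h3 h4 => by
        rw [lap_const_sub, H.sol.harmonic w h2 h1 h3 h4, neg_zero] }
  pathEdge a b hab hh := (H.pathEdge a b hab (by linarith)).symm

theorem base_injective : Function.Injective base := H.baseTop.base_injective H.inj

theorem lap_eq_zero {w : K.CutVertex γ} (hb : w ∉ Set.range base) (ht : w ∉ Set.range top) :
    (K.cut γ).lap (K.cutCond γ c) h w = 0 := by
  by_cases hE : K.cutProj γ w ∈ E₁ ∨ K.cutProj γ w ∈ E₂
  · exact H.sol.neumann w hb ht hE
  · push Not at hE
    exact H.sol.harmonic w hb ht hE.1 hE.2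

theorem ne_of_adj {w u : K.CutVertex γ} (hb : w ∉ Set.range base) (ht : w ∉ Set.range top)
    (hu : (K.cut γ).graph.Adj w u) : h u ≠ h w := by
  intro hh
  rcases H.pathEdge w u hu hh.symm with h1 | h1
  · obtain ⟨⟨i, rfl⟩, -⟩ := pathEdge_range h1
    exact hb ⟨i, rfl⟩
  · obtain ⟨⟨i, rfl⟩, -⟩ := pathEdge_range h1
    exact ht ⟨i, rfl⟩

theorem exists_adj (w : K.CutVertex γ) : ∃ u, (K.cut γ).graph.Adj w u := by
  obtain ⟨T, hT, hw⟩ := (K.cut γ).exists_tri w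
  obtain ⟨u, hu, hne⟩ := Finset.exists_mem_ne (by rw [(K.cut γ).card_tri T hT]; norm_num) w
  exact ⟨u, adj_of_mem hT hw hu hne.symm⟩

theorem exists_gt {w : K.CutVertex γ} (hb : w ∉ Set.range base) (ht : w ∉ Set.range top) :
    ∃ u, (K.cut γ).graph.Adj w u ∧ h w < h u := by
  obtain ⟨u, hu⟩ := H.exists_adj w
  exact exists_adj_gt_of_lap_eq_zero (H.cond.cut γ) (H.lap_eq_zero hb ht) hu (H.ne_of_adj hb ht hu)

theorem exists_lt {w : K.CutVertex γ} (hb : w ∉ Set.range base) (ht : w ∉ Set.range top) :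
    ∃ u, (K.cut γ).graph.Adj w u ∧ h u < h w := by
  obtain ⟨u, hu, hwu⟩ := H.swap.exists_gt ht hb
  exact ⟨u, hu, by linarith⟩

/-- A maximum off the base and the top would have a strictly higher neighbour. -/
theorem le_top (w : K.CutVertex γ) : h w ≤ p := by
  have : Nonempty (K.CutVertex γ) := ⟨w⟩
  obtain ⟨m, hm⟩ := Finite.exists_max h
  refine (hm w).trans ?_
  by_cases hb : m ∈ Set.range base
  · obtain ⟨i, rfl⟩ := hb
    rw [H.sol.on_base]
    exact H.pos.le
  by_cases ht : m ∈ Set.range top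
  · obtain ⟨i, rfl⟩ := ht
    rw [H.sol.on_top]
  obtain ⟨u, -, hu⟩ := H.exists_gt hb ht
  exact absurd (hm u) (not_le.2 hu)

theorem nonneg (w : K.CutVertex γ) : 0 ≤ h w := by
  have := H.swap.le_top w
  linarith

theorem lt_top {w : K.CutVertex γ} (ht : w ∉ Set.range top) : h w < p := by
  by_cases hb : w ∈ Set.range base
  · obtain ⟨i, rfl⟩ := hb
    rw [H.sol.on_base]
    exact H.pos
  · obtain ⟨u, -, hu⟩ := H.exists_gt hb ht
    exact hu.trans_le (H.le_top u)

theorem pos_of_notMem {w : K.CutVertex γ} (hb : w ∉ Set.range base) : 0 < h w := by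
  have := H.swap.lt_top hb
  linarith

theorem mem_base {w : K.CutVertex γ} (hw : h w = 0) : ∃ i, base i = w := by
  by_contra hcon
  exact (H.pos_of_notMem hcon).ne' hw

theorem notMem_top (i : Fin (n + 1)) : base i ∉ Set.range top := by
  rintro ⟨j, hj⟩
  exact H.baseTop.base_ne_top H.inj i j hj.symm

theorem pathEdge_base {i : Fin (n + 1)} {u : K.CutVertex γ}
    (hu : (K.cut γ).graph.Adj (base i) u) (hh : h u = 0) : PathEdge base (base i) u := by
  rcases H.pathEdge _ _ hu (by rw [H.sol.on_base, hh]) with h1 | h1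
  · exact h1
  · exact absurd (pathEdge_range h1).1 fun ⟨j, hj⟩ => H.notMem_top i ⟨j, hj.symm⟩

theorem edgeDeg_le {a b : K.CutVertex γ} (hab : (K.cut γ).graph.Adj a b) :
    (K.cut γ).edgeDeg a b ≤ 2 :=
  (edgeDeg_cut_le a b).trans (H.annulus.edgeDeg_le (cutProj_ne hab))

/-- Adjacent vertices of the base have the same value of `h`, so they span an edge of the path and
have consecutive indices. Three indices cannot be pairwise consecutive. -/
theorem not_three_base {T : Finset (K.CutVertex γ)} (hT : T ∈ (K.cut γ).tri) {i j l : Fin (n + 1)}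
    (hij : i ≠ j) (hil : i ≠ l) (hjl : j ≠ l) (hi : base i ∈ T) (hj : base j ∈ T)
    (hl : base l ∈ T) : False := by
  have key : ∀ i j, i ≠ j → base i ∈ T → base j ∈ T → i.1 + 1 = j.1 ∨ j.1 + 1 = i.1 :=
    fun i j hij hi hj => pathEdge_index H.base_injective
      (H.pathEdge_base (adj_of_mem hT hi hj (H.base_injective.ne hij)) (H.sol.on_base j))
  have := key i j hij hi hj
  have := key i l hil hi hl
  have := key j l hjl hj hl
  omega

theorem exists_pos {T : Finset (K.CutVertex γ)} (hT : T ∈ (K.cut γ).tri) : ∃ a ∈ T, 0 < h a := by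
  classical
  by_contra hcon
  push Not at hcon
  obtain ⟨a, b, d, hab, had, hbd, rfl⟩ := Finset.card_eq_three.1 ((K.cut γ).card_tri T hT)
  have key : ∀ w ∈ ({a, b, d} : Finset _), ∃ i, base i = w := fun w hw =>
    H.mem_base (le_antisymm (hcon w hw) (H.nonneg w))
  obtain ⟨i, rfl⟩ := key a (by simp)
  obtain ⟨j, rfl⟩ := key b (by simp)
  obtain ⟨l, rfl⟩ := key d (by simp)
  exact H.not_three_base hT (i := i) (j := j) (l := l) (fun e => hab (by rw [e])) (fun e => had (by rw [e]))
    (fun e => hbd (by rw [e])) (by simp) (by simp) (by simp)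

/-- The edges of a flat triangle would belong to the base or the top, at value `0` or `p`. But each
triangle has a vertex above `0` and one below `p`. -/
theorem exists_lt_of_mem_tri {T : Finset (K.CutVertex γ)} (hT : T ∈ (K.cut γ).tri) :
    ∃ a ∈ T, ∃ b ∈ T, h a < h b := by
  by_contra hcon
  push Not at hcon
  obtain ⟨a, ha, ha0⟩ := H.exists_pos hT
  obtain ⟨b, hb, hb0⟩ := H.swap.exists_pos hT
  obtain ⟨d, hd, hda⟩ := Finset.exists_mem_ne (by rw [(K.cut γ).card_tri T hT]; norm_num) a
  have e := hcon b hb a ha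
  rcases H.pathEdge a d (adj_of_mem hT ha hd hda.symm)
    (le_antisymm (hcon d hd a ha) (hcon a ha d hd)) with h1 | h1
  · obtain ⟨⟨i, rfl⟩, -⟩ := pathEdge_range h1
    rw [H.sol.on_base] at ha0
    exact lt_irrefl _ ha0
  · obtain ⟨⟨i, rfl⟩, -⟩ := pathEdge_range h1
    rw [H.sol.on_top] at e
    linarith

end IsCutAnnulus

end TriComplex

/-! ### Counting middle vertices -/

namespace TriComplex

open Relation

variable {V : Type*} [Fintype V] {K : TriComplex V}

set_option linter.unusedSectionVars false

namespace IsCutAnnulus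

variable {E₁ E₂ : Finset V} {c : V → V → ℝ} {p : ℝ} {n : ℕ} {γ : Fin (n + 1) → V}
  {base top : Fin (n + 1) → K.CutVertex γ} {h : K.CutVertex γ → ℝ}
  (H : K.IsCutAnnulus E₁ E₂ c p γ base top h)

include H

/-! ### The number of middle vertices -/

theorem base_edge_unique {T : Finset (K.CutVertex γ)} (hT : T ∈ (K.cut γ).tri) {i j : Fin n}
    (hi : base i.castSucc ∈ T ∧ base i.succ ∈ T) (hj : base j.castSucc ∈ T ∧ base j.succ ∈ T) :
    i = j := by
  by_contra hij
  have hij' : i.1 ≠ j.1 := fun e => hij (Fin.ext e)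
  rcases hij'.lt_or_gt with hlt | hlt
  · refine H.not_three_base hT (i := i.castSucc) (j := i.succ) (l := j.succ) ?_ ?_ ?_ hi.1 hi.2 hj.2
    all_goals
      simp only [ne_eq, Fin.ext_iff, Fin.val_castSucc, Fin.val_succ]
      omega
  · refine H.not_three_base hT (i := j.castSucc) (j := j.succ) (l := i.succ) ?_ ?_ ?_ hj.1 hj.2 hi.2
    all_goals
      simp only [ne_eq, Fin.ext_iff, Fin.val_castSucc, Fin.val_succ]
      omega

theorem ne_succ (i : Fin n) : base i.castSucc ≠ base i.succ := (H.baseTop.adj_base i).1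

open Classical in
/-- A triangle has a middle vertex, or an edge on the base, or an edge on the top. -/
theorem card_filter_le_one {T : Finset (K.CutVertex γ)} (hT : T ∈ (K.cut γ).tri) :
    (Finset.univ.filter fun w => T ∈ (K.cut γ).mid h w).card +
      (Finset.univ.filter fun i : Fin n => base i.castSucc ∈ T ∧ base i.succ ∈ T).card +
      (Finset.univ.filter fun i : Fin n => top i.castSucc ∈ T ∧ top i.succ ∈ T).card ≤ 1 := by
  classical
  have hmid : ∀ w w', T ∈ (K.cut γ).mid h w → T ∈ (K.cut γ).mid h w' → w = w' := by
    intro w w' hw hw'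
    obtain ⟨-, h1, ⟨a, ha, haw⟩, b, hb, hwb⟩ := mem_mid.1 hw
    obtain ⟨-, h2, ⟨a', ha', haw'⟩, b', hb', hwb'⟩ := mem_mid.1 hw'
    obtain ⟨x, y, z, -, -, -, rfl, hxy, hyz⟩ := exists_sorted ((K.cut γ).card_tri T hT) h
    simp only [Finset.mem_insert, Finset.mem_singleton] at h1 ha hb h2 ha' hb'
    have key : ∀ u ∈ ({x, y, z} : Finset (K.CutVertex γ)), h x ≤ h u ∧ h u ≤ h z := by
      intro u hu
      simp only [Finset.mem_insert, Finset.mem_singleton] at hu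
      rcases hu with rfl | rfl | rfl <;> constructor <;> linarith
    have k1 := (key a (by simpa using ha)).1.trans_lt haw
    have k2 := hwb.trans_le (key b (by simpa using hb)).2
    have k3 := (key a' (by simpa using ha')).1.trans_lt haw'
    have k4 := hwb'.trans_le (key b' (by simpa using hb')).2
    have e1 : w = y := by
      rcases h1 with rfl | rfl | rfl
      exacts [absurd k1 (lt_irrefl _), rfl, absurd k2 (lt_irrefl _)]
    have e2 : w' = y := by
      rcases h2 with rfl | rfl | rfl
      exacts [absurd k3 (lt_irrefl _), rfl, absurd k4 (lt_irrefl _)]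
    rw [e1, e2]
  have h4 : ∀ {a b x y : K.CutVertex γ}, a ∈ T → b ∈ T → x ∈ T → y ∈ T → a ≠ b → a ≠ x → a ≠ y →
      b ≠ x → b ≠ y → x ≠ y → False := by
    intro a b x y ha hb hx hy hab hax hay hbx hby hxy
    have hsub : ({a, b, x, y} : Finset (K.CutVertex γ)) ⊆ T := by
      intro u hu
      simp only [Finset.mem_insert, Finset.mem_singleton] at hu
      rcases hu with rfl | rfl | rfl | rfl <;> assumption
    have hcard := Finset.card_le_card hsub
    rw [(K.cut γ).card_tri T hT, Finset.card_insert_of_notMem (by simp [hab, hax, hay]),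
      Finset.card_insert_of_notMem (by simp [hbx, hby]),
      Finset.card_insert_of_notMem (by simp [hxy]), Finset.card_singleton] at hcard
    omega
  have hbt : ∀ i j, base i ≠ top j := H.baseTop.base_ne_top H.inj
  have c1 : (Finset.univ.filter fun w => T ∈ (K.cut γ).mid h w).card ≤ 1 :=
    Finset.card_le_one.2 fun w hw w' hw' => hmid w w' (by simpa using hw) (by simpa using hw')
  have c2 : (Finset.univ.filter fun i : Fin n => base i.castSucc ∈ T ∧ base i.succ ∈ T).card ≤ 1 :=
    Finset.card_le_one.2 fun i hi j hj =>
      H.base_edge_unique hT (by simpa using hi) (by simpa using hj)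
  have c3 : (Finset.univ.filter fun i : Fin n => top i.castSucc ∈ T ∧ top i.succ ∈ T).card ≤ 1 :=
    Finset.card_le_one.2 fun i hi j hj =>
      H.swap.base_edge_unique hT (by simpa using hi) (by simpa using hj)
  -- A middle vertex, a vertex above it and the two ends of a base edge would be four vertices of
  -- one triangle.
  have d12 : ∀ w, T ∈ (K.cut γ).mid h w → ∀ i : Fin n, ¬ (base i.castSucc ∈ T ∧ base i.succ ∈ T) := by
    intro w hw i hi
    obtain ⟨-, hwT, ⟨a, ha, haw⟩, b, hb, hwb⟩ := mem_mid.1 hw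
    have := H.nonneg a
    have e1 := H.sol.on_base i.castSucc
    have e2 := H.sol.on_base i.succ
    exact h4 hwT hb hi.1 hi.2 (by rintro rfl; exact lt_irrefl _ hwb)
      (by rintro rfl; linarith) (by rintro rfl; linarith) (by rintro rfl; linarith)
      (by rintro rfl; linarith) (H.ne_succ i)
  have d13 : ∀ w, T ∈ (K.cut γ).mid h w → ∀ i : Fin n, ¬ (top i.castSucc ∈ T ∧ top i.succ ∈ T) := by
    intro w hw i hi
    obtain ⟨-, hwT, ⟨a, ha, haw⟩, b, hb, hwb⟩ := mem_mid.1 hw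
    have := H.le_top b
    have e1 := H.sol.on_top i.castSucc
    have e2 := H.sol.on_top i.succ
    exact h4 hwT ha hi.1 hi.2 (by rintro rfl; exact lt_irrefl _ haw)
      (by rintro rfl; linarith) (by rintro rfl; linarith) (by rintro rfl; linarith)
      (by rintro rfl; linarith) (H.swap.ne_succ i)
  have d23 : ∀ i j : Fin n, (base i.castSucc ∈ T ∧ base i.succ ∈ T) →
      ¬ (top j.castSucc ∈ T ∧ top j.succ ∈ T) := fun i j hi hj =>
    h4 hi.1 hi.2 hj.1 hj.2 (H.ne_succ i) (hbt _ _) (hbt _ _) (hbt _ _) (hbt _ _) (H.swap.ne_succ j)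
  by_cases e1 : ∃ w, T ∈ (K.cut γ).mid h w
  · obtain ⟨w, hw⟩ := e1
    rw [Finset.filter_false_of_mem fun i _ => d12 w hw i,
      Finset.filter_false_of_mem fun i _ => d13 w hw i]
    simpa using c1
  · rw [Finset.filter_false_of_mem fun w _ hw => e1 ⟨w, hw⟩]
    by_cases e2 : ∃ i : Fin n, base i.castSucc ∈ T ∧ base i.succ ∈ T
    · obtain ⟨i, hi⟩ := e2
      rw [Finset.filter_false_of_mem fun j _ => d23 i j hi]
      simpa using c2
    · rw [Finset.filter_false_of_mem fun i _ hi => e2 ⟨i, hi⟩]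
      simpa using c3

/-- Sum the bound for single triangles: each of the `n` edges of the base and of the `n` edges of
the top lies in at least one triangle. -/
theorem sum_card_mid_le : ∑ w, ((K.cut γ).mid h w).card + 2 * n ≤ (K.cut γ).triangles.card := by
  classical
  have h1 := Finset.sum_le_sum fun T (hT : T ∈ (K.cut γ).triangles) =>
    H.card_filter_le_one (mem_triangles.1 hT)
  rw [Finset.sum_add_distrib, Finset.sum_add_distrib, Finset.sum_const, smul_eq_mul, mul_one] at h1
  have h2 : ∀ β : Fin (n + 1) → K.CutVertex γ,
      (∀ i : Fin n, (K.cut γ).graph.Adj (β i.castSucc) (β i.succ)) →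
      n ≤ ∑ T ∈ (K.cut γ).triangles,
        (Finset.univ.filter fun i : Fin n => β i.castSucc ∈ T ∧ β i.succ ∈ T).card := by
    intro β hβ
    simp only [Finset.card_filter]
    rw [Finset.sum_comm]
    calc n = ∑ _i : Fin n, 1 := by simp
      _ ≤ _ := Finset.sum_le_sum fun i _ => ?_
    rw [← Finset.card_filter]
    obtain ⟨-, T, hT, h3⟩ := hβ i
    exact Finset.card_pos.2 ⟨T, by simpa [mem_triangles] using ⟨hT, h3⟩⟩
  have h3 : ∑ T ∈ (K.cut γ).triangles, (Finset.univ.filter fun w => T ∈ (K.cut γ).mid h w).card =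
      ∑ w, ((K.cut γ).mid h w).card := by
    simp only [Finset.card_filter]
    rw [Finset.sum_comm]
    refine Finset.sum_congr rfl fun w _ => ?_
    rw [← Finset.card_filter]
    congr 1
    ext T
    simp only [Finset.mem_filter, mem_triangles, mem_mid]
    tauto
  have h4 := h2 base H.baseTop.adj_base
  have h5 := h2 top H.baseTop.adj_top
  omega

theorem notMem_base_of_proj {w : K.CutVertex γ} (hw : K.cutProj γ w ∉ Set.range γ) :
    w ∉ Set.range base := by
  rintro ⟨i, rfl⟩
  exact hw ⟨i, (H.baseTop.proj_base i).symm⟩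

theorem edgeDeg_eq {w u : K.CutVertex γ} (hw : K.cutProj γ w ∉ Set.range γ)
    (hu : (K.cut γ).graph.Adj w u) :
    (K.cut γ).edgeDeg w u = K.edgeDeg (K.cutProj γ w) (K.cutProj γ u) :=
  edgeDeg_cut_eq hu fun h1 => hw (by
    obtain ⟨⟨i, hi⟩, -⟩ := pathEdge_range h1
    exact ⟨i, hi.symm⟩)

theorem edgeDeg_eq_two {w : K.CutVertex γ} (hw : K.cutProj γ w ∉ Set.range γ)
    (hE : ¬ (K.cutProj γ w ∈ E₁ ∨ K.cutProj γ w ∈ E₂)) {u : K.CutVertex γ}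
    (hu : (K.cut γ).graph.Adj w u) : (K.cut γ).edgeDeg w u = 2 := by
  have h1 := H.edgeDeg_le hu
  have h2 := edgeDeg_pos hu
  have h3 : (K.cut γ).edgeDeg w u ≠ 1 := by
    rw [H.edgeDeg_eq hw hu]
    intro h4
    exact hE ((H.annulus.mem_boundary _).2 ⟨_, (edgeDeg_eq_one_iff (cutProj_ne hu)).1 h4⟩)
  omega

/-- These are the local lower bounds, by connectedness and parity of the link. The count in
`card_mid` makes them equalities. -/
theorem le_card_mid {w : K.CutVertex γ} (hw : K.cutProj γ w ∉ Set.range γ) :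
    (2 ≤ ((K.cut γ).mid h w).card) ∨
      ((K.cutProj γ w ∈ E₁ ∨ K.cutProj γ w ∈ E₂) ∧ 1 ≤ ((K.cut γ).mid h w).card) := by
  have hb := H.notMem_base_of_proj hw
  have ht := H.swap.notMem_base_of_proj hw
  by_cases hE : K.cutProj γ w ∈ E₁ ∨ K.cutProj γ w ∈ E₂
  · exact Or.inr ⟨hE, Finset.card_pos.2 ((linkConnected_cut K γ).mid_nonempty
      (fun u => H.ne_of_adj hb ht) (H.exists_gt hb ht) (H.exists_lt hb ht))⟩
  · exact Or.inl ((linkConnected_cut K γ).two_le_mid (fun u => H.ne_of_adj hb ht)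
      (H.exists_gt hb ht) (H.exists_lt hb ht) fun u => H.edgeDeg_eq_two hw hE)

open Classical in
-- Give weight `1` to boundary vertices and `2` to the others, in total `2|V| - |E₁| - |E₂|`. The
-- path takes at most `2n` of it, since at least two of its `n + 1` vertices are on the boundary.
theorem card_le_sum : 2 * Fintype.card V ≤ 2 * n + E₁.card + E₂.card +
    ∑ v ∈ Finset.univ.filter (fun v => v ∉ Set.range γ), if v ∈ E₁ ∪ E₂ then 1 else 2 := by
  have h1 : ∑ v : V, ((if v ∈ E₁ ∪ E₂ then 1 else 2) + if v ∈ E₁ ∪ E₂ then 1 else 0) =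
      2 * Fintype.card V := by
    rw [Finset.sum_congr rfl (g := fun _ => 2), Finset.sum_const, smul_eq_mul, mul_comm]
    · rfl
    · intro v _
      split_ifs <;> rfl
  rw [Finset.sum_add_distrib, ← Finset.card_filter, Finset.filter_mem_eq_inter, Finset.univ_inter,
    Finset.card_union_of_disjoint H.annulus.disjoint] at h1
  have h2 := Finset.sum_filter_add_sum_filter_not Finset.univ (fun v => v ∉ Set.range γ)
    fun v => if v ∈ E₁ ∪ E₂ then 1 else 2
  have h3 : Finset.univ.filter (fun v => ¬ v ∉ Set.range γ) = Finset.univ.image γ := by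
    ext v
    simp
  have h4 : ∑ v ∈ Finset.univ.image γ, (if v ∈ E₁ ∪ E₂ then 1 else 2) ≤ 2 * n := by
    rw [Finset.sum_image fun i _ j _ hij => H.inj hij]
    have h5 : ∑ i, ((if γ i ∈ E₁ ∪ E₂ then 1 else 2) + if γ i ∈ E₁ ∪ E₂ then 1 else 0) =
        2 * (n + 1) := by
      rw [Finset.sum_congr rfl (g := fun _ => 2), Finset.sum_const, smul_eq_mul, mul_comm]
      · simp
      · intro v _
        split_ifs <;> rfl
    rw [Finset.sum_add_distrib, ← Finset.card_filter] at h5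
    have h6 : ({0, Fin.last n} : Finset (Fin (n + 1))) ⊆
        Finset.univ.filter fun i => γ i ∈ E₁ ∪ E₂ := by
      intro i hi
      simp only [Finset.mem_insert, Finset.mem_singleton] at hi
      simp only [Finset.mem_filter, Finset.mem_univ, true_and, Finset.mem_union, H.mem_outer_iff,
        H.mem_inner_iff]
      exact hi
    have h7 := Finset.card_le_card h6
    rw [Finset.card_pair] at h7
    · omega
    · intro e
      have := congrArg Fin.val e
      simp only [Fin.val_zero, Fin.val_last] at this
      exact H.length_ne_zero this.symm
  rw [h3] at h2
  omega

/-- Away from the base and the top, every vertex lies over a vertex outside the path, and is the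
middle vertex of exactly two triangles, or of one triangle if it lies on the boundary. -/
theorem card_mid {w : K.CutVertex γ} (hb : w ∉ Set.range base) (ht : w ∉ Set.range top) :
    K.cutProj γ w ∉ Set.range γ ∧ (((K.cutProj γ w ∈ E₁ ∨ K.cutProj γ w ∈ E₂) ∧
      ((K.cut γ).mid h w).card = 1) ∨
      (¬ (K.cutProj γ w ∈ E₁ ∨ K.cutProj γ w ∈ E₂) ∧ ((K.cut γ).mid h w).card = 2)) := by
  classical
  have hex : ∀ v, ∃ w, K.cutProj γ w = v := fun v => by
    obtain ⟨T, hT, hv⟩ := K.exists_tri v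
    exact ⟨K.cutMk γ T hT v hv, rfl⟩
  -- One lift of each vertex suffices for the lower bound. That there are no further vertices off
  -- the base and the top is part of the outcome.
  choose l hl using hex
  set A := Finset.univ.filter fun v => v ∉ Set.range γ with hA
  have hmA : ∀ v, v ∈ A ↔ v ∉ Set.range γ := fun v => by simp [hA]
  have hinj : Function.Injective l := fun v v' e => by rw [← hl v, ← hl v', e]
  set m : K.CutVertex γ → ℕ := fun w => ((K.cut γ).mid h w).card with hm
  have h1 : ∑ w, m w + 2 * n ≤ (K.cut γ).triangles.card := H.sum_card_mid_le
  have h2 := H.annulus.card_triangles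
  have h3 := card_triangles_cut_le (K := K) (γ := γ)
  have h4 := H.card_le_sum
  rw [← hA] at h4
  have h5 : ∀ v ∈ A, (if v ∈ E₁ ∪ E₂ then 1 else 2) ≤ m (l v) := by
    intro v hv
    have h6 := H.le_card_mid (w := l v) (by rw [hl]; exact (hmA v).1 hv)
    rw [hl, ← Finset.mem_union] at h6
    split_ifs with h7
    · rcases h6 with h6 | h6
      · exact le_trans (by norm_num) h6
      · exact h6.2
    · rcases h6 with h6 | h6
      · exact h6
      · exact absurd h6.1 h7
  have h6 := Finset.sum_le_sum h5
  have h7 : ∑ v ∈ A, m (l v) = ∑ w ∈ A.image l, m w :=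
    (Finset.sum_image fun v _ v' _ e => hinj e).symm
  have h8 : ∑ w ∈ A.image l, m w + ∑ w ∈ Finset.univ \ A.image l, m w = ∑ w, m w := by
    rw [add_comm]
    exact Finset.sum_sdiff (Finset.subset_univ _)
  -- The upper bound from the triangles equals the lower bound from the vertices outside the path,
  -- so there is equality throughout.
  have h9 : ∑ w ∈ Finset.univ \ A.image l, m w = 0 := by omega
  have h10 : ∑ v ∈ A, (if v ∈ E₁ ∪ E₂ then 1 else 2) = ∑ v ∈ A, m (l v) := by omega
  have h11 := (Finset.sum_eq_sum_iff_of_le h5).1 h10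
  -- Vertices other than the chosen lifts are the middle vertex of no triangle, whereas the maximum
  -- principle provides such a triangle for `w`.
  have h12 : w ∈ A.image l := by
    by_contra hcon
    have := Finset.sum_eq_zero_iff.1 h9 w (by simpa using hcon)
    have h13 := Finset.card_pos.2 ((linkConnected_cut K γ).mid_nonempty
      (fun u => H.ne_of_adj hb ht) (H.exists_gt hb ht) (H.exists_lt hb ht))
    simp only [hm] at this
    omega
  obtain ⟨v, hv, rfl⟩ := Finset.mem_image.1 h12
  have h13 := h11 v hv
  rw [hl]
  refine ⟨(hmA v).1 hv, ?_⟩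
  simp only [Finset.mem_union] at h13
  split_ifs at h13 with h14
  · exact Or.inl ⟨h14, h13.symm⟩
  · exact Or.inr ⟨h14, h13.symm⟩

end IsCutAnnulus

end TriComplex

/-! ### The cut annulus as a quadrilateral -/

namespace TriComplex

open AffineMap Set Relation

variable {V : Type*} [Fintype V] {K : TriComplex V}

set_option linter.unusedSectionVars false

/-- `E` is one of the boundary components, and `i₀` is the index of the vertex on it of a path
from `E₁` to `E₂`. -/
def IsEnd (E₁ E₂ E : Finset V) {n : ℕ} (i₀ : Fin (n + 1)) : Prop :=
  E = E₁ ∧ i₀ = 0 ∨ E = E₂ ∧ i₀ = Fin.last n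

namespace IsCutAnnulus

variable {E₁ E₂ : Finset V} {c : V → V → ℝ} {p : ℝ} {n : ℕ} {γ : Fin (n + 1) → V}
  {base top : Fin (n + 1) → K.CutVertex γ} {h : K.CutVertex γ → ℝ}
  (H : K.IsCutAnnulus E₁ E₂ c p γ base top h)

include H

/-! ### Regularity of the level curves -/

theorem through_mem_mid {w : K.CutVertex γ} (hb : w ∉ range base) (ht : w ∉ range top)
    {T : Finset (K.CutVertex γ)} (hT : (K.cut γ).Through h w T) : T ∈ (K.cut γ).mid h w := by
  obtain ⟨hT, hw, ⟨a, ha, haw, hah⟩, b, hb', hbw, hbh⟩ := hT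
  exact mem_mid.2 ⟨hT, hw,
    ⟨a, ha, hah.lt_of_ne (H.ne_of_adj hb ht (adj_of_mem hT hw ha haw.symm))⟩,
    b, hb', hbh.lt_of_ne' (H.ne_of_adj hb ht (adj_of_mem hT hw hb' hbw.symm))⟩

/-- Nothing lies below the base, so a neighbour that is not higher is at level `0` and is joined to
`base i` by an edge of the base. -/
theorem through_base {i : Fin (n + 1)} {T : Finset (K.CutVertex γ)}
    (hT : (K.cut γ).Through h (base i) T) : ∃ a ∈ T, PathEdge base (base i) a := by
  obtain ⟨hT, hw, ⟨a, ha, haw, hah⟩, -⟩ := hT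
  rw [H.sol.on_base] at hah
  exact ⟨a, ha, H.pathEdge_base (adj_of_mem hT hw ha haw.symm) (le_antisymm hah (H.nonneg a))⟩

theorem through_swap {w : K.CutVertex γ} {T : Finset (K.CutVertex γ)}
    (hT : (K.cut γ).Through h w T) : (K.cut γ).Through (fun w => p - h w) w T := by
  obtain ⟨hT, hw, ⟨a, ha, haw, hah⟩, b, hb, hbw, hbh⟩ := hT
  exact ⟨hT, hw, ⟨b, hb, hbw, by linarith⟩, a, ha, haw, by linarith⟩

theorem eq_of_through_base {i : Fin (n + 1)} {T₁ T₂ : Finset (K.CutVertex γ)}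
    (h₁ : (K.cut γ).Through h (base i) T₁) (h₂ : (K.cut γ).Through h (base i) T₂)
    {a : K.CutVertex γ} (ha : PathEdge base (base i) a) (ha₁ : a ∈ T₁) (ha₂ : a ∈ T₂) : T₁ = T₂ :=
  eq_of_edgeDeg_le_one (H.baseTop.edgeDeg_base H.annulus ha) h₁.1 h₁.2.1 ha₁ h₂.1 h₂.2.1 ha₂

/-- A vertex of the path has at most two edges of the path, and each of these lies in one triangle
of the cut complex. -/
theorem through_base_le {i : Fin (n + 1)} {T₁ T₂ T₃ : Finset (K.CutVertex γ)}
    (h₁ : (K.cut γ).Through h (base i) T₁) (h₂ : (K.cut γ).Through h (base i) T₂)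
    (h₃ : (K.cut γ).Through h (base i) T₃) : T₁ = T₂ ∨ T₁ = T₃ ∨ T₂ = T₃ := by
  obtain ⟨a₁, m₁, e₁⟩ := H.through_base h₁
  obtain ⟨a₂, m₂, e₂⟩ := H.through_base h₂
  obtain ⟨a₃, m₃, e₃⟩ := H.through_base h₃
  rcases pathEdge_le_two H.base_injective e₁ e₂ e₃ with rfl | rfl | rfl
  · exact Or.inl (H.eq_of_through_base h₁ h₂ e₁ m₁ m₂)
  · exact Or.inr (Or.inl (H.eq_of_through_base h₁ h₃ e₁ m₁ m₃))
  · exact Or.inr (Or.inr (H.eq_of_through_base h₂ h₃ e₂ m₂ m₃))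

theorem exists_up (v : K.CutVertex γ) (hv : ∃ u, h v < h u) :
    ∃ u, (K.cut γ).graph.Adj v u ∧ h v < h u := by
  by_cases ht : v ∈ range top
  · obtain ⟨i, rfl⟩ := ht
    obtain ⟨u, hu⟩ := hv
    rw [H.sol.on_top] at hu
    exact absurd (H.le_top u) (not_le.2 hu)
  by_cases hb : v ∈ range base
  · obtain ⟨i, rfl⟩ := hb
    obtain ⟨T, hT, hi⟩ := (K.cut γ).exists_tri (base i)
    obtain ⟨a, ha, ha0⟩ := H.exists_pos hT
    have : h (base i) < h a := by rwa [H.sol.on_base]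
    exact ⟨a, adj_of_mem_lt hT hi ha this, this⟩
  · exact H.exists_gt hb ht

/-- On the base this is the case of a minimum with horizontal boundary edges. Elsewhere the exact
numbers of middle triangles exclude a second component. -/
theorem up_connected (v u u' : K.CutVertex γ) (hu : (K.cut γ).graph.Adj v u) (hvu : h v < h u)
    (hu' : (K.cut γ).graph.Adj v u') (hvu' : h v < h u') :
    ReflTransGen ((K.cut γ).UpRel h v) u u' := by
  by_cases ht : v ∈ range top
  · obtain ⟨i, rfl⟩ := ht
    rw [H.sol.on_top] at hvu
    exact absurd (H.le_top u) (not_le.2 hvu)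
  by_cases hb : v ∈ range base
  · obtain ⟨i, rfl⟩ := hb
    refine (linkConnected_cut K γ).upLink_connected_of_min (fun w => ?_) (fun w hw hw0 => ?_)
      hu hvu hu' hvu'
    · rw [H.sol.on_base]
      exact H.nonneg w
    · rw [H.sol.on_base] at hw0
      exact H.baseTop.edgeDeg_base H.annulus (H.pathEdge_base hw hw0)
  · refine (linkConnected_cut K γ).upLink_connected (fun w => H.ne_of_adj hb ht)
      (H.exists_lt hb ht) ?_ hu hvu hu' hvu'
    obtain ⟨hγ, ⟨-, h1⟩ | ⟨hE, h1⟩⟩ := H.card_mid hb ht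
    · exact Or.inl h1.le
    · exact Or.inr ⟨h1.le, fun w => H.edgeDeg_eq_two hγ hE⟩

theorem levelRegular : (K.cut γ).LevelRegular h where
  exists_lt T hT := H.exists_lt_of_mem_tri hT
  horiz a b hab hh := by
    rcases H.pathEdge a b hab hh with h1 | h1
    · obtain ⟨⟨i, rfl⟩, -⟩ := pathEdge_range h1
      rw [H.sol.on_base]
      exact Or.inr H.nonneg
    · obtain ⟨⟨i, rfl⟩, -⟩ := pathEdge_range h1
      rw [H.sol.on_top]
      exact Or.inl H.le_top
  edge_le a b hab T₁ h₁ T₂ h₂ T₃ h₃ ha₁ hb₁ ha₂ hb₂ ha₃ hb₃ :=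
    eq_of_edgeDeg_le_two (H.edgeDeg_le (adj_of_mem h₁ ha₁ hb₁ hab)) h₁ ha₁ hb₁ h₂ ha₂ hb₂ h₃ ha₃ hb₃
  through_le v T₁ T₂ T₃ h₁ h₂ h₃ := by
    by_cases ht : v ∈ range top
    · obtain ⟨i, rfl⟩ := ht
      exact H.swap.through_base_le (H.through_swap h₁) (H.through_swap h₂) (H.through_swap h₃)
    by_cases hb : v ∈ range base
    · obtain ⟨i, rfl⟩ := hb
      exact H.through_base_le h₁ h₂ h₃
    · refine eq_of_card_le_two ?_ (H.through_mem_mid hb ht h₁) (H.through_mem_mid hb ht h₂)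
        (H.through_mem_mid hb ht h₃)
      obtain ⟨-, ⟨-, h1⟩ | ⟨-, h1⟩⟩ := H.card_mid hb ht <;> omega
  up_ne := H.exists_up
  up_conn := H.up_connected
  down_ne v hv := by
    obtain ⟨u, hu⟩ := hv
    obtain ⟨w, hw, hvw⟩ := H.swap.exists_up v ⟨u, by linarith⟩
    exact ⟨w, hw, by linarith⟩
  down_conn v u u' hu hvu hu' hvu' :=
    ReflTransGen.mono (fun y z hyz => ⟨by linarith [hyz.1], by linarith [hyz.2.1], hyz.2.2⟩) _ _
      (H.swap.up_connected v u u' hu (by linarith) hu' (by linarith))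

/-! ### The sides over the boundary of the annulus -/

theorem not_pathEdge_of_bdryAdj {a b : V} (hab : K.BdryAdj a b) : ¬ PathEdge γ a b := fun h1 =>
  H.baseTop.two_le_edgeDeg H.annulus h1 ((edgeDeg_eq_one_iff hab.1).2 hab)

theorem edgeDeg_of_bdryAdj {a b : K.CutVertex γ} (hab : (K.cut γ).graph.Adj a b)
    (hbd : K.BdryAdj (K.cutProj γ a) (K.cutProj γ b)) : (K.cut γ).edgeDeg a b ≤ 1 := by
  rw [edgeDeg_cut_eq hab (H.not_pathEdge_of_bdryAdj hbd), (edgeDeg_eq_one_iff hbd.1).2 hbd]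

theorem ne_of_bdryAdj {a b : K.CutVertex γ} (hab : (K.cut γ).graph.Adj a b)
    (hbd : K.BdryAdj (K.cutProj γ a) (K.cutProj γ b)) : h a ≠ h b := by
  intro hh
  have key : ∀ β : Fin (n + 1) → K.CutVertex γ, (∀ i, K.cutProj γ (β i) = γ i) →
      PathEdge β a b → PathEdge γ (K.cutProj γ a) (K.cutProj γ b) := by
    rintro β hβ ⟨i, ⟨rfl, rfl⟩ | ⟨rfl, rfl⟩⟩
    · exact ⟨i, Or.inl ⟨hβ _, hβ _⟩⟩
    · exact ⟨i, Or.inr ⟨hβ _, hβ _⟩⟩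
  refine H.not_pathEdge_of_bdryAdj hbd ?_
  rcases H.pathEdge a b hab hh with h1 | h1
  exacts [key base H.baseTop.proj_base h1, key top H.baseTop.proj_top h1]

/-- A boundary edge of the cut complex either comes from the boundary of the annulus or is a copy of
a path edge, and on the copies `h` is constant. -/
theorem bdryAdj_of_edgeDeg {a b : K.CutVertex γ} (hab : (K.cut γ).graph.Adj a b)
    (hne : h a ≠ h b) (hdeg : (K.cut γ).edgeDeg a b = 1) :
    K.BdryAdj (K.cutProj γ a) (K.cutProj γ b) := by
  rw [← edgeDeg_eq_one_iff (cutProj_ne hab), ← edgeDeg_cut_eq hab, hdeg]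
  intro h1
  rcases H.baseTop.pathEdge_of_proj H.annulus hab h1 with h2 | h2
  · obtain ⟨⟨i, rfl⟩, j, rfl⟩ := pathEdge_range h2
    exact hne (by rw [H.sol.on_base, H.sol.on_base])
  · obtain ⟨⟨i, rfl⟩, j, rfl⟩ := pathEdge_range h2
    exact hne (by rw [H.sol.on_top, H.sol.on_top])

section Side

variable {E : Finset V} {i₀ : Fin (n + 1)} (hE : IsEnd E₁ E₂ E i₀)

include hE

theorem mem_end_iff (i : Fin (n + 1)) : γ i ∈ E ↔ i = i₀ := by
  rcases hE with ⟨rfl, rfl⟩ | ⟨rfl, rfl⟩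
  exacts [H.mem_outer_iff i, H.mem_inner_iff i]

theorem mem_end_of_bdryAdj {u v : V} (huv : K.BdryAdj u v) (hu : u ∈ E) : v ∈ E := by
  rcases hE with ⟨rfl, -⟩ | ⟨rfl, -⟩
  exacts [H.annulus.closed₁ u v huv hu, H.annulus.closed₂ u v huv hu]

theorem eq_corner {w : K.CutVertex γ} (hw : K.cutProj γ w ∈ E) (hb : w ∈ range base) :
    w = base i₀ := by
  obtain ⟨i, rfl⟩ := hb
  rw [H.baseTop.proj_base, H.mem_end_iff hE] at hw
  rw [hw]

theorem through_base_unique {T₁ T₂ : Finset (K.CutVertex γ)}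
    (h₁ : (K.cut γ).Through h (base i₀) T₁) (h₂ : (K.cut γ).Through h (base i₀) T₂) : T₁ = T₂ := by
  obtain ⟨a₁, m₁, e₁⟩ := H.through_base h₁
  obtain ⟨a₂, m₂, e₂⟩ := H.through_base h₂
  obtain rfl := pathEdge_unique H.base_injective (hE.imp And.right And.right) e₁ e₂
  exact H.eq_of_through_base h₁ h₂ e₁ m₁ m₂

theorem card_mid_side {w : K.CutVertex γ} (hw : K.cutProj γ w ∈ E) (hb : w ∉ range base)
    (ht : w ∉ range top) : ((K.cut γ).mid h w).card = 1 := by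
  obtain ⟨-, ⟨-, h1⟩ | ⟨h1, -⟩⟩ := H.card_mid hb ht
  · exact h1
  · refine absurd ?_ h1
    rcases hE with ⟨rfl, -⟩ | ⟨rfl, -⟩
    exacts [Or.inl hw, Or.inr hw]

/-- This makes the vertices of a side end points of their level curves: off the corners there is one
middle triangle, and at a corner the path has only one edge. -/
theorem through_unique {w : K.CutVertex γ} (hw : K.cutProj γ w ∈ E)
    {T₁ T₂ : Finset (K.CutVertex γ)} (h₁ : (K.cut γ).Through h w T₁)
    (h₂ : (K.cut γ).Through h w T₂) : T₁ = T₂ := by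
  by_cases hb : w ∈ range base
  · obtain rfl := H.eq_corner hE hw hb
    exact H.through_base_unique hE h₁ h₂
  by_cases ht : w ∈ range top
  · obtain rfl := H.swap.eq_corner hE hw ht
    exact H.swap.through_base_unique hE (H.through_swap h₁) (H.through_swap h₂)
  · exact Finset.card_le_one.1 (H.card_mid_side hE hw hb ht).le _ (H.through_mem_mid hb ht h₁) _
      (H.through_mem_mid hb ht h₂)

/-- A vertex on a side, other than the upper corner, has a higher neighbour on this side. -/
theorem exists_up_side {w : K.CutVertex γ} (hw : K.cutProj γ w ∈ E) (ht : w ∉ range top) :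
    ∃ u, (K.cut γ).graph.Adj w u ∧ h w < h u ∧ K.BdryAdj (K.cutProj γ w) (K.cutProj γ u) := by
  suffices ∃ u, (K.cut γ).graph.Adj w u ∧ h w < h u ∧ (K.cut γ).edgeDeg w u = 1 by
    obtain ⟨u, h1, h2, h3⟩ := this
    exact ⟨u, h1, h2, H.bdryAdj_of_edgeDeg h1 h2.ne h3⟩
  by_cases hb : w ∈ range base
  · obtain rfl := H.eq_corner hE hw hb
    obtain ⟨j, hj⟩ := exists_pathEdge H.length_ne_zero base i₀
    have hadj : (K.cut γ).graph.Adj (base i₀) (base j) := by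
      obtain ⟨l, ⟨e1, e2⟩ | ⟨e1, e2⟩⟩ := hj
      · rw [e1, e2]
        exact H.baseTop.adj_base l
      · rw [e1, e2]
        exact (H.baseTop.adj_base l).symm
    have hdeg : (K.cut γ).edgeDeg (base i₀) (base j) = 1 :=
      le_antisymm (H.baseTop.edgeDeg_base H.annulus hj) (edgeDeg_pos hadj)
    -- The edge of the base is one boundary edge at the corner. A second one cannot be horizontal,
    -- because the path has only one edge at its end.
    obtain ⟨z, hz, hz1, hz2⟩ := exists_second_bdry (fun u => H.edgeDeg_le) hadj hdeg
    refine ⟨z, hz1, ?_, hz2⟩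
    rw [H.sol.on_base]
    refine (H.nonneg z).lt_of_ne' fun h0 => hz ?_
    exact pathEdge_unique H.base_injective (hE.imp And.right And.right)
      (H.pathEdge_base hz1 h0) hj
  · exact exists_up_bdry (fun u => H.ne_of_adj hb ht) (fun u => H.edgeDeg_le)
      (H.card_mid_side hE hw hb ht)

theorem edgeBody_subset_cutSide {a b : K.CutVertex γ} (hab : (K.cut γ).graph.Adj a b)
    (hbd : K.BdryAdj (K.cutProj γ a) (K.cutProj γ b)) (ha : K.cutProj γ a ∈ E) :
    edgeBody a b ⊆ K.cutSide γ E := fun _ hx =>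
  ⟨a, b, hab, hbd, ha, H.mem_end_of_bdryAdj hE hbd ha, hx⟩

/-- From the highest vertex of the side that is not above the level `s`, an ascending edge of the
side must reach or cross this level. -/
theorem exists_mem_cutSide {s : ℝ} (hs : 0 ≤ s) (hsp : s ≤ p) :
    ∃ x ∈ K.cutSide γ E, ext h x = s := by
  classical
  obtain ⟨w, hw, hmax⟩ := Finset.exists_max_image
    (Finset.univ.filter fun w => K.cutProj γ w ∈ E ∧ h w ≤ s) h
    ⟨base i₀, by simp [H.baseTop.proj_base, (H.mem_end_iff hE i₀).2 rfl, H.sol.on_base, hs]⟩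
  simp only [Finset.mem_filter, Finset.mem_univ, true_and] at hw hmax
  -- At the upper corner there is no ascending edge; then `s = p`, and the corner itself is the
  -- point.
  by_cases ht : w ∈ range top
  · have hps : h w = s := by
      obtain ⟨i, rfl⟩ := ht
      have := hw.2
      rw [H.sol.on_top] at this ⊢
      linarith
    have hb : w ∉ range base := by
      obtain ⟨i, rfl⟩ := ht
      exact H.swap.notMem_top i
    obtain ⟨u, hu, -, hbd⟩ := H.swap.exists_up_side hE hw.1 hb
    exact ⟨pt w, H.edgeBody_subset_cutSide hE hu hbd hw.1 (left_mem_edgeBody _ _),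
      by rw [ext_pt, hps]⟩
  · obtain ⟨u, hu, hlt, hbd⟩ := H.exists_up_side hE hw.1 ht
    have hsu : s ≤ h u := by
      by_contra hcon
      exact absurd (hmax u ⟨H.mem_end_of_bdryAdj hE hbd hw.1, (not_le.1 hcon).le⟩) (not_le.2 hlt)
    exact ⟨cross h w u s, H.edgeBody_subset_cutSide hE hu hbd hw.1 (cross_mem hlt hw.2 hsu),
      ext_cross hlt.ne s⟩

theorem isSide : (K.cut γ).IsSide h p (K.cutSide γ E) where
  edge := by
    rintro x ⟨a, b, hab, hbd, ha, hb, hx⟩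
    rcases (H.ne_of_bdryAdj hab hbd).lt_or_gt with h1 | h1
    · exact ⟨a, b, hab, h1, hx, H.edgeBody_subset_cutSide hE hab hbd ha⟩
    · rw [edgeBody_symm] at hx
      exact ⟨b, a, hab.symm, h1, hx, by
        rw [edgeBody_symm]
        exact H.edgeBody_subset_cutSide hE hab hbd ha⟩
  isEnd := by
    rintro x ⟨a, b, hab, hbd, ha, hb, hx⟩ y hy y' hy' ⟨hxy, T, hT, hxT, hyT⟩
      ⟨hxy', T', hT', hxT', hyT'⟩
    have hxs : x ∈ (K.cut γ).crossSet h (ext h x) := by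
      refine ⟨?_, rfl⟩
      rcases (H.ne_of_bdryAdj hab hbd).lt_or_gt with h1 | h1
      · exact ⟨a, b, hab, h1, hx⟩
      · exact ⟨b, a, hab.symm, h1, edgeBody_symm a b ▸ hx⟩
    have hTT : T = T' := by
      have key : ∀ w, K.cutProj γ w ∈ E → x = pt w → T = T' := by
        rintro w hw rfl
        rw [ext_pt] at hy hy'
        exact H.through_unique hE hw
          (through_of_mem hT (mem_of_pt_mem_faceBody hxT) hyT hxy.symm hy.2)
          (through_of_mem hT' (mem_of_pt_mem_faceBody hxT') hyT' hxy'.symm hy'.2)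
      rcases mem_face_of_mem_edgeBody hx hxT with h1 | h1 | h1
      · exact key a ha h1.1
      · exact key b hb h1.1
      rcases mem_face_of_mem_edgeBody hx hxT' with h2 | h2 | h2
      · exact key a ha h2.1
      · exact key b hb h2.1
      exact eq_of_edgeDeg_le_one (H.edgeDeg_of_bdryAdj hab hbd) hT h1.1 h1.2 hT' h2.1 h2.2
    subst hTT
    rcases H.levelRegular.eq_of_mem_face hT hxs hy hy' hxT hyT hyT' with h1 | h1 | h1
    exacts [absurd h1 hxy, absurd h1 hxy', h1]
  exists_mem s hs hsp := H.exists_mem_cutSide hE hs hsp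

end Side

theorem disjoint_cutSide : Disjoint (K.cutSide γ E₁) (K.cutSide γ E₂) := by
  classical
  rw [Set.disjoint_left]
  rintro x ⟨a, b, -, -, ha, hb, hx⟩ ⟨a', b', -, -, ha', hb', hx'⟩
  have hx2 : x ∈ faceBody ({a', b'} : Finset (K.CutVertex γ)) :=
    edgeBody_subset_faceBody (by simp) (by simp) hx'
  have key : ∀ w ∈ ({a', b'} : Finset (K.CutVertex γ)), K.cutProj γ w ∉ E₁ := by
    intro w hw h1
    simp only [Finset.mem_insert, Finset.mem_singleton] at hw
    rcases hw with rfl | rfl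
    exacts [Finset.disjoint_left.1 H.annulus.disjoint h1 ha',
      Finset.disjoint_left.1 H.annulus.disjoint h1 hb']
  rcases mem_face_of_mem_edgeBody hx hx2 with h1 | h1 | h1
  exacts [key a h1.2 ha, key b h1.2 hb, key a h1.1 ha]

/-! ### The base and the top -/

theorem crossSet_zero {u : K.CutVertex γ → ℝ} (hu : u ∈ (K.cut γ).crossSet h 0) :
    ∃ i, u = pt (base i) := by
  obtain ⟨⟨a, b, -, hab, hue⟩, hu0⟩ := hu
  have h1 := (ext_mem_of_mem_edgeBody hab.le hue).1
  have h2 : h a = 0 := le_antisymm (by linarith) (H.nonneg a)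
  obtain ⟨i, rfl⟩ := H.mem_base h2
  exact ⟨i, eq_left_of_ext_eq hab.ne hue (hu0.trans h2.symm)⟩

theorem linked_crossSet_zero : Linked (K.cut γ).ChordRel ((K.cut γ).crossSet h 0) := by
  have hmem : ∀ i, pt (base i) ∈ (K.cut γ).crossSet h 0 := fun i =>
    ⟨H.levelRegular.pt_cross _, by rw [ext_pt, H.sol.on_base]⟩
  have key : ∀ i, ReflTransGen (fun u v => u ∈ (K.cut γ).crossSet h 0 ∧
      v ∈ (K.cut γ).crossSet h 0 ∧ (K.cut γ).ChordRel u v) (pt (base 0)) (pt (base i)) := by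
    intro i
    induction i using Fin.induction with
    | zero => exact ReflTransGen.refl
    | succ i ih =>
      refine ih.tail ⟨hmem _, hmem _, ?_⟩
      obtain ⟨hne, T, hT, h1, h2⟩ := H.baseTop.adj_base i
      exact ⟨pt_injective.ne hne, T, hT, pt_mem_faceBody h1, pt_mem_faceBody h2⟩
  have : Std.Symm fun u v => u ∈ (K.cut γ).crossSet h 0 ∧
      v ∈ (K.cut γ).crossSet h 0 ∧ (K.cut γ).ChordRel u v :=
    ⟨fun u v huv => ⟨huv.2.1, huv.1, huv.2.2.symm⟩⟩
  intro x hx y hy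
  obtain ⟨i, rfl⟩ := H.crossSet_zero hx
  obtain ⟨j, rfl⟩ := H.crossSet_zero hy
  exact (ReflTransGen.stdSymm.symm _ _ (key i)).trans (key j)

/-- At level `0` the chord of a triangle has base vertices as its ends. They are equal or adjacent,
and adjacent ones span an edge of the base. -/
theorem mem_pathBody_base {u : K.CutVertex γ → ℝ} (hu : u ∈ (K.cut γ).body) :
    u ∈ pathBody base ↔ ext h u = 0 := by
  constructor
  · rintro ⟨i, hi⟩
    have h1 := ext_mem_of_mem_edgeBody (h := h)
      (by rw [H.sol.on_base, H.sol.on_base]) hi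
    rw [H.sol.on_base, H.sol.on_base] at h1
    exact le_antisymm h1.2 h1.1
  · intro hu0
    have edge : ∀ v w, PathEdge base v w → edgeBody v w ⊆ pathBody base := by
      rintro v w ⟨i, ⟨rfl, rfl⟩ | ⟨rfl, rfl⟩⟩ x hx
      · exact ⟨i, hx⟩
      · exact ⟨i, edgeBody_symm _ _ ▸ hx⟩
    obtain ⟨T, hT, huT⟩ := hu
    obtain ⟨q₁, h1, q₂, h2, h3, h4, t, ht, rfl⟩ := H.levelRegular.exists_lineMap hT huT
    rw [hu0] at h1 h2
    obtain ⟨i, rfl⟩ := H.crossSet_zero h1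
    obtain ⟨j, rfl⟩ := H.crossSet_zero h2
    by_cases hij : base i = base j
    · rw [← hij, lineMap_same_apply]
      obtain ⟨l, hl⟩ := exists_pathEdge H.length_ne_zero base i
      exact edge _ _ hl (left_mem_edgeBody _ _)
    · have hadj := adj_of_mem hT (mem_of_pt_mem_faceBody h3) (mem_of_pt_mem_faceBody h4) hij
      exact edge _ _ (H.pathEdge_base hadj (H.sol.on_base j)) (mem_edgeBody_iff.2 ⟨t, ht, rfl⟩)

theorem mem_pathBody_top {u : K.CutVertex γ → ℝ} (hu : u ∈ (K.cut γ).body) (hup : ext h u = p) :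
    u ∈ pathBody top := by
  rw [H.swap.mem_pathBody_base hu]
  obtain ⟨-, -, -, hu1, -⟩ := hu
  have h1 : ext (fun w => p - h w) u = p * ∑ w, u w - ext h u := by
    simp only [ext, Finset.mul_sum, ← Finset.sum_sub_distrib]
    exact Finset.sum_congr rfl fun w _ => by ring
  rw [h1, hu1, hup]
  ring

theorem isQuad : (K.cut γ).IsQuad h p (K.cutSide γ E₁) (K.cutSide γ E₂) where
  reg := H.levelRegular
  pos := H.pos
  nonneg := H.nonneg
  le := H.le_top
  exists_zero := ⟨_, H.sol.on_base 0⟩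
  exists_top := ⟨_, H.sol.on_top 0⟩
  linked := H.linked_crossSet_zero
  start_side := H.isSide (Or.inl ⟨rfl, rfl⟩)
  fin_side := H.isSide (Or.inr ⟨rfl, rfl⟩)
  disjoint := H.disjoint_cutSide

theorem cutSide_subset (E : Finset V) : K.cutSide γ E ⊆ (K.cut γ).body := by
  rintro x ⟨a, b, ⟨-, T, hT, haT, hbT⟩, -, -, -, hx⟩
  exact ⟨T, hT, edgeBody_subset_faceBody haT hbT hx⟩

end IsCutAnnulus

/-! ### Level curves of coordinates -/

namespace IsCoordinate

variable {h : V → ℝ} {p W : ℝ} {start fin : Set (V → ℝ)} {F : (V → ℝ) → ℝ}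
  (hC : K.IsCoordinate h p start fin W F)

include hC

theorem levelCurve_eq (hfin : fin ⊆ K.body) : K.levelCurve F W = fin := by
  ext u
  exact ⟨fun hu => (hC.fin_iff u hu.1).2 hu.2, fun hu => ⟨hfin hu, (hC.fin_iff u (hfin hu)).1 hu⟩⟩

/-- The arc is the image of a segment of the rectangle under the inverse coordinates. With `h`
proportional to the parameter, injectivity is clear and the ends lie at levels `0` and `p`. -/
theorem exists_arc (hp : 0 < p) {t : ℝ} (ht : (K.levelCurve F t).Nonempty) :
    ∃ σ : ℝ → V → ℝ, ContinuousOn σ (Icc 0 1) ∧ InjOn σ (Icc 0 1) ∧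
      σ '' Icc 0 1 = K.levelCurve F t ∧ ∀ r ∈ Icc (0 : ℝ) 1, ext h (σ r) = p * r := by
  obtain ⟨u, hu, rfl⟩ := ht
  obtain ⟨Φ, hΦ, hΦ'⟩ := hC.exists_inverse
  have hmem : ∀ r ∈ Icc (0 : ℝ) 1, p * r ∈ Icc 0 p := fun r hr =>
    ⟨mul_nonneg hp.le hr.1, mul_le_of_le_one_right hp.le hr.2⟩
  have hext : ∀ r ∈ Icc (0 : ℝ) 1, ext h (Φ (p * r, F u)) = p * r := fun r hr =>
    (hΦ' _ (hmem r hr) _ (hC.mem u hu).2).2.1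
  refine ⟨fun r => Φ (p * r, F u), hΦ.comp (by fun_prop) fun r hr =>
    ⟨hmem r hr, (hC.mem u hu).2⟩, fun r hr r' hr' e => ?_, ?_, hext⟩
  · have h1 := hext r hr
    simp only at e
    rw [e, hext r' hr'] at h1
    exact (mul_left_cancel₀ hp.ne' h1).symm
  · ext x
    constructor
    · rintro ⟨r, hr, rfl⟩
      have := hΦ' _ (hmem r hr) _ (hC.mem u hu).2
      exact ⟨this.1, this.2.2⟩
    · rintro ⟨hx, hxF⟩
      have hm := (hC.mem x hx).1
      have hr : ext h x / p ∈ Icc (0 : ℝ) 1 :=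
        ⟨div_nonneg hm.1 hp.le, (div_le_one hp).2 hm.2⟩
      have hr' : p * (ext h x / p) = ext h x := mul_div_cancel₀ _ hp.ne'
      have := hΦ' _ (hmem _ hr) _ (hC.mem u hu).2
      refine ⟨_, hr, hC.inj _ this.1 x hx ?_ ?_⟩
      · rw [this.2.1, hr']
      · rw [this.2.2, hxF]

theorem existsUnique_mem {s t : ℝ} (hs : (K.levelCurve (ext h) s).Nonempty)
    (ht : (K.levelCurve F t).Nonempty) :
    ∃! x, x ∈ K.levelCurve F t ∧ x ∈ K.levelCurve (ext h) s := by
  obtain ⟨u, hu, rfl⟩ := hs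
  obtain ⟨v, hv, rfl⟩ := ht
  have hm := hC.mem u hu
  have hm' := hC.mem v hv
  obtain ⟨x, hx, hx1, hx2⟩ := hC.exists_mem _ hm.1.1 hm.1.2 _ hm'.2.1 hm'.2.2
  exact ⟨x, ⟨⟨hx, hx2⟩, hx, hx1⟩, fun y hy =>
    hC.inj y hy.1.1 x hx (hy.2.2.trans hx1.symm) (hy.1.2.trans hx2.symm)⟩

end IsCoordinate

end TriComplex

theorem proposition4 {V : Type*} [Fintype V] (K : TriComplex V) (E₁ E₂ : Finset V)
    (hA : K.IsAnnulus E₁ E₂) (c : V → V → ℝ) (hc : K.IsConductance c)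
    (k : ℝ) (hk : 0 < k) (g : V → ℝ) (hg : K.IsDirichletSolution E₁ E₂ c k g)
    {n : ℕ} (γ : Fin (n + 1) → V) (hγ : K.IsSlit E₁ E₂ g γ)
    (base top : Fin (n + 1) → K.CutVertex γ) (hbt : K.IsBaseTop γ base top)
    (h : K.CutVertex γ → ℝ)
    (hh : K.IsHarmonicConjugate E₁ E₂ c (K.period E₁ c g) γ base top h)
    -- adjacent vertices have different `h`-values, unless they span an edge of the base or the top
    (hne : ∀ a b, (K.cut γ).graph.Adj a b → h a = h b →
      TriComplex.PathEdge base a b ∨ TriComplex.PathEdge top a b)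
    -- the values of `h` at the original vertices and at additional vertices inserted into edges
    (S : Finset ℝ) (hS : ∀ w, h w ∈ S) (hS' : ∀ s ∈ S, 0 ≤ s ∧ s ≤ K.period E₁ c g) :
    (∃ hstar : (K.CutVertex γ → ℝ) → ℝ, (K.cut γ).IsConjugate (K.cutCond γ c) h S
      (K.cutSide γ E₁) (TriComplex.pathBody base) hstar) ∧
    ∀ hstar : (K.CutVertex γ → ℝ) → ℝ, (K.cut γ).IsConjugate (K.cutCond γ c) h S
      (K.cutSide γ E₁) (TriComplex.pathBody base) hstar →
      -- the side over `E₂` is a level curve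
      (∃ width : ℝ, (K.cut γ).levelCurve hstar width = K.cutSide γ E₂) ∧
      -- each level curve is a simple arc which joins the base to the top
      (∀ t : ℝ, ((K.cut γ).levelCurve hstar t).Nonempty →
        ∃ σ : ℝ → K.CutVertex γ → ℝ, ContinuousOn σ (Set.Icc 0 1) ∧
          Set.InjOn σ (Set.Icc 0 1) ∧ σ '' Set.Icc 0 1 = (K.cut γ).levelCurve hstar t ∧
          σ 0 ∈ TriComplex.pathBody base ∧ σ 1 ∈ TriComplex.pathBody top) ∧
      -- different level curves are disjoint
      (∀ s t : ℝ, s ≠ t →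
        Disjoint ((K.cut γ).levelCurve hstar s) ((K.cut γ).levelCurve hstar t)) ∧
      -- each level curve of the conjugate function meets each level curve of `h` exactly once
      (∀ s t : ℝ, ((K.cut γ).levelCurve (TriComplex.ext h) s).Nonempty →
        ((K.cut γ).levelCurve hstar t).Nonempty →
        ∃! x, x ∈ (K.cut γ).levelCurve hstar t ∧
          x ∈ (K.cut γ).levelCurve (TriComplex.ext h) s) := by
  have hn := hγ.length_ne_zero hg hk
  have hp : 0 < K.period E₁ c g := by
    obtain ⟨m, rfl⟩ := Nat.exists_eq_succ_of_ne_zero hn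
    -- On the first edge of the slit `g` is not constant, so the energy is positive.
    exact hg.period_pos hc hk (hγ.adj 0) (hγ.anti (Fin.castSucc_lt_succ (i := 0))).ne'
  have H : K.IsCutAnnulus E₁ E₂ c (K.period E₁ c g) γ base top h :=
    { annulus := hA
      cond := hc
      pos := hp
      inj := hγ.injective
      mem_outer_iff := hγ.mem_outer_iff hg
      mem_inner_iff := hγ.mem_inner_iff hg
      length_ne_zero := hn
      baseTop := hbt
      sol := hh
      pathEdge := hne }
  -- Values strictly between `0` and the period exclude the base and the top, where alone `h` may
  -- fail to be harmonic.
  obtain ⟨hex, W, hW⟩ := H.isQuad.conjugate (hc.cut γ)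
    (fun w h0 h1 => H.lap_eq_zero
      (by rintro ⟨i, rfl⟩; exact h0.ne' (hh.on_base i))
      (by rintro ⟨i, rfl⟩; exact h1.ne (hh.on_top i)))
    hS hS' fun u => H.mem_pathBody_base
  refine ⟨hex, fun F hF => ?_⟩
  have hC := hW F hF
  refine ⟨⟨W, hC.levelCurve_eq (H.cutSide_subset E₂)⟩, fun t ht => ?_, fun s t hst => ?_,
    fun s t hs ht => hC.existsUnique_mem hs ht⟩
  · obtain ⟨σ, h1, h2, h3, h4⟩ := hC.exists_arc hp ht
    have hmem : ∀ r ∈ Set.Icc (0 : ℝ) 1, σ r ∈ (K.cut γ).body := fun r hr =>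
      (h3 ▸ Set.mem_image_of_mem σ hr : σ r ∈ (K.cut γ).levelCurve F t).1
    have h01 : (0 : ℝ) ∈ Set.Icc (0 : ℝ) 1 := ⟨le_rfl, zero_le_one⟩
    have h11 : (1 : ℝ) ∈ Set.Icc (0 : ℝ) 1 := ⟨zero_le_one, le_rfl⟩
    exact ⟨σ, h1, h2, h3, (H.mem_pathBody_base (hmem 0 h01)).2 (by rw [h4 0 h01, mul_zero]),
      H.mem_pathBody_top (hmem 1 h11) (by rw [h4 1 h11, mul_one])⟩
  · rw [Set.disjoint_left]
    exact fun x hx hx' => hst (hx.2.symm.trans hx'.2)
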